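/- Let $\alpha,\beta\in[0,1)$ be irrational numbers with bounded partial quotients (in their continued fraction expansions) such that the rotation $T(x,y)=(x+\alpha,y+\beta)$ of $\mathbb T^2=\mathbb R^2/\mathbb Z^2$ is ergodic with respect to Lebesgue measure $\lambda$. Let $f:\mathbb T^2\to(0,\infty)$ be of the form $$f(x,y)=f_1(x)+f_2(y)+g(x,y)+\gamma h(x,y),\qquad h(x,y)=\alpha\{y\}-(\{x\}+\alpha)\lfloor\{y\}+\beta\rfloor,$$ where $\gamma\in\mathbb R$, $g:\mathbb T^2\to\mathbb R$ is of class $C^2$, and $f_1,f_2:\mathbb T\to\mathbb R$ are discontinuous and piecewise $C^2$ (that is, $\mathbb T$ is cut by finitely many points into arcs such that on each open arc the function agrees with a $C^2$ function on the closed arc). For $i=1,2$ suppose that $f_i$ has exactly $s_i$ discontinuities, with jumps $d_{i,1},\dots,d_{i,s_i}$, where the jump is the left limit minus the right limit. Assume that $d_{1,1},\dots,d_{1,s_1},d_{2,1},\dots,d_{2,s_2}$ are linearly independent over $\mathbb Q$, and that one of the following holds: (i) $\gamma,d_{1,1},\dots,d_{1,s_1},d_{2,1},\dots,d_{2,s_2}$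 are linearly independent over $\mathbb Q$, and $\sum_{j=1}^{s_1}d_{1,j}-\beta\gamma\neq0$ or $\sum_{j=1}^{s_2}d_{2,j}+\alpha\gamma\neq0$; (ii) $\gamma=0$. Then the special flow $T^f=(T^f_t)_{t\in\mathbb R}$ has weak Ratner's property. Here $T^f$ acts on $X^f=\{(p,s)\in\mathbb T^2\times\mathbb R: 0\le s<f(p)\}$ by moving points upward at unit speed and identifying $(p,f(p))$ with $(Tp,0)$. The space $X^f$ carries the metric $d((p,s),(p',s'))=d_{\mathbb T^2}(p,p')+|s-s'|$, where $d_{\mathbb T^2}((x,y),(x',y'))=\max(\|x-x'\|,\|y-y'\|)$ and $\|\cdot\|$ is the distance to the nearest integer, and the probability measure $\mu$ obtained by normalizing the restriction of $\lambda\otimes\text{Lebesgue}$ to $X^f$. A flow $(S_t)$ on a metric probability space $(X,d,\mu)$ has weak Ratner's property if there is a compact set $P\subset\mathbb R\setminus\{0\}$ such that, for uncountably many $t_0\in\mathbb R\setminus\{0\}$, the following property $R(t_0,P)$ holds: for every $\varepsilon>0$ there is $\kappa=\kappa(\varepsilon)>0$ such that for every $N\in\mathbb N$ there are $\delta>0$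 and a Borel set $Z$ with $\mu(Z)>1-\varepsilon$ such that, whenever $x,x'\in Z$, $x'$ is not in the orbit of $x$ and $d(x,x')<\delta$, there are natural numbers $M,L\ge N$ with $L/M\ge\kappa$ and some $\rho\in P$ with $$\frac{\#\{n\in\mathbb Z\cap[M,M+L]: d(S_{nt_0}x,S_{nt_0+\rho}x')<\varepsilon\}}{L}>1-\varepsilon.$$ -/

import Mathlib

open MeasureTheory Filter Topology

noncomputable section

/-! ### Birkhoff sums and special flows -/

/-- The cocycle `f^(m)` over the bijection `T`, for `m : ℤ`: it is `f x + ⋯ + f (T^(m-1) x)` for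
`m > 0`, `0` for `m = 0`, and `-(f (T^m x) + ⋯ + f (T^(-1) x))` for `m < 0`. -/
def birkhoffCocycle {X : Type*} (T : Equiv.Perm X) (f : X → ℝ) : ℤ → X → ℝ
  | Int.ofNat m, x => ∑ k ∈ Finset.range m, f ((T ^ (k : ℤ)) x)
  | Int.negSucc m, x => -∑ k ∈ Finset.range (m + 1), f ((T ^ (-((k : ℤ) + 1))) x)

theorem birkhoffCocycle_add_one {X : Type*} (T : Equiv.Perm X) (f : X → ℝ) (n : ℤ) (x : X) :
    birkhoffCocycle T f (n + 1) x = birkhoffCocycle T f n x + f ((T ^ n) x) := by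
  rcases n with m | m
  · have h : (Int.ofNat m + 1 : ℤ) = Int.ofNat (m + 1) := rfl
    rw [h]
    simp only [birkhoffCocycle, Finset.sum_range_succ]
    rfl
  · cases m with
    | zero =>
      have h : (Int.negSucc 0 + 1 : ℤ) = Int.ofNat 0 := rfl
      rw [h]
      simp [birkhoffCocycle]
    | succ m =>
      have h : (Int.negSucc (m + 1) + 1 : ℤ) = Int.negSucc m := by
        simp [Int.negSucc_eq]
      have h2 : (Int.negSucc (m + 1) : ℤ) = -(((m + 1 : ℕ) : ℤ) + 1) := by
        simp [Int.negSucc_eq]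
      rw [h]
      simp only [birkhoffCocycle]
      rw [Finset.sum_range_succ _ (m + 1), h2]
      ring

theorem birkhoffCocycle_strictMono {X : Type*} (T : Equiv.Perm X) {f : X → ℝ}
    (hf : ∀ x, 0 < f x) (x : X) : StrictMono (fun n : ℤ => birkhoffCocycle T f n x) :=
  strictMono_int_of_lt_succ fun n => by
    rw [birkhoffCocycle_add_one]
    linarith [hf ((T ^ n) x)]

/-- The phase space `X^f = {(x, s) : 0 ≤ s < f x}` of the special flow under `f`. As a subtype of
the `L¹`-product of `X` and `ℝ`, it carries the metric
`d^f ((x₁, s₁), (x₂, s₂)) = d (x₁, x₂) + |s₁ - s₂|` (see `SpecialFlowSpace.dist_eq`)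
and its Borel σ-algebra. -/
abbrev SpecialFlowSpace {X : Type*} (f : X → ℝ) : Type _ :=
  {p : WithLp 1 (X × ℝ) // 0 ≤ p.snd ∧ p.snd < f p.fst}

theorem SpecialFlowSpace.dist_eq {X : Type*} [MetricSpace X] {f : X → ℝ}
    (p q : SpecialFlowSpace f) :
    dist p q = dist p.1.fst q.1.fst + |p.1.snd - q.1.snd| := by
  rw [Subtype.dist_eq, WithLp.prod_dist_eq_add (by norm_num)]
  simp [Real.dist_eq]

/-- The point `(T^n x, u - f^(n) x)` of the phase space, for `f^(n) x ≤ u < f^(n+1) x`. -/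
def specialFlowPoint {X : Type*} (T : Equiv.Perm X) (f : X → ℝ) (n : ℤ) (x : X) (u : ℝ)
    (h : birkhoffCocycle T f n x ≤ u ∧ u < birkhoffCocycle T f (n + 1) x) :
    SpecialFlowSpace f :=
  ⟨WithLp.toLp 1 ((T ^ n) x, u - birkhoffCocycle T f n x),
    sub_nonneg.2 h.1, sub_lt_iff_lt_add'.2 (h.2.trans_eq (birkhoffCocycle_add_one T f n x))⟩

open Classical in
/-- The special flow `T^f`: each point moves up at unit speed and `(x, f x)` is identified with
`(T x, 0)`. Explicitly, `T^f_t (x, s) = (T^n x, s + t - f^(n) x)` for the integer `n` with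
`f^(n) x ≤ s + t < f^(n+1) x`. This `n` is unique when `f > 0`, and it exists whenever
`f^(n) x → ±∞` as `n → ±∞` (otherwise the point is left where it is). -/
def specialFlow {X : Type*} (T : Equiv.Perm X) (f : X → ℝ) (t : ℝ) (p : SpecialFlowSpace f) :
    SpecialFlowSpace f :=
  if h : ∃ n : ℤ, birkhoffCocycle T f n p.1.fst ≤ p.1.snd + t ∧
      p.1.snd + t < birkhoffCocycle T f (n + 1) p.1.fst then
    specialFlowPoint T f h.choose p.1.fst (p.1.snd + t) h.choose_spec
  else p

theorem specialFlow_eq {X : Type*} (T : Equiv.Perm X) {f : X → ℝ} (hf : ∀ x, 0 < f x) (t : ℝ)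
    (p : SpecialFlowSpace f) (n : ℤ) (hn : birkhoffCocycle T f n p.1.fst ≤ p.1.snd + t ∧
      p.1.snd + t < birkhoffCocycle T f (n + 1) p.1.fst) :
    specialFlow T f t p = specialFlowPoint T f n p.1.fst (p.1.snd + t) hn := by
  have h : ∃ n : ℤ, birkhoffCocycle T f n p.1.fst ≤ p.1.snd + t ∧
      p.1.snd + t < birkhoffCocycle T f (n + 1) p.1.fst := ⟨n, hn⟩
  have hc : h.choose = n := by
    have hm := birkhoffCocycle_strictMono T hf p.1.fst
    have a := hm.lt_iff_lt.1 (lt_of_le_of_lt h.choose_spec.1 hn.2)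
    have b := hm.lt_iff_lt.1 (lt_of_le_of_lt hn.1 h.choose_spec.2)
    omega
  unfold specialFlow
  rw [dif_pos h]
  congr 1

/-- The invariant probability measure of the special flow: the restriction of `μ ⊗ Lebesgue`
to `X^f`, normalized to have total mass one. -/
def specialFlowMeasure {X : Type*} [MeasurableSpace X] (μ : Measure X) (f : X → ℝ) :
    Measure (SpecialFlowSpace f) :=
  let ν : Measure (SpecialFlowSpace f) :=
    Measure.comap (fun p : SpecialFlowSpace f => (p.1.fst, p.1.snd)) (μ.prod volume)
  (ν Set.univ)⁻¹ • ν

/-! ### Weak Ratner's property -/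

/-- The property `R(t₀, P)` of a flow `S` on a metric probability space. Note that `κ` depends on
`ε` only. -/
def HasRatnerProperty {X : Type*} [MetricSpace X] [MeasurableSpace X] (μ : Measure X)
    (S : ℝ → X → X) (t₀ : ℝ) (P : Set ℝ) : Prop :=
  ∀ ε : ℝ, 0 < ε → ∃ κ : ℝ, 0 < κ ∧ ∀ N : ℕ, ∃ δ : ℝ, 0 < δ ∧ ∃ Z : Set X,
    MeasurableSet Z ∧ 1 - ε < μ.real Z ∧
    ∀ x ∈ Z, ∀ x' ∈ Z, (∀ t : ℝ, S t x ≠ x') → dist x x' < δ →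
      ∃ M L : ℕ, N ≤ M ∧ N ≤ L ∧ κ ≤ (L : ℝ) / (M : ℝ) ∧ ∃ ρ ∈ P,
        1 - ε < (Set.ncard {n : ℤ | (M : ℤ) ≤ n ∧ n ≤ (M : ℤ) + (L : ℤ) ∧
          dist (S ((n : ℝ) * t₀) x) (S ((n : ℝ) * t₀ + ρ) x') < ε} : ℝ) / (L : ℝ)

/-- Weak Ratner's property: for some compact `P ⊆ ℝ \ {0}`, the property `R(s, P)` holds for
uncountably many `s ≠ 0`. -/
def HasWeakRatnerProperty {X : Type*} [MetricSpace X] [MeasurableSpace X] (μ : Measure X)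
    (S : ℝ → X → X) : Prop :=
  ∃ P : Set ℝ, IsCompact P ∧ (0 : ℝ) ∉ P ∧
    ¬ Set.Countable {s : ℝ | s ≠ 0 ∧ HasRatnerProperty μ S s P}

/-! ### Rotations of the two-torus and roof functions -/

/-- The two-torus `ℝ² / ℤ²`. Its metric is `max (‖x - x'‖, ‖y - y'‖)`, where `‖·‖` is the distance
to the nearest integer, and its `volume` is the Lebesgue probability measure. -/
abbrev TwoTorus : Type := UnitAddCircle × UnitAddCircle

/-- The rotation `(x, y) ↦ (x + α, y + β)` of the two-torus. -/
def torusRotation (α β : ℝ) : Equiv.Perm TwoTorus :=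
  Equiv.addRight (((α : UnitAddCircle), (β : UnitAddCircle)) : TwoTorus)

/-- An irrational number whose continued fraction expansion has bounded partial quotients. -/
def HasBoundedPartialQuotients (α : ℝ) : Prop :=
  Irrational α ∧
    ∃ C : ℝ, ∀ (n : ℕ) (a : ℝ), (GenContFract.of α).partDens.get? n = some a → a ≤ C

/-- A function on the circle is piecewise `C^r` if there are `0 ≤ a_0 < ⋯ < a_{N-1} < 1`, `N ≥ 1`,
such that, with `a_N = a_0 + 1`, on each open arc `(a_j, a_{j+1})` it agrees with a function of
class `C^r` on the closed arc `[a_j, a_{j+1}]`. (Here `N ≥ 1` is forced by `a_N = a_0 + 1`.) -/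
def IsPiecewiseContDiff (r : ℕ) (F : UnitAddCircle → ℝ) : Prop :=
  ∃ (N : ℕ) (a : Fin (N + 1) → ℝ), StrictMono a ∧
    (∀ j : Fin N, a j.castSucc ∈ Set.Ico (0 : ℝ) 1) ∧ a (Fin.last N) = a 0 + 1 ∧
    ∀ j : Fin N, ∃ G : ℝ → ℝ,
      ContDiffOn ℝ r G (Set.Icc (a j.castSucc) (a j.succ)) ∧
      ∀ t ∈ Set.Ioo (a j.castSucc) (a j.succ), F (t : UnitAddCircle) = G t

/-- A function on the two-torus is `C^r` if its lift to the plane is. -/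
def IsTorusContDiff (r : ℕ) (g : TwoTorus → ℝ) : Prop :=
  ContDiff ℝ r (fun p : ℝ × ℝ => g ((p.1 : UnitAddCircle), (p.2 : UnitAddCircle)))

/-- `F` has at `x` a jump of size `d`, that is, one-sided limits whose difference
(left limit minus right limit) is `d`. With this sign, `t ↦ {t}` has jump `1` at `0`. -/
def HasJump (F : UnitAddCircle → ℝ) (x : UnitAddCircle) (d : ℝ) : Prop :=
  ∃ l r : ℝ, Tendsto (fun t : ℝ => F (x + (t : UnitAddCircle))) (𝓝[<] 0) (𝓝 l) ∧
    Tendsto (fun t : ℝ => F (x + (t : UnitAddCircle))) (𝓝[>] 0) (𝓝 r) ∧ d = l - r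

/-- `Δ_1, …, Δ_s` is a list without repetition of all discontinuities of `F`, and `d_1, …, d_s`
are the sizes of the jumps there. -/
def HasDiscontinuities (F : UnitAddCircle → ℝ) {s : ℕ} (Δ : Fin s → UnitAddCircle)
    (d : Fin s → ℝ) : Prop :=
  Function.Injective Δ ∧ (∀ x, ¬ ContinuousAt F x ↔ x ∈ Set.range Δ) ∧
    ∀ j, HasJump F (Δ j) (d j)

/-- The fractional part of a point of the circle: its representative in `[0, 1)`. -/
def circleFract (x : UnitAddCircle) : ℝ := (AddCircle.equivIco (1 : ℝ) 0 x : ℝ)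

/-- The Heisenberg-type function `h (x, y) = α {y} - ({x} + α) ⌊{y} + β⌋`. -/
def heisenbergFun (α β : ℝ) (p : TwoTorus) : ℝ :=
  α * circleFract p.2 - (circleFract p.1 + α) * (⌊circleFract p.2 + β⌋ : ℝ)

end

open MeasureTheory Filter Topology

noncomputable section

/-! ### Badly approximable numbers -/

/-- An irrational number all of whose partial quotients, except the integer part, are at most
`C`. -/
def PartDensLE (C ξ : ℝ) : Prop :=
  Irrational ξ ∧ ∀ (n : ℕ) (a : ℝ), (GenContFract.of ξ).partDens.get? n = some a → a ≤ C

theorem fract_pos_of_irrational {ξ : ℝ} (h : Irrational ξ) : 0 < Int.fract ξ := by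
  refine lt_of_le_of_ne (Int.fract_nonneg _) fun h0 => ?_
  have := Int.self_sub_floor ξ
  rw [← h0] at this
  exact h ⟨(⌊ξ⌋ : ℚ), by push_cast; linarith⟩

theorem PartDensLE.inv_fract {C ξ : ℝ} (h : PartDensLE C ξ) :
    PartDensLE C (Int.fract ξ)⁻¹ ∧ 1 < (Int.fract ξ)⁻¹ ∧ (Int.fract ξ)⁻¹ < C + 1 := by
  have h0 := fract_pos_of_irrational h.1
  have h1 : 1 < (Int.fract ξ)⁻¹ := (one_lt_inv₀ h0).2 (Int.fract_lt_one ξ)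
  have hirr : Irrational (Int.fract ξ) := by
    rw [Int.fract]; exact h.1.sub_intCast _
  refine ⟨⟨hirr.inv, fun n a ha => h.2 (n + 1) a ?_⟩, h1, ?_⟩
  · simp only [GenContFract.partDens, Stream'.Seq.map_get?] at ha ⊢
    rwa [GenContFract.of_s_succ]
  · have := h.2 0 (⌊(Int.fract ξ)⁻¹⌋ : ℝ) (by
      simp only [GenContFract.partDens, Stream'.Seq.map_get?]
      have := GenContFract.of_s_head (v := ξ) h0.ne'
      rw [Stream'.Seq.head] at this
      rw [this]; rfl)
    have := Int.lt_floor_add_one ((Int.fract ξ)⁻¹)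
    linarith

/-- The quantity `|(q ξ - p) (q η - p)| / (ξ - η)` is invariant under a step of the continued
fraction algorithm applied to `ξ` and `η`. This gives a lower bound for it. -/
theorem PartDensLE.le_abs_mul {C : ℝ} (n : ℕ) : ∀ (ξ η : ℝ) (q p : ℤ), PartDensLE C ξ → 1 < ξ →
    ξ < C + 1 → -1 ≤ η → η ≤ 0 → 0 ≤ q → 1 ≤ p → q ≤ n →
    ((C + 2) ^ 2)⁻¹ * (ξ - η) ≤ |q * ξ - p| * (p - q * η) := by
  induction n with
  | zero =>
    intro ξ η q p hξ h1 h2 h3 h4 hq hp hqn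
    obtain rfl : q = 0 := by push_cast at hqn; omega
    have hp' : (1 : ℝ) ≤ p := by exact_mod_cast hp
    have : |((0 : ℤ) : ℝ) * ξ - p| * (p - ((0 : ℤ) : ℝ) * η) = p * p := by
      rw [Int.cast_zero, zero_mul, zero_sub, abs_neg, abs_of_nonneg (by linarith)]; ring
    have hC : 0 < C := by linarith
    rw [this, inv_mul_le_iff₀ (by positivity)]
    nlinarith [mul_nonneg (sub_nonneg.2 hp') (sub_nonneg.2 hp')]
  | succ n ih =>
    intro ξ η q p hξ h1 h2 h3 h4 hq hp hqn
    rcases hq.eq_or_lt with rfl | hq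
    · exact ih ξ η 0 p hξ h1 h2 h3 h4 le_rfl hp (by positivity)
    have hp' : (1 : ℝ) ≤ p := by exact_mod_cast hp
    have hq' : (1 : ℝ) ≤ q := by exact_mod_cast hq
    obtain ⟨hξ', h1', h2'⟩ := hξ.inv_fract
    obtain ⟨hξ'', h1'', h2''⟩ := hξ'.inv_fract
    have hfr := fract_pos_of_irrational hξ.1
    set a : ℤ := ⌊ξ⌋ with ha
    have hfa : Int.fract ξ = ξ - a := rfl
    have ha1 : (1 : ℝ) ≤ a := by
      have : (1 : ℤ) ≤ a := Int.le_floor.2 (by simpa using h1.le)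
      exact_mod_cast this
    have hC : 0 < C := by linarith
    have hpη : (1 : ℝ) ≤ p - q * η := by nlinarith
    have hc : ((C + 2) ^ 2)⁻¹ * (ξ - η) ≤ (C + 2)⁻¹ := by
      rw [inv_mul_le_iff₀ (by positivity), pow_two, mul_assoc, mul_inv_cancel₀ (by positivity)]
      linarith
    have hend : (C + 2)⁻¹ ≤ |q * ξ - p| → ((C + 2) ^ 2)⁻¹ * (ξ - η) ≤ |q * ξ - p| * (p - q * η) :=
      fun h => by nlinarith [abs_nonneg (q * ξ - p)]
    rcases le_or_gt p (q * a) with hpa | hpa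
    · apply hend
      have : (p : ℝ) ≤ q * a := by exact_mod_cast hpa
      have h5 : (C + 2)⁻¹ ≤ Int.fract ξ := by
        rw [inv_le_comm₀ (by linarith) hfr]; linarith
      refine le_trans ?_ (le_abs_self _)
      nlinarith
    rcases le_or_gt (q * (a + 1)) p with hpb | hpb
    · apply hend
      have : (q : ℝ) * (a + 1) ≤ p := by exact_mod_cast hpb
      have h5 : Int.fract ξ ≤ 1 - (C + 2)⁻¹ := by
        have h6 : (C + 2) / (C + 1) ≤ (Int.fract ξ)⁻¹ := by
          have h7 : (C + 1)⁻¹ ≤ Int.fract (Int.fract ξ)⁻¹ := by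
            rw [inv_le_comm₀ (by linarith) (fract_pos_of_irrational hξ'.1)]; linarith
          have h8 : (1 : ℤ) ≤ ⌊(Int.fract ξ)⁻¹⌋ := Int.le_floor.2 (by simpa using h1'.le)
          have h9 : (1 : ℝ) ≤ ⌊(Int.fract ξ)⁻¹⌋ := by exact_mod_cast h8
          have := Int.floor_add_fract (Int.fract ξ)⁻¹
          have : (C + 2) / (C + 1) = 1 + (C + 1)⁻¹ := by field_simp; ring
          linarith
        rw [le_inv_comm₀ (by positivity) hfr, inv_div] at h6
        have : (C + 1) / (C + 2) = 1 - (C + 2)⁻¹ := by field_simp; ring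
        linarith
      rw [abs_sub_comm]
      refine le_trans ?_ (le_abs_self _)
      have h10 : 0 ≤ ((q : ℝ) - 1) * (a + 1 - ξ) :=
        mul_nonneg (by linarith) (by linarith [inv_pos.2 (show 0 < C + 2 by linarith)])
      linarith
    · have hpa' : (q : ℝ) * a + 1 ≤ p := by exact_mod_cast hpa
      have hηa : η - a < 0 := by linarith
      have key := ih (Int.fract ξ)⁻¹ (η - a)⁻¹ (p - q * a) q hξ' h1' h2'
        (by rw [← neg_le_neg_iff, neg_neg, ← inv_neg]
            exact inv_le_one_of_one_le₀ (by linarith))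
        (inv_nonpos.2 hηa.le) (by omega) hq (by push_cast at hqn; nlinarith)
      have hx : 0 < ξ - a := hfa ▸ hfr
      have e1 : |((p - q * a : ℤ) : ℝ) * (Int.fract ξ)⁻¹ - q| = |q * ξ - p| * (ξ - a)⁻¹ := by
        rw [hfa, ← abs_of_pos (inv_pos.2 hx), ← abs_mul, abs_of_pos (inv_pos.2 hx), ← abs_neg]
        congr 1; push_cast; field_simp; ring
      have e2 : (q : ℝ) - ((p - q * a : ℤ) : ℝ) * (η - a)⁻¹ = (p - q * η) * (-(η - a)⁻¹) := by
        push_cast; have := hηa.ne; field_simp; ring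
      have e3 : (Int.fract ξ)⁻¹ - (η - a)⁻¹ = (ξ - η) * ((ξ - a)⁻¹ * (-(η - a)⁻¹)) := by
        rw [hfa]; have := hηa.ne; field_simp; ring
      rw [e1, e2, e3] at key
      have hpos : 0 < (ξ - a)⁻¹ * (-(η - a)⁻¹) :=
        mul_pos (inv_pos.2 hx) (neg_pos.2 (inv_lt_zero.2 hηa))
      refine le_of_mul_le_mul_right ?_ hpos
      linarith

/-- `α` is badly approximable with constant `c`. -/
def BadlyApproximable (c α : ℝ) : Prop :=
  ∀ k : ℕ, 1 ≤ k → c ≤ k * ‖((k • α : ℝ) : UnitAddCircle)‖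

theorem HasBoundedPartialQuotients.badlyApproximable {α : ℝ} (h : HasBoundedPartialQuotients α) :
    ∃ c : ℝ, 0 < c ∧ BadlyApproximable c α := by
  obtain ⟨hirr, C, hC⟩ := h
  have hα : PartDensLE C α := ⟨hirr, hC⟩
  obtain ⟨h1, h2, h3⟩ := hα.inv_fract
  have hf := fract_pos_of_irrational hirr
  have hf1 := Int.fract_lt_one α
  set x := Int.fract α
  have hCpos : 0 < C := by linarith
  refine ⟨((C + 2) ^ 2)⁻¹ * x, by positivity, fun k hk => ?_⟩
  have hk' : (1 : ℝ) ≤ k := by exact_mod_cast hk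
  have hnorm : ∃ p : ℤ, ‖((k • α : ℝ) : UnitAddCircle)‖ = |k * x - p| := by
    refine ⟨round (k * α) - k * ⌊α⌋, ?_⟩
    rw [UnitAddCircle.norm_eq, nsmul_eq_mul]
    congr 1
    have : α = ⌊α⌋ + x := (Int.floor_add_fract α).symm
    push_cast
    linear_combination (k : ℝ) * this
  obtain ⟨p, hp⟩ := hnorm
  rw [hp]
  have hc1 : ((C + 2) ^ 2)⁻¹ ≤ 1 := inv_le_one_of_one_le₀ (by nlinarith)
  rcases le_or_gt 1 p with hp1 | hp1
  · have := PartDensLE.le_abs_mul p.toNat x⁻¹ 0 p k h1 h2 h3 (by norm_num) le_rfl (by omega)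
      (by exact_mod_cast hk) (by omega)
    have e : |(p : ℝ) * x⁻¹ - (k : ℤ)| = |k * x - p| * x⁻¹ := by
      rw [← abs_of_pos (inv_pos.2 hf), ← abs_mul, abs_of_pos (inv_pos.2 hf), ← abs_neg]
      congr 1; push_cast; field_simp; ring
    rw [e] at this
    simp only [mul_zero, sub_zero, Int.cast_natCast] at this
    have h4 : ((C + 2) ^ 2)⁻¹ ≤ |k * x - p| * k :=
      le_of_mul_le_mul_right (a := x⁻¹) (by linarith) (by positivity)
    nlinarith [inv_pos.2 (show 0 < (C + 2) ^ 2 by positivity)]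
  · have hp' : (p : ℝ) ≤ 0 := by exact_mod_cast (by omega : p ≤ 0)
    have : x ≤ |k * x - p| := le_trans (by nlinarith) (le_abs_self _)
    calc ((C + 2) ^ 2)⁻¹ * x ≤ 1 * x := by gcongr
      _ ≤ k * |k * x - p| := by gcongr

theorem Finset.card_le_of_separated {D : ℝ} (hD : 0 < D) {n : ℕ} (A : Finset ℕ)
    (hA : ∀ k ∈ A, k < n) (hsep : ∀ k ∈ A, ∀ l ∈ A, k < l → D ≤ (l : ℝ) - k) :
    (A.card : ℝ) ≤ n / D + 1 := by
  have h : A.card ≤ (Finset.range (⌊n / D⌋₊ + 1)).card := by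
    refine Finset.card_le_card_of_injOn (fun k => ⌊(k : ℝ) / D⌋₊) (fun k hk => ?_) ?_
    · simp only [Finset.coe_range, Set.mem_Iio]
      refine Nat.lt_succ_of_le (Nat.floor_mono ?_)
      have : (k : ℝ) ≤ n := by exact_mod_cast (hA k hk).le
      gcongr
    · have key : ∀ k ∈ A, ∀ l ∈ A, k < l → ⌊(k : ℝ) / D⌋₊ ≠ ⌊(l : ℝ) / D⌋₊ := by
        intro k hk l hl hkl
        have h1 := hsep k hk l hl hkl
        have h2 : (k : ℝ) / D + 1 ≤ l / D := by
          rw [div_add_one hD.ne']; gcongr; linarith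
        have h3 := Nat.floor_mono h2
        rw [Nat.floor_add_one (by positivity)] at h3
        omega
      intro k hk l hl hkl
      rcases lt_trichotomy k l with h | h | h
      · exact absurd hkl (key k hk l hl h)
      · exact h
      · exact absurd hkl.symm (key l hl k hk h)
  rw [Finset.card_range] at h
  have h2 : (⌊n / D⌋₊ : ℝ) ≤ n / D := Nat.floor_le (by positivity)
  have h3 : (A.card : ℝ) ≤ (⌊n / D⌋₊ : ℝ) + 1 := by exact_mod_cast h
  linarith

theorem BadlyApproximable.le_sub {c α : ℝ} (h : BadlyApproximable c α) {x b : UnitAddCircle}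
    {r : ℝ} (hr : 0 < r) {k l : ℕ} (hkl : k < l)
    (hk : ‖x + ((k * α : ℝ) : UnitAddCircle) - b‖ ≤ r)
    (hl : ‖x + ((l * α : ℝ) : UnitAddCircle) - b‖ ≤ r) : c / (2 * r) ≤ (l : ℝ) - k := by
  have h1 := h (l - k) (by omega)
  have h2 : (((l - k) • α : ℝ) : UnitAddCircle) = (x + ((l * α : ℝ) : UnitAddCircle) - b) -
      (x + ((k * α : ℝ) : UnitAddCircle) - b) := by
    rw [nsmul_eq_mul, Nat.cast_sub hkl.le, sub_mul, AddCircle.coe_sub]; abel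
  have h3 : ‖(((l - k) • α : ℝ) : UnitAddCircle)‖ ≤ 2 * r := by
    rw [h2]; exact (norm_sub_le _ _).trans (by linarith)
  rw [Nat.cast_sub hkl.le] at h1
  rw [div_le_iff₀ (by positivity)]
  have : (0 : ℝ) ≤ (l : ℝ) - k := by
    have : (k : ℝ) ≤ l := by exact_mod_cast hkl.le
    linarith
  nlinarith

open Classical in
theorem BadlyApproximable.card_le {c α : ℝ} (hc : 0 < c) (h : BadlyApproximable c α)
    (x b : UnitAddCircle) {r : ℝ} (hr : 0 < r) (n : ℕ) :
    (((Finset.range n).filter fun k : ℕ => ‖x + ((k * α : ℝ) : UnitAddCircle) - b‖ ≤ r).card : ℝ) ≤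
      2 * r * n / c + 1 := by
  have := Finset.card_le_of_separated (D := c / (2 * r)) (by positivity) (n := n)
    ((Finset.range n).filter fun k : ℕ => ‖x + ((k * α : ℝ) : UnitAddCircle) - b‖ ≤ r)
    (fun k hk => Finset.mem_range.1 (Finset.mem_filter.1 hk).1)
    (fun k hk l hl hkl => h.le_sub hr hkl (Finset.mem_filter.1 hk).2 (Finset.mem_filter.1 hl).2)
  have e : (n : ℝ) / (c / (2 * r)) = 2 * r * n / c := by field_simp
  rwa [e] at this

/-- An orbit of length `O (1 / r)` of the rotation by a badly approximable number meets every arc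
of radius `r`. -/
theorem BadlyApproximable.exists_norm_lt {c α : ℝ} (hc : 0 < c) (h : BadlyApproximable c α)
    (x b : UnitAddCircle) {r : ℝ} (hr : 0 < r) :
    ∃ k : ℕ, (k : ℝ) ≤ 3 / (c * r) + 2 ∧ ‖x + ((k * α : ℝ) : UnitAddCircle) - b‖ < r := by
  obtain ⟨n, hn⟩ : ∃ n : ℕ, n = ⌊3 / (c * r)⌋₊ + 1 := ⟨_, rfl⟩
  have hn1 : 3 / (c * r) < n := by rw [hn]; push_cast; exact Nat.lt_floor_add_one _
  have hn2 : (n : ℝ) ≤ 3 / (c * r) + 1 := by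
    rw [hn]; push_cast
    linarith [Nat.floor_le (show 0 ≤ 3 / (c * r) by positivity)]
  obtain ⟨q, hq1, hq2⟩ := Real.exists_rat_abs_sub_le_and_den_le α (n := n) (by omega)
  have hd : (0 : ℝ) < q.den := by exact_mod_cast q.den_pos
  have hqα : (q : ℝ) = q.num / q.den := by exact_mod_cast (Rat.num_div_den q).symm
  have hden : |q.den * α - q.num| ≤ 1 / (n + 1) := by
    have : (q.den : ℝ) * α - q.num = q.den * (α - q) := by rw [hqα]; field_simp
    rw [this, abs_mul, abs_of_pos hd]
    calc (q.den : ℝ) * |α - q| ≤ q.den * (1 / ((n + 1) * q.den)) := by gcongr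
      _ = 1 / (n + 1) := by field_simp
  have hnormd : ‖((q.den • α : ℝ) : UnitAddCircle)‖ ≤ 1 / (n + 1) := by
    rw [UnitAddCircle.norm_eq, nsmul_eq_mul]
    exact (round_le _ q.num).trans hden
  have hlarge : 3 / r < q.den := by
    have h1 := h q.den q.den_pos
    have h2 : c * (n + 1) ≤ q.den := by
      have : c ≤ q.den * (1 / (n + 1)) := h1.trans (by gcongr)
      rw [mul_one_div, le_div_iff₀ (by positivity)] at this
      exact this
    have h3 : 3 / r = c * (3 / (c * r)) := by field_simp
    nlinarith
  -- choose the multiple of `1 / q.den` nearest to `b - x`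
  obtain ⟨t, ht⟩ : ∃ t : ℝ, (t : UnitAddCircle) = b - x := QuotientAddGroup.mk_surjective _
  set m : ℤ := ⌊t * q.den⌋ with hm
  obtain ⟨k, hk, hkm⟩ : ∃ k : ℕ, k < q.den ∧ ∃ s : ℤ, (k : ℤ) * q.num = m + s * q.den := by
    have hu : IsCoprime q.num (q.den : ℤ) := by
      rw [Int.isCoprime_iff_gcd_eq_one]; exact q.reduced
    obtain ⟨a, b', hab⟩ := hu
    have hdz : (0 : ℤ) < q.den := by exact_mod_cast q.den_pos
    refine ⟨((m * a) % q.den).toNat, ?_, ?_⟩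
    · have := Int.emod_lt_of_pos (m * a) hdz
      have := Int.emod_nonneg (m * a) hdz.ne'
      omega
    · rw [Int.toNat_of_nonneg (Int.emod_nonneg _ hdz.ne'), Int.emod_def]
      exact ⟨-(m * b') - (m * a / q.den) * q.num, by linear_combination m * hab⟩
  obtain ⟨s, hs⟩ := hkm
  refine ⟨k, ?_, ?_⟩
  · have : (k : ℝ) ≤ n := by exact_mod_cast hk.le.trans hq2
    linarith
  · have e : x + ((k * α : ℝ) : UnitAddCircle) - b = ((k * α - s - t : ℝ) : UnitAddCircle) := by
      have hs0 : ((s : ℝ) : UnitAddCircle) = 0 := by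
        rw [AddCircle.coe_eq_zero_iff]; exact ⟨s, by simp⟩
      rw [AddCircle.coe_sub, AddCircle.coe_sub, hs0, ht]; abel
    have hs' : (k : ℝ) * q.num = m + s * q.den := by exact_mod_cast hs
    have hfl : (m : ℝ) ≤ t * q.den := Int.floor_le _
    have hfl2 : t * q.den < m + 1 := Int.lt_floor_add_one _
    have hkd : (k : ℝ) ≤ q.den := by exact_mod_cast hk.le
    have h4 : |k * α - s - t| * q.den ≤ 2 := by
      have h0 : |k * α - s - t| * q.den = |(k * α - s - t) * q.den| := by
        rw [abs_mul, abs_of_pos hd]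
      rw [h0]
      have : (k * α - s - t) * q.den = k * (q.den * α - q.num) + (m - t * q.den) := by
        linear_combination hs'
      rw [this]
      refine (abs_add_le _ _).trans ?_
      have h5 : |(k : ℝ) * (q.den * α - q.num)| ≤ 1 := by
        rw [abs_mul, Nat.abs_cast]
        have hq2' : (q.den : ℝ) ≤ n := by exact_mod_cast hq2
        calc (k : ℝ) * |q.den * α - q.num| ≤ n * (1 / (n + 1)) := by gcongr; linarith
          _ ≤ 1 := by rw [mul_one_div, div_le_one (by positivity)]; linarith
      have h6 : |(m : ℝ) - t * q.den| ≤ 1 := by rw [abs_le]; constructor <;> linarith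
      linarith
    rw [e]
    refine lt_of_le_of_lt (b := |k * α - s - t|) ?_ ?_
    · rw [UnitAddCircle.norm_eq]
      simpa using round_le (k * α - s - t) 0
    · rw [div_lt_iff₀ hr] at hlarge
      by_contra hcon
      push Not at hcon
      nlinarith

/-! ### Sums along orbits of a translation -/

/-- The Birkhoff sum `f p + f (p + ω) + ⋯ + f (p + (n - 1) ω)`. -/
def orbitSum {X : Type*} [AddCommGroup X] (ω : X) (f : X → ℝ) (n : ℕ) (p : X) : ℝ :=
  ∑ k ∈ Finset.range n, f (p + k • ω)

section OrbitSum

variable {X : Type*} [AddCommGroup X] (ω : X) (f : X → ℝ)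

theorem orbitSum_succ (n : ℕ) (p : X) :
    orbitSum ω f (n + 1) p = orbitSum ω f n p + f (p + n • ω) :=
  Finset.sum_range_succ _ _

theorem orbitSum_add (m n : ℕ) (p : X) :
    orbitSum ω f (m + n) p = orbitSum ω f m p + orbitSum ω f n (p + m • ω) := by
  simp only [orbitSum, Finset.sum_range_add, add_smul, add_assoc]

theorem orbitSum_add_fun (g : X → ℝ) (n : ℕ) (p : X) :
    orbitSum ω (fun q => f q + g q) n p = orbitSum ω f n p + orbitSum ω g n p :=
  Finset.sum_add_distrib

variable {ω f}

theorem abs_orbitSum_le {C : ℝ} (hC : ∀ p, |f p| ≤ C) (n : ℕ) (p : X) :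
    |orbitSum ω f n p| ≤ n * C := by
  refine (Finset.abs_sum_le_sum_abs _ _).trans ?_
  refine (Finset.sum_le_card_nsmul _ _ C fun k _ => hC _).trans ?_
  simp

theorem orbitSum_nonneg (hf : ∀ p, 0 ≤ f p) (n : ℕ) (p : X) : 0 ≤ orbitSum ω f n p :=
  Finset.sum_nonneg fun _ _ => hf _

end OrbitSum

/-- Within bounded time, every orbit of the translation by `ω` comes close to every point. -/
def UniformlyMinimal {X : Type*} [AddCommGroup X] [PseudoMetricSpace X] (ω : X) : Prop :=
  ∀ δ : ℝ, 0 < δ → ∃ K : ℕ, ∀ p q : X, ∃ k : ℕ, k ≤ K ∧ dist (p + k • ω) q < δ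

theorem uniformlyMinimal_of_denseRange {X : Type*} [NormedAddCommGroup X] [CompactSpace X] {ω : X}
    (h : DenseRange fun n : ℤ => n • ω) : UniformlyMinimal ω := by
  intro δ hδ
  have hcov : (Set.univ : Set X) ⊆ ⋃ n : ℤ, Metric.ball (n • ω) δ := by
    intro q _
    obtain ⟨n, hn⟩ := h.exists_dist_lt q hδ
    exact Set.mem_iUnion.2 ⟨n, hn⟩
  obtain ⟨t, ht⟩ := isCompact_univ.elim_finite_subcover _ (fun n => Metric.isOpen_ball) hcov
  obtain ⟨K, hK⟩ : ∃ K : ℕ, ∀ n ∈ t, |n| ≤ K :=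
    ⟨t.sup Int.natAbs, fun n hn => by
      rw [Int.abs_eq_natAbs]; exact_mod_cast Finset.le_sup (f := Int.natAbs) hn⟩
  refine ⟨2 * K, fun p q => ?_⟩
  obtain ⟨n, hn, hq⟩ := Set.mem_iUnion₂.1 (ht (Set.mem_univ (q - p - K • ω)))
  have h1 := abs_le.1 (hK n hn)
  refine ⟨(n + K).toNat, by omega, ?_⟩
  have h2 : (n + K).toNat • ω = n • ω + K • ω := by
    rw [← natCast_zsmul, Int.toNat_of_nonneg (by omega), add_smul, natCast_zsmul]
  rw [Metric.mem_ball, dist_comm, dist_eq_norm] at hq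
  rw [h2, dist_eq_norm]
  convert hq using 2
  abel

/-- The oscillation of the Birkhoff sums of a continuous function is sublinear. -/
theorem UniformlyMinimal.osc_le {X : Type*} [NormedAddCommGroup X] [CompactSpace X] {ω : X}
    (h : UniformlyMinimal ω) {G : X → ℝ} (hG : Continuous G) {η : ℝ} (hη : 0 < η) :
    ∃ C : ℝ, 0 ≤ C ∧ ∀ (n : ℕ) (p q : X),
      |orbitSum ω G n p - orbitSum ω G n q| ≤ η * n + C := by
  obtain ⟨B, hB⟩ := isCompact_univ.exists_bound_of_continuousOn hG.continuousOn
  have hB' : ∀ p, |G p| ≤ B := fun p => hB p trivial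
  have hB0 : 0 ≤ B := (abs_nonneg _).trans (hB' 0)
  obtain ⟨δ, hδ, hδG⟩ := Metric.uniformContinuous_iff.1
    (CompactSpace.uniformContinuous_of_continuous hG) η hη
  obtain ⟨K, hK⟩ := h δ hδ
  refine ⟨2 * K * B, by positivity, fun n p q => ?_⟩
  obtain ⟨k, hk, hd⟩ := hK p q
  have h1 : |orbitSum ω G n (p + k • ω) - orbitSum ω G n q| ≤ η * n := by
    rw [orbitSum, orbitSum, ← Finset.sum_sub_distrib]
    refine (Finset.abs_sum_le_sum_abs _ _).trans ?_
    refine (Finset.sum_le_card_nsmul _ _ η fun i _ => ?_).trans (by simp [mul_comm])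
    refine (hδG ?_).le
    rwa [dist_add_right]
  have h2 : orbitSum ω G n p - orbitSum ω G n (p + k • ω) =
      orbitSum ω G k p - orbitSum ω G k (p + n • ω) := by
    have e1 := orbitSum_add ω G k n p
    have e2 := orbitSum_add ω G n k p
    rw [add_comm k n] at e1
    linarith
  have h3 := abs_orbitSum_le (ω := ω) hB' k p
  have h4 := abs_orbitSum_le (ω := ω) hB' k (p + n • ω)
  have h5 : |orbitSum ω G n p - orbitSum ω G n (p + k • ω)| ≤ 2 * K * B := by
    rw [h2]
    refine (abs_sub _ _).trans ?_
    have : (k : ℝ) * B ≤ K * B := by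
      have : (k : ℝ) ≤ K := by exact_mod_cast hk
      gcongr
    linarith
  calc |orbitSum ω G n p - orbitSum ω G n q|
      ≤ |orbitSum ω G n p - orbitSum ω G n (p + k • ω)| +
        |orbitSum ω G n (p + k • ω) - orbitSum ω G n q| := abs_sub_le _ _ _
    _ ≤ η * n + 2 * K * B := by linarith

/-- The Birkhoff sums of a nonnegative function that is bounded below on a ball grow linearly. -/
theorem UniformlyMinimal.linear_growth {X : Type*} [NormedAddCommGroup X] {ω : X}
    (h : UniformlyMinimal ω) {f : X → ℝ} (hf : ∀ p, 0 ≤ f p) {q : X} {b r : ℝ} (hb : 0 < b)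
    (hr : 0 < r) (hball : ∀ p, dist p q < r → b ≤ f p) :
    ∃ c : ℝ, 0 < c ∧ ∃ C : ℝ, ∀ (n : ℕ) (p : X), c * n - C ≤ orbitSum ω f n p := by
  obtain ⟨K, hK⟩ := h r hr
  have hstep : ∀ p, b ≤ orbitSum ω f (K + 1) p := by
    intro p
    obtain ⟨k, hk, hd⟩ := hK p q
    exact (hball _ hd).trans (Finset.single_le_sum (f := fun k => f (p + k • ω))
      (fun i _ => hf _) (Finset.mem_range.2 (by omega)))
  have hmul : ∀ (m : ℕ) (p : X), m * b ≤ orbitSum ω f (m * (K + 1)) p := by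
    intro m
    induction m with
    | zero => intro p; simp [orbitSum]
    | succ m ih =>
      intro p
      rw [Nat.succ_mul, orbitSum_add]
      push_cast
      linarith [ih p, hstep (p + (m * (K + 1)) • ω)]
  refine ⟨b / (K + 1), by positivity, b, fun n p => ?_⟩
  have h1 : orbitSum ω f n p = orbitSum ω f (n / (K + 1) * (K + 1)) p +
      orbitSum ω f (n % (K + 1)) (p + (n / (K + 1) * (K + 1)) • ω) := by
    rw [← orbitSum_add, Nat.div_add_mod']
  have h2 := hmul (n / (K + 1)) p
  have h3 := orbitSum_nonneg (ω := ω) hf (n % (K + 1)) (p + (n / (K + 1) * (K + 1)) • ω)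
  have h4 : (n : ℝ) / (K + 1) ≤ (n / (K + 1) : ℕ) + 1 := by
    rw [div_le_iff₀ (by positivity)]
    have := Nat.lt_div_mul_add (a := n) (show 0 < K + 1 by omega)
    have h5 : (n : ℝ) ≤ ((n / (K + 1) * (K + 1) + (K + 1) : ℕ) : ℝ) := by exact_mod_cast this.le
    push_cast at h5 ⊢
    linarith
  have h5 : b / (K + 1) * n = b * (n / (K + 1)) := by ring
  rw [h1, h5]
  nlinarith

theorem torusRotation_zpow (α β : ℝ) (n : ℤ) (p : TwoTorus) :
    (torusRotation α β ^ n) p = p + n • (((α : UnitAddCircle), (β : UnitAddCircle)) : TwoTorus) := by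
  induction n generalizing p with
  | zero => simp
  | succ n ih =>
    rw [zpow_add_one, Equiv.Perm.mul_apply, ih, torusRotation, Equiv.coe_addRight, add_smul,
      one_smul, add_assoc, add_comm (((α : UnitAddCircle), (β : UnitAddCircle)) : TwoTorus)]
  | pred n ih =>
    have h : (torusRotation α β)⁻¹ p =
        p - (((α : UnitAddCircle), (β : UnitAddCircle)) : TwoTorus) := by
      rw [Equiv.Perm.inv_eq_iff_eq]
      exact (sub_add_cancel _ _).symm
    rw [zpow_sub_one, Equiv.Perm.mul_apply, ih, h, sub_smul, one_smul, sub_add_eq_add_sub,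
      add_sub_assoc]

theorem birkhoffCocycle_torusRotation (α β : ℝ) (f : TwoTorus → ℝ) (n : ℕ) (p : TwoTorus) :
    birkhoffCocycle (torusRotation α β) f n p =
      orbitSum (((α : UnitAddCircle), (β : UnitAddCircle)) : TwoTorus) f n p := by
  change birkhoffCocycle (torusRotation α β) f (Int.ofNat n) p = _
  simp only [birkhoffCocycle, torusRotation_zpow, orbitSum, natCast_zsmul]

theorem uniformlyMinimal_of_ergodic {α β : ℝ}
    (hT : Ergodic (torusRotation α β) (volume : Measure TwoTorus)) :
    UniformlyMinimal (((α : UnitAddCircle), (β : UnitAddCircle)) : TwoTorus) := by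
  apply uniformlyMinimal_of_denseRange
  have : (fun p : TwoTorus => (((α : UnitAddCircle), (β : UnitAddCircle)) : TwoTorus) + p) =
      torusRotation α β := by
    ext p : 1
    exact add_comm _ _
  exact DenseRange.zsmul_of_ergodic_add_left (μ := (volume : Measure TwoTorus)) (by rwa [this])

/-! ### Second differences -/

/-- A `C²` function on a compact convex set is Lipschitz and so is its derivative. -/
theorem ContDiffOn.exists_second_diff_le {E : Type*} [NormedAddCommGroup E] [NormedSpace ℝ E]
    {f : E → ℝ} {s : Set E} (hf : ContDiffOn ℝ 2 f s) (hs : UniqueDiffOn ℝ s)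
    (hconv : Convex ℝ s) (hcomp : IsCompact s) :
    ∃ C : ℝ, 0 ≤ C ∧ (∀ x ∈ s, ∀ y ∈ s, |f y - f x| ≤ C * ‖y - x‖) ∧
      ∀ p w z : E, p ∈ s → p + w ∈ s → p + z ∈ s → p + w + z ∈ s →
        |f (p + w + z) - f (p + w) - f (p + z) + f p| ≤ C * (‖w‖ * ‖z‖) := by
  have hd : DifferentiableOn ℝ f s := hf.differentiableOn (by norm_num)
  have hf1 : ContDiffOn ℝ 1 (fderivWithin ℝ f s) s := hf.fderivWithin hs (by norm_num)
  obtain ⟨C₁, hC₁⟩ := hcomp.exists_bound_of_continuousOn hf1.continuousOn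
  obtain ⟨C₂, hC₂⟩ := hcomp.exists_bound_of_continuousOn
    (hf1.continuousOn_fderivWithin hs (by norm_num))
  have hlip : ∀ x ∈ s, ∀ y ∈ s, ‖fderivWithin ℝ f s y - fderivWithin ℝ f s x‖ ≤ C₂ * ‖y - x‖ :=
    fun x hx y hy => hconv.norm_image_sub_le_of_norm_fderivWithin_le
      (hf1.differentiableOn (by norm_num)) hC₂ hx hy
  refine ⟨max 0 (max C₁ C₂), le_max_left _ _, fun x hx y hy => ?_, fun p w z hp hw hz hwz => ?_⟩
  · refine (hconv.norm_image_sub_le_of_norm_fderivWithin_le hd hC₁ hx hy).trans ?_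
    gcongr
    exact (le_max_left _ _).trans (le_max_right _ _)
  · have hm : ∀ q : E, q ∈ s → q + z ∈ s → ∀ t ∈ Set.Icc (0 : ℝ) 1, q + t • z ∈ s := by
      intro q hq hqz t ht
      have := hconv.add_smul_sub_mem hq hqz ht
      rwa [add_sub_cancel_left] at this
    have hline : ∀ q : E, q ∈ s → q + z ∈ s → ∀ t ∈ Set.Icc (0 : ℝ) 1,
        HasDerivWithinAt (fun t : ℝ => f (q + t • z)) (fderivWithin ℝ f s (q + t • z) z)
          (Set.Icc 0 1) t := by
      intro q hq hqz t ht
      have h1 : HasDerivWithinAt (fun t : ℝ => q + t • z) z (Set.Icc 0 1) t := by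
        simpa using ((hasDerivWithinAt_id t (Set.Icc 0 1)).smul_const z).const_add q
      exact (hd _ (hm q hq hqz t ht)).hasFDerivWithinAt.comp_hasDerivWithinAt t h1
        (fun r hr => hm q hq hqz r hr)
    have key := norm_image_sub_le_of_norm_deriv_le_segment_01'
      (f := fun t : ℝ => f (p + w + t • z) - f (p + t • z)) (C := C₂ * (‖w‖ * ‖z‖))
      (fun t ht => (hline (p + w) hw hwz t ht).sub (hline p hp hz t ht)) (fun t ht => by
        have ht' := Set.Ico_subset_Icc_self ht
        rw [← sub_apply]
        refine (ContinuousLinearMap.le_opNorm _ _).trans ?_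
        have := hlip _ (hm p hp hz t ht') _ (hm (p + w) hw hwz t ht')
        rw [show p + w + t • z - (p + t • z) = w by abel] at this
        calc _ ≤ C₂ * ‖w‖ * ‖z‖ := by gcongr
          _ = _ := by ring)
    simp only [one_smul, zero_smul, add_zero, Real.norm_eq_abs] at key
    have e : f (p + w + z) - f (p + w) - f (p + z) + f p =
        f (p + w + z) - f (p + z) - (f (p + w) - f p) := by ring
    rw [e]
    refine key.trans ?_
    gcongr
    exact (le_max_right _ _).trans (le_max_right _ _)

/-! ### The fractional part on the circle -/

theorem circleFract_coe (t : ℝ) : circleFract (t : UnitAddCircle) = Int.fract t := by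
  rw [circleFract]
  exact (AddCircle.coe_equivIco_mk_apply 1 t).trans (by simp)

theorem coe_circleFract (x : UnitAddCircle) : ((circleFract x : ℝ) : UnitAddCircle) = x :=
  AddCircle.coe_equivIco

theorem circleFract_nonneg (x : UnitAddCircle) : 0 ≤ circleFract x :=
  (AddCircle.equivIco (1 : ℝ) 0 x).2.1

theorem circleFract_lt_one (x : UnitAddCircle) : circleFract x < 1 :=
  (AddCircle.equivIco (1 : ℝ) 0 x).2.2.trans_eq (zero_add 1)

/-- The number of turns by which `{a} + u` exceeds `[0, 1)`. -/
def carry (a : UnitAddCircle) (u : ℝ) : ℤ := ⌊circleFract a + u⌋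

theorem circleFract_add (a : UnitAddCircle) (u : ℝ) :
    circleFract (a + (u : UnitAddCircle)) = circleFract a + u - carry a u := by
  conv_lhs => rw [← coe_circleFract a, ← AddCircle.coe_add, circleFract_coe]
  rfl

theorem norm_coe_le_abs_sub (t : ℝ) (m : ℤ) : ‖(t : UnitAddCircle)‖ ≤ |t - m| := by
  rw [UnitAddCircle.norm_eq]; exact round_le t m

theorem norm_coe_le_abs (t : ℝ) : ‖(t : UnitAddCircle)‖ ≤ |t| := by
  simpa using norm_coe_le_abs_sub t 0

theorem norm_le_of_carry_ne_zero {a : UnitAddCircle} {u : ℝ} (h : carry a u ≠ 0) :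
    ‖a‖ ≤ |u| := by
  have h0 := circleFract_nonneg a
  have h1 := circleFract_lt_one a
  rw [← coe_circleFract a]
  rcases lt_or_ge (circleFract a + u) 0 with hneg | hpos
  · refine (norm_coe_le_abs _).trans ?_
    rw [abs_of_nonneg h0, abs_of_neg (by linarith)]; linarith
  · have : ¬ (circleFract a + u < 1) := fun hlt =>
      h (Int.floor_eq_zero_iff.2 ⟨hpos, hlt⟩)
    refine (norm_coe_le_abs_sub _ 1).trans ?_
    rw [Int.cast_one, abs_of_neg (by linarith), abs_of_pos (by linarith)]; linarith

theorem carry_ne_zero {a : UnitAddCircle} {u : ℝ}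
    (h : ‖a + ((u / 2 : ℝ) : UnitAddCircle)‖ < |u| / 2) : carry a u ≠ 0 := by
  have h0 := circleFract_nonneg a
  have h1 := circleFract_lt_one a
  rw [← coe_circleFract a, ← AddCircle.coe_add, UnitAddCircle.norm_eq] at h
  set m := round (circleFract a + u / 2)
  rw [abs_lt] at h
  intro hc
  obtain ⟨h2, h3⟩ := Int.floor_eq_zero_iff.1 hc
  rcases le_or_gt 0 u with hu | hu
  · rw [abs_of_nonneg hu] at h
    have e1 : (0 : ℝ) < m := by linarith
    have e2 : (m : ℝ) < 1 := by linarith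
    have : 0 < m := by exact_mod_cast e1
    have : m < 1 := by exact_mod_cast e2
    omega
  · rw [abs_of_neg hu] at h
    have e1 : (0 : ℝ) < m := by linarith
    have e2 : (m : ℝ) < 1 := by linarith
    have : 0 < m := by exact_mod_cast e1
    have : m < 1 := by exact_mod_cast e2
    omega

theorem carry_nonneg {a : UnitAddCircle} {u : ℝ} (hu : 0 ≤ u) : 0 ≤ carry a u :=
  Int.floor_nonneg.2 (add_nonneg (circleFract_nonneg a) hu)

theorem carry_nonpos {a : UnitAddCircle} {u : ℝ} (hu : u ≤ 0) : carry a u ≤ 0 := by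
  have h1 := circleFract_lt_one a
  exact Int.lt_add_one_iff.1 (Int.floor_lt.2 (by push_cast; linarith))

theorem abs_carry_le_one {a : UnitAddCircle} {u : ℝ} (hu : |u| < 1) : |carry a u| ≤ 1 := by
  have h0 := circleFract_nonneg a
  have h1 := circleFract_lt_one a
  rw [abs_lt] at hu
  rw [abs_le]
  constructor
  · exact Int.le_floor.2 (by push_cast; linarith)
  · exact Int.lt_add_one_iff.1 (Int.floor_lt.2 (by push_cast; linarith))

theorem circleFract_add_of_lt {a : UnitAddCircle} {u : ℝ} (h : |u| < ‖a‖) :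
    circleFract (a + (u : UnitAddCircle)) = circleFract a + u := by
  have : carry a u = 0 := by
    by_contra hc
    exact absurd (norm_le_of_carry_ne_zero hc) (not_le.2 h)
  rw [circleFract_add, this]; simp

/-! ### Local behaviour of piecewise smooth functions -/

/-- `F` has a right limit at `x`, at a rate controlled by `C`. -/
def RightLipAt (C : ℝ) (F : UnitAddCircle → ℝ) (x : UnitAddCircle) (r : ℝ) : Prop :=
  ∀ᶠ s : ℝ in 𝓝[>] 0, |F (x + (s : UnitAddCircle)) - r| ≤ C * |s|

/-- `F` has a left limit at `x`, at a rate controlled by `C`. -/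
def LeftLipAt (C : ℝ) (F : UnitAddCircle → ℝ) (x : UnitAddCircle) (r : ℝ) : Prop :=
  ∀ᶠ s : ℝ in 𝓝[<] 0, |F (x + (s : UnitAddCircle)) - r| ≤ C * |s|

theorem tendsto_of_abs_sub_le {l : Filter ℝ} (hl : l ≤ 𝓝 0) {φ : ℝ → ℝ} {r C : ℝ}
    (h : ∀ᶠ s in l, |φ s - r| ≤ C * |s|) : Tendsto φ l (𝓝 r) := by
  rw [tendsto_iff_dist_tendsto_zero]
  have h0 : Tendsto (fun s : ℝ => C * |s|) l (𝓝 0) := by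
    have : Tendsto (fun s : ℝ => C * |s|) (𝓝 0) (𝓝 (C * |0|)) :=
      (continuous_const.mul continuous_abs).tendsto 0
    rw [abs_zero, mul_zero] at this
    exact this.mono_left hl
  exact squeeze_zero' (Eventually.of_forall fun _ => dist_nonneg) h h0

theorem RightLipAt.tendsto {C : ℝ} {F : UnitAddCircle → ℝ} {x : UnitAddCircle} {r : ℝ}
    (h : RightLipAt C F x r) :
    Tendsto (fun s : ℝ => F (x + (s : UnitAddCircle))) (𝓝[>] 0) (𝓝 r) :=
  tendsto_of_abs_sub_le nhdsWithin_le_nhds h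

theorem LeftLipAt.tendsto {C : ℝ} {F : UnitAddCircle → ℝ} {x : UnitAddCircle} {r : ℝ}
    (h : LeftLipAt C F x r) :
    Tendsto (fun s : ℝ => F (x + (s : UnitAddCircle))) (𝓝[<] 0) (𝓝 r) :=
  tendsto_of_abs_sub_le nhdsWithin_le_nhds h

theorem exists_mem_Ico_of_mono {N : ℕ} {a : Fin (N + 1) → ℝ} {t : ℝ} (h0 : a 0 ≤ t)
    (h1 : t < a (Fin.last N)) : ∃ j : Fin N, t ∈ Set.Ico (a j.castSucc) (a j.succ) := by
  by_contra! hcon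
  have : ∀ j : Fin (N + 1), a j ≤ t := by
    intro j
    induction j using Fin.induction with
    | zero => exact h0
    | succ j ih => exact not_lt.1 fun h => hcon j ⟨ih, h⟩
  exact absurd (this (Fin.last N)) (not_le.2 h1)

theorem exists_mem_Ioc_of_mono {N : ℕ} {a : Fin (N + 1) → ℝ} {t : ℝ} (h0 : a 0 < t)
    (h1 : t ≤ a (Fin.last N)) : ∃ j : Fin N, t ∈ Set.Ioc (a j.castSucc) (a j.succ) := by
  by_contra! hcon
  have : ∀ j : Fin (N + 1), a j < t := by
    intro j
    induction j using Fin.induction with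
    | zero => exact h0
    | succ j ih => exact not_le.1 fun h => hcon j ⟨ih, h⟩
  exact absurd (this (Fin.last N)) (not_lt.2 h1)

theorem IsPiecewiseContDiff.local_bounds {f : UnitAddCircle → ℝ} (hf : IsPiecewiseContDiff 2 f) :
    ∃ (C : ℝ) (B : Finset UnitAddCircle), 0 ≤ C ∧ (∀ x, ∃ r, RightLipAt C f x r) ∧
      (∀ x, ∃ r, LeftLipAt C f x r) ∧
      ∀ (x : UnitAddCircle) (u z : ℝ), (∀ b ∈ B, |u| + |z| < ‖x - b‖) →
        |f (x + u + z) - f (x + u) - f (x + z) + f x| ≤ C * (|u| * |z|) := by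
  classical
  obtain ⟨N, a, hmono, ha, hlast, hG⟩ := hf
  choose G hGC hGf using hG
  have hlt : ∀ j : Fin N, a j.castSucc < a j.succ := fun j => hmono (Fin.castSucc_lt_succ)
  have hb := fun j => (hGC j).exists_second_diff_le (uniqueDiffOn_Icc (hlt j)) (convex_Icc _ _)
    isCompact_Icc
  choose C hC0 hClip hCsec using hb
  have hle : ∀ j, C j ≤ ∑ j, C j := fun j =>
    Finset.single_le_sum (f := C) (fun i _ => hC0 i) (Finset.mem_univ j)
  refine ⟨∑ j, C j, Finset.univ.image fun j => ((a j : ℝ) : UnitAddCircle),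
    Finset.sum_nonneg fun j _ => hC0 j, fun x => ?_, fun x => ?_, fun x u z hx => ?_⟩
  · obtain ⟨t, ht, rfl⟩ : ∃ t ∈ Set.Ico (a 0) (a 0 + 1), ((t : ℝ) : UnitAddCircle) = x :=
      ⟨_, (AddCircle.equivIco 1 (a 0) x).2, AddCircle.coe_equivIco⟩
    obtain ⟨j, hj⟩ := exists_mem_Ico_of_mono ht.1 (hlast ▸ ht.2)
    refine ⟨G j t, ?_⟩
    have : Set.Ioo 0 (a j.succ - t) ∈ 𝓝[>] (0 : ℝ) := Ioo_mem_nhdsGT (by linarith [hj.2])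
    filter_upwards [this] with s hs
    rw [← AddCircle.coe_add, hGf j (t + s) ⟨by linarith [hj.1, hs.1], by linarith [hs.2]⟩]
    refine (hClip j t ⟨hj.1, hj.2.le⟩ (t + s) ⟨by linarith [hj.1, hs.1], by linarith [hs.2]⟩).trans
      ?_
    rw [add_sub_cancel_left, Real.norm_eq_abs]
    gcongr
    exact hle j
  · obtain ⟨t, ht, rfl⟩ : ∃ t ∈ Set.Ioc (a 0) (a 0 + 1), ((t : ℝ) : UnitAddCircle) = x :=
      ⟨_, (AddCircle.equivIoc 1 (a 0) x).2, AddCircle.coe_equivIoc⟩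
    obtain ⟨j, hj⟩ := exists_mem_Ioc_of_mono ht.1 (hlast ▸ ht.2)
    refine ⟨G j t, ?_⟩
    have : Set.Ioo (a j.castSucc - t) 0 ∈ 𝓝[<] (0 : ℝ) := Ioo_mem_nhdsLT (by linarith [hj.1])
    filter_upwards [this] with s hs
    rw [← AddCircle.coe_add, hGf j (t + s) ⟨by linarith [hs.1], by linarith [hj.2, hs.2]⟩]
    refine (hClip j t ⟨hj.1.le, hj.2⟩ (t + s) ⟨by linarith [hs.1], by linarith [hj.2, hs.2]⟩).trans
      ?_
    rw [add_sub_cancel_left, Real.norm_eq_abs]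
    gcongr
    exact hle j
  · obtain ⟨t, ht, rfl⟩ : ∃ t ∈ Set.Ico (a 0) (a 0 + 1), ((t : ℝ) : UnitAddCircle) = x :=
      ⟨_, (AddCircle.equivIco 1 (a 0) x).2, AddCircle.coe_equivIco⟩
    obtain ⟨j, hj⟩ := exists_mem_Ico_of_mono ht.1 (hlast ▸ ht.2)
    have hd : ∀ i, |u| + |z| < |t - a i| := fun i =>
      (hx _ (Finset.mem_image_of_mem _ (Finset.mem_univ i))).trans_le
        (by rw [← AddCircle.coe_sub]; exact norm_coe_le_abs _)
    have h1 := hd j.castSucc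
    have h2 := hd j.succ
    rw [abs_of_nonneg (show 0 ≤ t - a j.castSucc by linarith [hj.1])] at h1
    rw [abs_of_neg (show t - a j.succ < 0 by linarith [hj.2])] at h2
    have hu := abs_le.1 (le_refl |u|)
    have hz := abs_le.1 (le_refl |z|)
    have hu0 := abs_nonneg u
    have hz0 := abs_nonneg z
    have m1 : t ∈ Set.Ioo (a j.castSucc) (a j.succ) := ⟨by linarith, by linarith⟩
    have m2 : t + u ∈ Set.Ioo (a j.castSucc) (a j.succ) := ⟨by linarith, by linarith⟩
    have m3 : t + z ∈ Set.Ioo (a j.castSucc) (a j.succ) := ⟨by linarith, by linarith⟩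
    have m4 : t + u + z ∈ Set.Ioo (a j.castSucc) (a j.succ) := ⟨by linarith, by linarith⟩
    have := hCsec j t u z (Set.Ioo_subset_Icc_self m1) (Set.Ioo_subset_Icc_self m2)
      (Set.Ioo_subset_Icc_self m3) (Set.Ioo_subset_Icc_self m4)
    rw [← AddCircle.coe_add, ← AddCircle.coe_add, ← AddCircle.coe_add, hGf j _ m1, hGf j _ m2,
      hGf j _ m3, hGf j _ m4]
    refine this.trans ?_
    simp only [Real.norm_eq_abs]
    gcongr
    exact hle j

theorem abs_sub_le_of_eventually {F : ℝ → ℝ} {C : ℝ}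
    (h : ∀ t, ∀ᶠ s in 𝓝 t, |F s - F t| ≤ C * |s - t|) {a b : ℝ} (hab : a ≤ b) :
    |F b - F a| ≤ C * (b - a) := by
  have hcont : Continuous F := by
    rw [continuous_iff_continuousAt]
    intro t
    have h1 : Tendsto (fun s : ℝ => t + s) (𝓝 0) (𝓝 t) := by
      simpa using (continuous_const.add continuous_id).tendsto (x := (0 : ℝ)) (f := fun s => t + s)
    have h2 : ∀ᶠ s in 𝓝 (0 : ℝ), |F (t + s) - F t| ≤ C * |s| := by
      filter_upwards [h1.eventually (h t)] with s hs
      simpa using hs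
    have h3 := tendsto_of_abs_sub_le (φ := fun s => F (t + s)) le_rfl h2
    have h4 : Tendsto (fun s : ℝ => s - t) (𝓝 t) (𝓝 0) := by
      simpa using (continuous_id.sub continuous_const).tendsto (x := t) (f := fun s : ℝ => s - t)
    simpa [Function.comp_def, ContinuousAt] using h3.comp h4
  have hcl : IsClosed ({x | |F x - F a| ≤ C * (x - a)} ∩ Set.Icc a b) :=
    (isClosed_le (by fun_prop) (by fun_prop)).inter isClosed_Icc
  refine hcl.Icc_subset_of_forall_exists_gt (by simp) ?_ ⟨hab, le_rfl⟩
  rintro x ⟨hx, -⟩ y hy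
  have hev : ∀ᶠ s in 𝓝[>] x, |F s - F x| ≤ C * |s - x| := nhdsWithin_le_nhds (h x)
  obtain ⟨z, hz, hzy⟩ := (hev.and (Ioc_mem_nhdsGT hy)).exists
  refine ⟨z, ?_, hzy⟩
  change |F x - F a| ≤ _ at hx
  change |F z - F a| ≤ _
  rw [abs_of_pos (show 0 < z - x by linarith [hzy.1])] at hz
  calc |F z - F a| ≤ |F z - F x| + |F x - F a| := abs_sub_le _ _ _
    _ ≤ C * (z - a) := by linarith

/-! ### The regular part of a piecewise smooth function -/

theorem circleFract_eq_zero_iff {x : UnitAddCircle} : circleFract x = 0 ↔ x = 0 := by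
  constructor
  · intro h; rw [← coe_circleFract x, h, AddCircle.coe_zero]
  · rintro rfl; rw [← AddCircle.coe_zero, circleFract_coe, Int.fract_zero]

theorem circleFract_add_eventually_right (x : UnitAddCircle) :
    ∀ᶠ s : ℝ in 𝓝[>] 0, circleFract (x + (s : UnitAddCircle)) = circleFract x + s := by
  have h0 := circleFract_nonneg x
  have : Set.Ioo 0 (1 - circleFract x) ∈ 𝓝[>] (0 : ℝ) :=
    Ioo_mem_nhdsGT (by linarith [circleFract_lt_one x])
  filter_upwards [this] with s hs
  have : carry x s = 0 := Int.floor_eq_zero_iff.2 ⟨by linarith [hs.1], by linarith [hs.2]⟩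
  rw [circleFract_add, this]; simp

theorem circleFract_add_eventually_left (x : UnitAddCircle) [Decidable (x = 0)] :
    ∀ᶠ s : ℝ in 𝓝[<] 0, circleFract (x + (s : UnitAddCircle)) =
      circleFract x + (if x = 0 then 1 else 0) + s := by
  split_ifs with hx
  · have : Set.Ioo (-1) 0 ∈ 𝓝[<] (0 : ℝ) := Ioo_mem_nhdsLT (by norm_num)
    filter_upwards [this] with s hs
    have h0 := circleFract_eq_zero_iff.2 hx
    have : carry x s = -1 := by
      rw [carry, h0, Int.floor_eq_iff]
      push_cast
      exact ⟨by linarith [hs.1], by linarith [hs.2]⟩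
    rw [circleFract_add, this]; push_cast; ring
  · have h0 : 0 < circleFract x :=
      lt_of_le_of_ne (circleFract_nonneg x) fun h => hx (circleFract_eq_zero_iff.1 h.symm)
    have h1 := circleFract_lt_one x
    have : Set.Ioo (-circleFract x) 0 ∈ 𝓝[<] (0 : ℝ) := Ioo_mem_nhdsLT (by linarith)
    filter_upwards [this] with s hs
    have : carry x s = 0 := Int.floor_eq_zero_iff.2 ⟨by linarith [hs.1], by linarith [hs.2]⟩
    rw [circleFract_add, this]; simp

theorem eventually_add_ne (x y : UnitAddCircle) :
    ∀ᶠ s : ℝ in 𝓝[≠] 0, x + (s : UnitAddCircle) ≠ y := by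
  by_cases hxy : x = y
  · subst hxy
    have h1 : ∀ᶠ s : ℝ in 𝓝[≠] 0, |s| < 1 / 2 := by
      refine nhdsWithin_le_nhds ?_
      have := Metric.ball_mem_nhds (0 : ℝ) (show (0 : ℝ) < 1 / 2 by norm_num)
      filter_upwards [this] with s hs
      simpa using hs
    filter_upwards [h1, self_mem_nhdsWithin] with s hs hs0 heq
    rw [add_eq_left] at heq
    have h2 : ‖(s : UnitAddCircle)‖ = |s| :=
      (AddCircle.norm_coe_eq_abs_iff (p := (1 : ℝ)) (by norm_num)).2 (by simpa using hs.le)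
    rw [heq, norm_zero] at h2
    exact hs0 (abs_eq_zero.1 h2.symm)
  · refine nhdsWithin_le_nhds ?_
    have hc : Continuous fun s : ℝ => x + (s : UnitAddCircle) :=
      continuous_const.add (AddCircle.continuous_mk' 1)
    exact hc.continuousAt.eventually_ne (by simpa using hxy)

theorem exists_regular_part {f : UnitAddCircle → ℝ} (hf : IsPiecewiseContDiff 2 f) {s : ℕ}
    {Δ : Fin s → UnitAddCircle} {d : Fin s → ℝ} (hd : HasDiscontinuities f Δ d) :
    ∃ (F : UnitAddCircle → ℝ) (C : ℝ) (B : Finset UnitAddCircle), 0 ≤ C ∧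
      (∀ x, x ∉ Set.range Δ → f x = ∑ j, d j * circleFract (x - Δ j) + F x) ∧
      (∀ (x : UnitAddCircle) (u : ℝ), |F (x + u) - F x| ≤ C * |u|) ∧
      ∀ (x : UnitAddCircle) (u z : ℝ), (∀ b ∈ B, |u| + |z| < ‖x - b‖) →
        |F (x + u + z) - F (x + u) - F (x + z) + F x| ≤ C * (|u| * |z|) := by
  classical
  obtain ⟨hinj, hdisc, hjump⟩ := hd
  obtain ⟨C, B, hC, hright, hleft, hsec⟩ := hf.local_bounds
  choose r hr using hright
  choose l hl using hleft
  set Φ : UnitAddCircle → ℝ := fun x => f x - ∑ j, d j * circleFract (x - Δ j) with hΦ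
  set F : UnitAddCircle → ℝ := fun x => r x - ∑ j, d j * circleFract (x - Δ j) with hF
  set D := C + ∑ j, |d j| with hD
  have hD0 : 0 ≤ D := add_nonneg hC (Finset.sum_nonneg fun j _ => abs_nonneg _)
  have hcont : ∀ x, x ∉ Set.range Δ → r x = f x ∧ l x = f x := by
    intro x hx
    have hca : ContinuousAt f x := by
      by_contra h
      exact hx ((hdisc x).1 h)
    have hline : Tendsto (fun s : ℝ => f (x + (s : UnitAddCircle))) (𝓝 0) (𝓝 (f x)) := by
      have hc : Continuous fun s : ℝ => x + (s : UnitAddCircle) :=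
        continuous_const.add (AddCircle.continuous_mk' 1)
      have h2 : Tendsto (fun s : ℝ => x + (s : UnitAddCircle)) (𝓝 0) (𝓝 x) := by
        simpa using hc.tendsto 0
      exact hca.tendsto.comp h2
    exact ⟨tendsto_nhds_unique (hr x).tendsto (hline.mono_left nhdsWithin_le_nhds),
      tendsto_nhds_unique (hl x).tendsto (hline.mono_left nhdsWithin_le_nhds)⟩
  have hFΦ : ∀ x, x ∉ Set.range Δ → F x = Φ x := fun x hx => by
    simp only [hF, hΦ, (hcont x hx).1]
  have hlr : ∀ x, l x - ∑ j, d j * (circleFract (x - Δ j) + if x - Δ j = 0 then 1 else 0) = F x := by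
    intro x
    simp only [hF, mul_add, Finset.sum_add_distrib]
    suffices h : l x - r x = ∑ j, d j * (if x - Δ j = 0 then 1 else 0) by linarith
    simp only [sub_eq_zero, mul_ite, mul_one, mul_zero]
    by_cases hx : x ∈ Set.range Δ
    · obtain ⟨i, rfl⟩ := hx
      obtain ⟨l', r', hl', hr', hdi⟩ := hjump i
      rw [tendsto_nhds_unique (hl (Δ i)).tendsto hl', tendsto_nhds_unique (hr (Δ i)).tendsto hr',
        ← hdi]
      simp [hinj.eq_iff]
    · rw [(hcont x hx).1, (hcont x hx).2, sub_self]
      refine (Finset.sum_eq_zero fun j _ => if_neg fun h => hx ⟨j, h.symm⟩).symm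
  have hright' : ∀ x, ∀ᶠ s : ℝ in 𝓝[>] 0, |Φ (x + (s : UnitAddCircle)) - F x| ≤ D * |s| := by
    intro x
    have h1 : ∀ᶠ s : ℝ in 𝓝[>] 0, ∀ j, circleFract (x - Δ j + (s : UnitAddCircle)) =
        circleFract (x - Δ j) + s :=
      eventually_all.2 fun j => circleFract_add_eventually_right _
    filter_upwards [h1, hr x] with s h1 h2
    have e : Φ (x + (s : UnitAddCircle)) - F x =
        (f (x + (s : UnitAddCircle)) - r x) - ∑ j, d j * s := by
      simp only [hΦ, hF, add_sub_right_comm, h1, mul_add, Finset.sum_add_distrib]; ring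
    rw [e, hD, add_mul, Finset.sum_mul]
    refine (abs_sub _ _).trans (add_le_add h2 ?_)
    refine (Finset.abs_sum_le_sum_abs _ _).trans (le_of_eq ?_)
    simp only [abs_mul]
  have hleft' : ∀ x, ∀ᶠ s : ℝ in 𝓝[<] 0, |Φ (x + (s : UnitAddCircle)) - F x| ≤ D * |s| := by
    intro x
    have h1 : ∀ᶠ s : ℝ in 𝓝[<] 0, ∀ j, circleFract (x - Δ j + (s : UnitAddCircle)) =
        circleFract (x - Δ j) + (if x - Δ j = 0 then 1 else 0) + s :=
      eventually_all.2 fun j => circleFract_add_eventually_left _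
    filter_upwards [h1, hl x] with s h1 h2
    have e : Φ (x + (s : UnitAddCircle)) - F x =
        (f (x + (s : UnitAddCircle)) - l x) - ∑ j, d j * s := by
      rw [← hlr x]
      simp only [hΦ, add_sub_right_comm, h1, mul_add, Finset.sum_add_distrib]; ring
    rw [e, hD, add_mul, Finset.sum_mul]
    refine (abs_sub _ _).trans (add_le_add h2 ?_)
    refine (Finset.abs_sum_le_sum_abs _ _).trans (le_of_eq ?_)
    simp only [abs_mul]
  have hlocal : ∀ x, ∀ᶠ s : ℝ in 𝓝 0, |F (x + (s : UnitAddCircle)) - F x| ≤ D * |s| := by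
    intro x
    have h1 : ∀ᶠ s : ℝ in 𝓝[≠] 0, |Φ (x + (s : UnitAddCircle)) - F x| ≤ D * |s| := by
      rw [← Set.Iio_union_Ioi, nhdsWithin_union]
      exact eventually_sup.2 ⟨hleft' x, hright' x⟩
    have h2 : ∀ᶠ s : ℝ in 𝓝[≠] 0, ∀ j, x + (s : UnitAddCircle) ≠ Δ j :=
      eventually_all.2 fun j => eventually_add_ne x (Δ j)
    have h3 : ∀ᶠ s : ℝ in 𝓝[≠] 0, |F (x + (s : UnitAddCircle)) - F x| ≤ D * |s| := by
      filter_upwards [h1, h2] with s h1 h2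
      rw [hFΦ _ (by rintro ⟨j, hj⟩; exact h2 j hj.symm)]
      exact h1
    rw [eventually_nhdsWithin_iff] at h3
    filter_upwards [h3] with s hs
    by_cases h0 : s = 0
    · subst h0; simp
    · exact hs h0
  refine ⟨F, D, B ∪ Finset.univ.image Δ, hD0, fun x hx => ?_, fun x u => ?_, fun x u z hx => ?_⟩
  · rw [hFΦ x hx]; simp only [hΦ]; ring
  · have h1 : ∀ t : ℝ, ∀ᶠ s in 𝓝 t, |F (x + ((s : ℝ) : UnitAddCircle)) -
        F (x + ((t : ℝ) : UnitAddCircle))| ≤ D * |s - t| := by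
      intro t
      have h4 : Tendsto (fun s : ℝ => s - t) (𝓝 t) (𝓝 0) := by
        simpa using (continuous_id.sub continuous_const).tendsto (x := t) (f := fun s : ℝ => s - t)
      filter_upwards [h4.eventually (hlocal (x + (t : UnitAddCircle)))] with s hs
      rw [add_assoc, ← AddCircle.coe_add, add_sub_cancel] at hs
      exact hs
    rcases le_total 0 u with hu | hu
    · have := abs_sub_le_of_eventually (F := fun t : ℝ => F (x + (t : UnitAddCircle))) h1 hu
      simpa [abs_of_nonneg hu] using this
    · have := abs_sub_le_of_eventually (F := fun t : ℝ => F (x + (t : UnitAddCircle))) h1 hu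
      rw [abs_sub_comm] at this
      simpa [abs_of_nonpos hu] using this
  · have hB : ∀ b ∈ B, |u| + |z| < ‖x - b‖ := fun b hb => hx b (Finset.mem_union_left _ hb)
    have hΔ : ∀ j, |u| + |z| < ‖x - Δ j‖ := fun j =>
      hx _ (Finset.mem_union_right _ (Finset.mem_image_of_mem _ (Finset.mem_univ j)))
    have hout : ∀ v : ℝ, |v| ≤ |u| + |z| → F (x + (v : UnitAddCircle)) =
        f (x + (v : UnitAddCircle)) - ∑ j, d j * (circleFract (x - Δ j) + v) := by
      intro v hv
      rw [hFΦ]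
      · simp only [hΦ, add_sub_right_comm, circleFract_add_of_lt (hv.trans_lt (hΔ _))]
      · rintro ⟨j, hj⟩
        have := hΔ j
        rw [hj, sub_add_cancel_left, norm_neg] at this
        exact absurd (this.trans_le (norm_coe_le_abs v)) (not_lt.2 hv)
    have e0 := hout 0 (by simp; positivity)
    have e1 := hout u (by linarith [abs_nonneg z])
    have e2 := hout z (by linarith [abs_nonneg u])
    have e3 := hout (u + z) (abs_add_le u z)
    rw [AddCircle.coe_zero, add_zero] at e0
    rw [AddCircle.coe_add, ← add_assoc] at e3
    have key : F (x + u + z) - F (x + u) - F (x + z) + F x =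
        f (x + u + z) - f (x + u) - f (x + z) + f x := by
      rw [e0, e1, e2, e3]
      simp only [mul_add, Finset.sum_add_distrib, ← Finset.sum_mul]
      ring
    rw [key]
    refine (hsec x u z hB).trans ?_
    gcongr
    rw [hD]
    linarith [Finset.sum_nonneg fun (j : Fin s) (_ : j ∈ Finset.univ) => abs_nonneg (d j)]

/-! ### Birkhoff sums of regular functions on the torus -/

/-- The projection of the plane onto the two-torus. -/
def torusMk (w : ℝ × ℝ) : TwoTorus := ((w.1 : UnitAddCircle), (w.2 : UnitAddCircle))

theorem torusMk_add (w z : ℝ × ℝ) : torusMk (w + z) = torusMk w + torusMk z := rfl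

theorem torusMk_zero : torusMk 0 = 0 := rfl

theorem exists_coe_eq_abs_eq_norm (x : UnitAddCircle) :
    ∃ u : ℝ, (u : UnitAddCircle) = x ∧ |u| = ‖x‖ := by
  refine ⟨circleFract x - round (circleFract x), ?_, ?_⟩
  · have h0 : ((round (circleFract x) : ℝ) : UnitAddCircle) = 0 := by
      rw [AddCircle.coe_eq_zero_iff]; exact ⟨round (circleFract x), by simp⟩
    rw [AddCircle.coe_sub, h0, sub_zero, coe_circleFract]
  · conv_rhs => rw [← coe_circleFract x, UnitAddCircle.norm_eq]

theorem exists_torusMk_eq (p q : TwoTorus) :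
    ∃ w : ℝ × ℝ, q = p + torusMk w ∧ ‖w‖ = dist p q := by
  obtain ⟨u, hu, hu'⟩ := exists_coe_eq_abs_eq_norm (q.1 - p.1)
  obtain ⟨v, hv, hv'⟩ := exists_coe_eq_abs_eq_norm (q.2 - p.2)
  refine ⟨(u, v), ?_, ?_⟩
  · ext
    · simp [torusMk, hu]
    · simp [torusMk, hv]
  · rw [dist_comm, dist_eq_norm, Prod.norm_def, Prod.norm_def, Real.norm_eq_abs, Real.norm_eq_abs,
      hu', hv']
    rfl

theorem nsmul_coe (k : ℕ) (α : ℝ) : k • (α : UnitAddCircle) = ((k * α : ℝ) : UnitAddCircle) := by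
  rw [← AddCircle.coe_nsmul, nsmul_eq_mul]

/-- The second difference `f (p + w + z) - f (p + w) - f (p + z) + f p`. -/
def secondDiff {X : Type*} [Add X] (f : X → ℝ) (p w z : X) : ℝ :=
  f (p + w + z) - f (p + w) - f (p + z) + f p

theorem secondDiff_orbitSum {X : Type*} [AddCommGroup X] (ω : X) (f : X → ℝ) (n : ℕ)
    (p w z : X) : secondDiff (orbitSum ω f n) p w z =
      ∑ k ∈ Finset.range n, secondDiff f (p + k • ω) w z := by
  simp only [secondDiff, orbitSum, ← Finset.sum_sub_distrib, ← Finset.sum_add_distrib]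
  refine Finset.sum_congr rfl fun k _ => ?_
  rw [show p + w + z + k • ω = p + k • ω + w + z by abel, add_right_comm p w,
    add_right_comm p z]

theorem abs_secondDiff_orbitSum_le {c α : ℝ} (hc : 0 < c) (hα : BadlyApproximable c α)
    {F : UnitAddCircle → ℝ} {C : ℝ} {B : Finset UnitAddCircle} (hC : 0 ≤ C)
    (hlip : ∀ (x : UnitAddCircle) (u : ℝ), |F (x + u) - F x| ≤ C * |u|)
    (hsec : ∀ (x : UnitAddCircle) (u z : ℝ), (∀ b ∈ B, |u| + |z| < ‖x - b‖) →
        |F (x + u + z) - F (x + u) - F (x + z) + F x| ≤ C * (|u| * |z|)) :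
    ∃ C' : ℝ, 0 ≤ C' ∧ ∀ (n : ℕ) (x : UnitAddCircle) (u z : ℝ),
      |secondDiff (orbitSum (α : UnitAddCircle) F n) x u z| ≤
        C' * |u| * (n * (|u| + |z|) + 1) := by
  classical
  refine ⟨C + 2 * C * (B.card * (2 / c + 1)), by positivity, fun n x u z => ?_⟩
  by_cases hu : u = 0
  · subst hu; simp [secondDiff]
  have hr : 0 < |u| + |z| := by positivity
  set r := |u| + |z| with hrdef
  have hterm : ∀ k ∈ Finset.range n, |secondDiff F (x + k • (α : UnitAddCircle)) u z| ≤
      C * (|u| * |z|) + 2 * C * |u| *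
        ∑ b ∈ B, if ‖x + ((k * α : ℝ) : UnitAddCircle) - b‖ ≤ r then 1 else 0 := by
    intro k _
    rw [nsmul_coe]
    set y := x + ((k * α : ℝ) : UnitAddCircle)
    have hnn : ∀ b ∈ B, (0 : ℝ) ≤ if ‖y - b‖ ≤ r then 1 else 0 := fun b _ => by
      split_ifs <;> norm_num
    by_cases h : ∀ b ∈ B, r < ‖y - b‖
    · refine (hsec y u z h).trans (le_add_of_nonneg_right ?_)
      have := Finset.sum_nonneg hnn
      positivity
    · push Not at h
      obtain ⟨b, hb, hbr⟩ := h
      have h1 : (1 : ℝ) ≤ ∑ b ∈ B, if ‖y - b‖ ≤ r then 1 else 0 := by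
        refine le_trans ?_ (Finset.single_le_sum hnn hb)
        rw [if_pos hbr]
      have h2 : |secondDiff F y u z| ≤ 2 * C * |u| := by
        have e : secondDiff F y u z = (F (y + z + u) - F (y + z)) - (F (y + u) - F y) := by
          rw [secondDiff, add_right_comm]; ring
        rw [e]
        refine (abs_sub _ _).trans ?_
        linarith [hlip (y + z) u, hlip y u]
      have h3 : 0 ≤ 2 * C * |u| := by positivity
      have h4 : 0 ≤ C * (|u| * |z|) := by positivity
      nlinarith
  rw [secondDiff_orbitSum]
  refine (Finset.abs_sum_le_sum_abs _ _).trans ((Finset.sum_le_sum hterm).trans ?_)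
  rw [Finset.sum_add_distrib, ← Finset.mul_sum (Finset.range n) _ (2 * C * |u|), Finset.sum_comm]
  have hcount : ∑ b ∈ B, ∑ k ∈ Finset.range n,
      (if ‖x + ((k * α : ℝ) : UnitAddCircle) - b‖ ≤ r then (1 : ℝ) else 0) ≤
      B.card * (2 * r * n / c + 1) := by
    rw [← nsmul_eq_mul]
    refine Finset.sum_le_card_nsmul _ _ _ fun b _ => ?_
    rw [Finset.sum_boole]
    exact hα.card_le hc x b hr n
  have hz : |z| ≤ r := by rw [hrdef]; linarith [abs_nonneg u]
  calc _ ≤ n * (C * (|u| * r)) + 2 * C * |u| * (B.card * (2 * r * n / c + 1)) := by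
        rw [Finset.sum_const, Finset.card_range, nsmul_eq_mul]
        gcongr
    _ = C * |u| * (n * r) + 2 * C * |u| * (B.card * (2 / c * (n * r) + 1)) := by ring
    _ ≤ C * |u| * (n * r + 1) + 2 * C * |u| * (B.card * ((2 / c + 1) * (n * r + 1))) := by
        have : 0 ≤ n * r := by positivity
        gcongr
        · linarith
        · have : 0 ≤ 2 / c := by positivity
          nlinarith
    _ = _ := by ring

theorem IsTorusContDiff.bounds {g : TwoTorus → ℝ} (hg : IsTorusContDiff 2 g) :
    ∃ C : ℝ, 0 ≤ C ∧ (∀ (p : TwoTorus) (w : ℝ × ℝ), ‖w‖ ≤ 1 →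
        |g (p + torusMk w) - g p| ≤ C * ‖w‖) ∧
      ∀ (p : TwoTorus) (w z : ℝ × ℝ), ‖w‖ ≤ 1 → ‖z‖ ≤ 1 →
        |secondDiff g p (torusMk w) (torusMk z)| ≤ C * (‖w‖ * ‖z‖) := by
  set s : Set (ℝ × ℝ) := Metric.closedBall 0 3
  have hconv : Convex ℝ s := convex_closedBall 0 3
  have hs : UniqueDiffOn ℝ s := uniqueDiffOn_convex hconv
    ⟨0, mem_interior_iff_mem_nhds.2 (Metric.closedBall_mem_nhds _ (by norm_num))⟩
  obtain ⟨C, hC, hlip, hsec⟩ := (hg.contDiffOn (s := s)).exists_second_diff_le hs hconv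
    (isCompact_closedBall 0 3)
  have hrep : ∀ p : TwoTorus, ∃ t : ℝ × ℝ, torusMk t = p ∧ ‖t‖ ≤ 1 := by
    intro p
    refine ⟨(circleFract p.1, circleFract p.2), ?_, ?_⟩
    · simp only [torusMk, coe_circleFract]
    · rw [Prod.norm_def, Real.norm_of_nonneg (circleFract_nonneg _),
        Real.norm_of_nonneg (circleFract_nonneg _)]
      exact max_le (circleFract_lt_one _).le (circleFract_lt_one _).le
  have hmem : ∀ t : ℝ × ℝ, ‖t‖ ≤ 3 → t ∈ s := fun t ht => by simpa [s] using ht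
  refine ⟨C, hC, fun p w hw => ?_, fun p w z hw hz => ?_⟩
  · obtain ⟨t, rfl, ht⟩ := hrep p
    have := hlip t (hmem _ (by linarith)) (t + w) (hmem _ (by linarith [norm_add_le t w]))
    rw [add_sub_cancel_left] at this
    exact this
  · obtain ⟨t, rfl, ht⟩ := hrep p
    exact hsec t w z (hmem _ (by linarith)) (hmem _ (by linarith [norm_add_le t w]))
      (hmem _ (by linarith [norm_add_le t z]))
      (hmem _ (by linarith [norm_add_le t w, norm_add_le (t + w) z]))

theorem continuous_of_torus_lipschitz {G : TwoTorus → ℝ} {C : ℝ}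
    (h : ∀ (p : TwoTorus) (w : ℝ × ℝ), ‖w‖ ≤ 1 → |G (p + torusMk w) - G p| ≤ C * ‖w‖) :
    Continuous G := by
  rw [continuous_iff_continuousAt]
  intro p
  have hd : Tendsto (fun q : TwoTorus => dist p q) (𝓝 p) (𝓝 0) := by
    simpa using (continuous_const.dist continuous_id).tendsto (x := p)
      (f := fun q : TwoTorus => dist p q)
  rw [ContinuousAt, tendsto_iff_dist_tendsto_zero]
  refine squeeze_zero' (g := fun q => C * dist p q) (Eventually.of_forall fun _ => dist_nonneg) ?_
    (by simpa using hd.const_mul C)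
  filter_upwards [hd.eventually (ge_mem_nhds (show (0 : ℝ) < 1 by norm_num))] with q hq
  obtain ⟨w, rfl, hw⟩ := exists_torusMk_eq p q
  rw [← hw] at hq ⊢
  exact h p w hq

/-- If the oscillation of the Birkhoff sums of `G` is sublinear and their second differences are
controlled, then Birkhoff sums at nearby points remain close for a long time. -/
theorem orbitSum_sub_small {ω : TwoTorus} {G : TwoTorus → ℝ}
    (hosc : ∀ η : ℝ, 0 < η → ∃ C : ℝ, 0 ≤ C ∧ ∀ (n : ℕ) (p q : TwoTorus),
      |orbitSum ω G n p - orbitSum ω G n q| ≤ η * n + C)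
    {C : ℝ} (hC : 0 ≤ C)
    (hsec : ∀ (n : ℕ) (p : TwoTorus) (w z : ℝ × ℝ), ‖w‖ ≤ 1 → ‖z‖ ≤ 1 →
      |secondDiff (orbitSum ω G n) p (torusMk w) (torusMk z)| ≤
        C * ‖w‖ * (n * (‖w‖ + ‖z‖) + 1))
    {A e : ℝ} (hA : 0 < A) (he : 0 < e) :
    ∃ δ : ℝ, 0 < δ ∧ ∀ (p : TwoTorus) (w : ℝ × ℝ) (n : ℕ), ‖w‖ < δ → n * ‖w‖ ≤ A →
      |orbitSum ω G n (p + torusMk w) - orbitSum ω G n p| ≤ e := by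
  obtain ⟨θ, hθ, hθ1, hθe⟩ : ∃ θ : ℝ, 0 < θ ∧ θ ≤ 1 / 2 ∧ C * (A * (3 * θ)) ≤ e / 4 := by
    refine ⟨min (1 / 2) (e / 4 / (3 * A * (C + 1))), by positivity, min_le_left _ _, ?_⟩
    have h1 : min (1 / 2) (e / 4 / (3 * A * (C + 1))) * (3 * A * (C + 1)) ≤ e / 4 := by
      rw [← le_div_iff₀ (by positivity)]; exact min_le_right _ _
    have h0 : 0 ≤ min (1 / 2) (e / 4 / (3 * A * (C + 1))) := by positivity
    nlinarith [mul_nonneg h0 hA.le]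
  obtain ⟨Cη, hCη, hη⟩ := hosc (e / 4 * θ / A) (by positivity)
  refine ⟨min θ (min (e / 4 / (C + 1)) (e / 4 * θ / (Cη + 1))), by positivity,
    fun p w n hw hn => ?_⟩
  have hw1 : ‖w‖ < θ := hw.trans_le (min_le_left _ _)
  have hw2 : ‖w‖ * (C + 1) ≤ e / 4 := by
    rw [← le_div_iff₀ (by positivity)]
    exact hw.le.trans ((min_le_right _ _).trans (min_le_left _ _))
  have hw3 : ‖w‖ * (Cη + 1) ≤ e / 4 * θ := by
    rw [← le_div_iff₀ (by positivity)]
    exact hw.le.trans ((min_le_right _ _).trans (min_le_right _ _))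
  rcases (norm_nonneg w).eq_or_lt with h0 | h0
  · rw [norm_eq_zero.1 h0.symm, torusMk_zero, add_zero, sub_self, abs_zero]; exact he.le
  set S := orbitSum ω G n
  set D := S (p + torusMk w) - S p with hD
  obtain ⟨m, hm⟩ : ∃ m : ℕ, m = ⌈θ / ‖w‖⌉₊ := ⟨_, rfl⟩
  have hm1 : θ ≤ m * ‖w‖ := by
    rw [← div_le_iff₀ h0, hm]; exact Nat.le_ceil _
  have hm2 : m * ‖w‖ ≤ 2 * θ := by
    have : (m : ℝ) < θ / ‖w‖ + 1 := by rw [hm]; exact Nat.ceil_lt_add_one (by positivity)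
    have h2 : (m : ℝ) * ‖w‖ ≤ (θ / ‖w‖ + 1) * ‖w‖ := by gcongr
    rw [add_mul, div_mul_cancel₀ _ h0.ne', one_mul] at h2
    linarith
  have htel : S (p + torusMk ((m : ℝ) • w)) - S p =
      m * D + ∑ i ∈ Finset.range m, secondDiff S p (torusMk w) (torusMk ((i : ℝ) • w)) := by
    have h1 : ∀ i ∈ Finset.range m, secondDiff S p (torusMk w) (torusMk ((i : ℝ) • w)) =
        (S (p + torusMk (((i + 1 : ℕ) : ℝ) • w)) - S (p + torusMk ((i : ℝ) • w))) - D := by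
      intro i _
      have e1 : ((i + 1 : ℕ) : ℝ) • w = w + (i : ℝ) • w := by
        push_cast; rw [add_smul, one_smul, add_comm]
      rw [secondDiff, e1, torusMk_add, ← add_assoc, hD]; ring
    rw [Finset.sum_congr rfl h1, Finset.sum_sub_distrib,
      Finset.sum_range_sub (fun i : ℕ => S (p + torusMk ((i : ℝ) • w))), Finset.sum_const,
      Finset.card_range, nsmul_eq_mul]
    simp only [Nat.cast_zero, zero_smul, torusMk_zero, add_zero]
    ring
  have hsum : |∑ i ∈ Finset.range m, secondDiff S p (torusMk w) (torusMk ((i : ℝ) • w))| ≤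
      m * (C * ‖w‖ * (n * (3 * θ) + 1)) := by
    refine (Finset.abs_sum_le_sum_abs _ _).trans ?_
    refine (Finset.sum_le_card_nsmul _ _ (C * ‖w‖ * (n * (3 * θ) + 1)) fun i hi => ?_).trans
      (by simp)
    have hi' : (i : ℝ) ≤ m := by exact_mod_cast (Finset.mem_range.1 hi).le
    have hiw : ‖(i : ℝ) • w‖ ≤ 2 * θ := by
      rw [norm_smul, Real.norm_natCast]
      exact (mul_le_mul_of_nonneg_right hi' h0.le).trans hm2
    refine (hsec n p w _ (by linarith) (by linarith)).trans ?_
    gcongr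
    linarith
  have hend := hη n (p + torusMk ((m : ℝ) • w)) p
  have hmD : m * |D| ≤ e / 4 * θ / A * n + Cη + m * (C * ‖w‖ * (n * (3 * θ) + 1)) := by
    have : (m : ℝ) * |D| = |m * D| := by rw [abs_mul, Nat.abs_cast]
    rw [this, show (m : ℝ) * D = (S (p + torusMk ((m : ℝ) • w)) - S p) -
      ∑ i ∈ Finset.range m, secondDiff S p (torusMk w) (torusMk ((i : ℝ) • w)) by rw [htel]; ring]
    refine (abs_sub _ _).trans ?_
    linarith
  have h1 : m * ‖w‖ * |D| ≤ m * ‖w‖ * e := by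
    have t1 : e / 4 * θ / A * n * ‖w‖ ≤ e / 4 * θ := by
      calc e / 4 * θ / A * n * ‖w‖ = e / 4 * θ / A * (n * ‖w‖) := by ring
        _ ≤ e / 4 * θ / A * A := by gcongr
        _ = e / 4 * θ := by field_simp
    have t2 : Cη * ‖w‖ ≤ e / 4 * θ := by nlinarith
    have t3 : C * ‖w‖ * (n * (3 * θ) + 1) ≤ e / 4 + e / 4 := by
      calc C * ‖w‖ * (n * (3 * θ) + 1) = C * ((n * ‖w‖) * (3 * θ)) + C * ‖w‖ := by ring
        _ ≤ C * (A * (3 * θ)) + C * ‖w‖ := by gcongr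
        _ ≤ e / 4 + e / 4 := by nlinarith
    have t4 : e / 4 * θ ≤ e / 4 * (m * ‖w‖) := by gcongr
    have h5 := mul_le_mul_of_nonneg_right hmD h0.le
    have h6 : m * (C * ‖w‖ * (n * (3 * θ) + 1)) * ‖w‖ ≤ m * ‖w‖ * (e / 4 + e / 4) := by
      calc _ = m * ‖w‖ * (C * ‖w‖ * (n * (3 * θ) + 1)) := by ring
        _ ≤ _ := by gcongr
    nlinarith
  exact le_of_mul_le_mul_left h1 (by linarith)

/-! ### Differences of Birkhoff sums along two nearby orbits -/

theorem orbitSum_circleFract_sub (ω : UnitAddCircle) (b : UnitAddCircle) (n : ℕ)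
    (x : UnitAddCircle) (u : ℝ) :
    orbitSum ω (fun y => circleFract (y - b)) n (x + u) -
      orbitSum ω (fun y => circleFract (y - b)) n x =
      n * u - ((∑ k ∈ Finset.range n, carry (x + k • ω - b) u : ℤ) : ℝ) := by
  simp only [orbitSum, ← Finset.sum_sub_distrib]
  have : ∀ k ∈ Finset.range n, circleFract (x + u + k • ω - b) - circleFract (x + k • ω - b) =
      u - (carry (x + k • ω - b) u : ℝ) := by
    intro k _
    rw [show x + u + k • ω - b = x + k • ω - b + u by abel, circleFract_add]; ring
  rw [Finset.sum_congr rfl this, Finset.sum_sub_distrib]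
  simp

theorem carry_add_carry (y : UnitAddCircle) (v β : ℝ) :
    carry y v + carry (y + v) β = carry y β + carry (y + β) v := by
  have h1 := circleFract_add (y + v) β
  have h2 := circleFract_add (y + β) v
  rw [circleFract_add y v] at h1
  rw [circleFract_add y β, add_right_comm] at h2
  have : (carry y v + carry (y + v) β : ℝ) = carry y β + carry (y + β) v := by linarith
  exact_mod_cast this

/-- The effect of the crossings at one point on the difference of two values of the
Heisenberg-type function. -/
def heisenbergCarry (α β : ℝ) (p : TwoTorus) (w : ℝ × ℝ) : ℤ :=
  carry p.1 w.1 * carry (p.2 + w.2) β - carry p.1 α * carry (p.2 + β) w.2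

theorem heisenbergFun_sub (α β : ℝ) (p : TwoTorus) (w : ℝ × ℝ) :
    heisenbergFun α β (p + torusMk w) - heisenbergFun α β p =
      (α * w.2 - β * w.1) + heisenbergCarry α β p w -
        (circleFract (p.1 + α) * carry (p.2 + β) w.2 - circleFract p.1 * carry p.2 w.2) -
        w.1 * (circleFract (p.2 + w.2) - circleFract (p.2 + β + w.2)) := by
  obtain ⟨x, y⟩ := p
  obtain ⟨u, v⟩ := w
  have e1 := circleFract_add x u
  have e2 := circleFract_add y v
  have e3 := circleFract_add x α
  have e4 := circleFract_add (y + v) β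
  have e5 : (carry y v + carry (y + v) β : ℝ) = carry y β + carry (y + β) v := by
    exact_mod_cast carry_add_carry y v β
  rw [add_right_comm] at e4
  have e6 : (⌊circleFract (y + v) + β⌋ : ℝ) = carry (y + v) β := rfl
  have e7 : (⌊circleFract y + β⌋ : ℝ) = carry y β := rfl
  simp only [heisenbergFun, heisenbergCarry, torusMk, Prod.mk_add_mk]
  push_cast
  rw [e6, e7, e1, e4, e3, e2]
  have e8 : (carry y β : ℝ) = carry y v + carry (y + v) β - carry (y + β) v := by linarith
  rw [e8]
  ring

theorem orbitSum_heisenbergFun_sub (α β : ℝ) (n : ℕ) (p : TwoTorus) (w : ℝ × ℝ) :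
    orbitSum (torusMk (α, β)) (heisenbergFun α β) n (p + torusMk w) -
      orbitSum (torusMk (α, β)) (heisenbergFun α β) n p =
      n * (α * w.2 - β * w.1) +
        ((∑ k ∈ Finset.range n, heisenbergCarry α β (p + k • torusMk (α, β)) w : ℤ) : ℝ) -
        (circleFract (p.1 + n • (α : UnitAddCircle)) *
          carry (p.2 + n • (β : UnitAddCircle)) w.2 - circleFract p.1 * carry p.2 w.2) -
        w.1 * (circleFract (p.2 + w.2) -
          circleFract (p.2 + n • (β : UnitAddCircle) + w.2)) := by
  induction n with
  | zero => simp [orbitSum]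
  | succ n ih =>
    rw [orbitSum_succ, orbitSum_succ, Finset.sum_range_succ,
      show p + torusMk w + n • torusMk (α, β) = p + n • torusMk (α, β) + torusMk w by abel]
    have h := heisenbergFun_sub α β (p + n • torusMk (α, β)) w
    have f1 : (p + n • torusMk (α, β)).1 = p.1 + n • (α : UnitAddCircle) := rfl
    have f2 : (p + n • torusMk (α, β)).2 = p.2 + n • (β : UnitAddCircle) := rfl
    rw [f1, f2] at h
    rw [succ_nsmul, succ_nsmul, ← add_assoc, ← add_assoc]
    push_cast at ih ⊢
    linear_combination ih + h

theorem sum_abs_carry_le {c α : ℝ} (hc : 0 < c) (hα : BadlyApproximable c α)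
    (x : UnitAddCircle) {u d : ℝ} (hu : |u| ≤ d) (hd : d < 1) (hd0 : 0 < d) (n : ℕ) :
    ((∑ k ∈ Finset.range n, |carry (x + k • (α : UnitAddCircle)) u| : ℤ) : ℝ) ≤
      2 * d * n / c + 1 := by
  classical
  refine le_trans ?_ (hα.card_le hc x 0 hd0 n)
  rw [← Finset.sum_boole]
  push_cast
  refine Finset.sum_le_sum fun k _ => ?_
  rw [sub_zero, ← nsmul_coe]
  split_ifs with h
  · exact_mod_cast abs_carry_le_one (hu.trans_lt hd)
  · have : carry (x + k • (α : UnitAddCircle)) u = 0 := by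
      by_contra hne
      exact h ((norm_le_of_carry_ne_zero hne).trans hu)
    rw [this]; simp

theorem abs_sum_carry_le {c α : ℝ} (hc : 0 < c) (hα : BadlyApproximable c α)
    (x : UnitAddCircle) {u d : ℝ} (hu : |u| ≤ d) (hd : d < 1) (hd0 : 0 < d) (n : ℕ) :
    ((|∑ k ∈ Finset.range n, carry (x + k • (α : UnitAddCircle)) u| : ℤ) : ℝ) ≤
      2 * d * n / c + 1 :=
  le_trans (by exact_mod_cast Finset.abs_sum_le_sum_abs _ _) (sum_abs_carry_le hc hα x hu hd hd0 n)

theorem abs_carry_le_one_of_mem {a : UnitAddCircle} {β : ℝ} (hβ : β ∈ Set.Ico (0 : ℝ) 1) :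
    |carry a β| ≤ 1 :=
  abs_carry_le_one (by rw [abs_of_nonneg hβ.1]; exact hβ.2)

theorem abs_sum_heisenbergCarry_le {c α β : ℝ} (hc : 0 < c) (hα : BadlyApproximable c α)
    (hβ : BadlyApproximable c β) (hα1 : α ∈ Set.Ico (0 : ℝ) 1) (hβ1 : β ∈ Set.Ico (0 : ℝ) 1)
    (p : TwoTorus) {w : ℝ × ℝ} (hw : ‖w‖ < 1) (hw0 : 0 < ‖w‖) (n : ℕ) :
    ((|∑ k ∈ Finset.range n, heisenbergCarry α β (p + k • torusMk (α, β)) w| : ℤ) : ℝ) ≤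
      2 * (2 * ‖w‖ * n / c + 1) := by
  have h1 := sum_abs_carry_le hc hα p.1 (u := w.1) (norm_fst_le w) hw hw0 n
  have h2 := sum_abs_carry_le hc hβ (p.2 + β) (u := w.2) (norm_snd_le w) hw hw0 n
  have h3 : |∑ k ∈ Finset.range n, heisenbergCarry α β (p + k • torusMk (α, β)) w| ≤
      ∑ k ∈ Finset.range n, |carry (p.1 + k • (α : UnitAddCircle)) w.1| +
      ∑ k ∈ Finset.range n, |carry (p.2 + β + k • (β : UnitAddCircle)) w.2| := by
    rw [← Finset.sum_add_distrib]
    refine (Finset.abs_sum_le_sum_abs _ _).trans (Finset.sum_le_sum fun k _ => ?_)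
    refine (abs_sub _ _).trans ?_
    rw [abs_mul, abs_mul]
    refine add_le_add (mul_le_of_le_one_right (abs_nonneg _) (abs_carry_le_one_of_mem hβ1)) ?_
    rw [add_right_comm p.2]
    exact mul_le_of_le_one_left (abs_nonneg _) (abs_carry_le_one_of_mem hα1)
  have h4 : ((|∑ k ∈ Finset.range n, heisenbergCarry α β (p + k • torusMk (α, β)) w| : ℤ) : ℝ) ≤
      ((∑ k ∈ Finset.range n, |carry (p.1 + k • (α : UnitAddCircle)) w.1| : ℤ) : ℝ) +
      ((∑ k ∈ Finset.range n, |carry (p.2 + β + k • (β : UnitAddCircle)) w.2| : ℤ) : ℝ) := by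
    exact_mod_cast h3
  linarith

/-- Once a crossing has occurred, the signed number of crossings does not vanish any more. -/
theorem exists_sum_carry_ne_zero {c α : ℝ} (hc : 0 < c) (hα : BadlyApproximable c α)
    (x b : UnitAddCircle) {u : ℝ} (hu : u ≠ 0) {n : ℕ} (hn : 6 / (c * |u|) + 2 < n) :
    ∑ k ∈ Finset.range n, carry (x + k • (α : UnitAddCircle) - b) u ≠ 0 := by
  have hu' : 0 < |u| := abs_pos.2 hu
  obtain ⟨k, hk, hk'⟩ := hα.exists_norm_lt hc x (b - ((u / 2 : ℝ) : UnitAddCircle))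
    (half_pos hu')
  have hkn : k ∈ Finset.range n := by
    rw [Finset.mem_range]
    have : 3 / (c * (|u| / 2)) = 6 / (c * |u|) := by field_simp; norm_num
    rw [this] at hk
    exact_mod_cast hk.trans_lt hn
  have hne : carry (x + k • (α : UnitAddCircle) - b) u ≠ 0 := by
    apply carry_ne_zero
    rw [nsmul_coe]
    convert hk' using 2
    abel
  rcases le_total 0 u with h | h
  · intro h0
    exact hne ((Finset.sum_eq_zero_iff_of_nonneg fun i _ => carry_nonneg h).1 h0 k hkn)
  · intro h0
    exact hne ((Finset.sum_eq_zero_iff_of_nonpos fun i _ => carry_nonpos h).1 h0 k hkn)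

theorem orbitSum_const_mul {X : Type*} [AddCommGroup X] (ω : X) (f : X → ℝ) (b : ℝ) (n : ℕ)
    (p : X) : orbitSum ω (fun q => b * f q) n p = b * orbitSum ω f n p :=
  (Finset.mul_sum _ _ _).symm

theorem orbitSum_sum {X ι : Type*} [AddCommGroup X] (ω : X) (s : Finset ι) (f : ι → X → ℝ) (n : ℕ)
    (p : X) : orbitSum ω (fun q => ∑ i ∈ s, f i q) n p = ∑ i ∈ s, orbitSum ω (f i) n p :=
  Finset.sum_comm

/-- The orbit of `p` avoids the vertical lines over `Δ₁` and the horizontal lines over `Δ₂`. -/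
def AvoidsLines {s₁ s₂ : ℕ} (α β : ℝ) (Δ₁ : Fin s₁ → UnitAddCircle) (Δ₂ : Fin s₂ → UnitAddCircle)
    (p : TwoTorus) : Prop :=
  ∀ k : ℕ, (∀ j, p.1 + k • (α : UnitAddCircle) ≠ Δ₁ j) ∧ ∀ j, p.2 + k • (β : UnitAddCircle) ≠ Δ₂ j

/-- The part of the difference of Birkhoff sums that comes from crossings. -/
def jumpSum {s₁ s₂ : ℕ} (α β γ : ℝ) (Δ₁ : Fin s₁ → UnitAddCircle) (Δ₂ : Fin s₂ → UnitAddCircle)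
    (d₁ : Fin s₁ → ℝ) (d₂ : Fin s₂ → ℝ) (p : TwoTorus) (w : ℝ × ℝ) (n : ℕ) : ℝ :=
  ∑ j, ((-∑ k ∈ Finset.range n, carry (p.1 + k • (α : UnitAddCircle) - Δ₁ j) w.1 : ℤ) : ℝ) * d₁ j +
  ∑ j, ((-∑ k ∈ Finset.range n, carry (p.2 + k • (β : UnitAddCircle) - Δ₂ j) w.2 : ℤ) : ℝ) * d₂ j +
  ((∑ k ∈ Finset.range n, heisenbergCarry α β (p + k • torusMk (α, β)) w : ℤ) : ℝ) * γ

theorem orbitSum_sub_eq {s₁ s₂ : ℕ} {α β γ : ℝ} {Δ₁ : Fin s₁ → UnitAddCircle}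
    {Δ₂ : Fin s₂ → UnitAddCircle} {d₁ : Fin s₁ → ℝ} {d₂ : Fin s₂ → ℝ} {G f : TwoTorus → ℝ}
    (hf : ∀ p : TwoTorus, (∀ j, p.1 ≠ Δ₁ j) → (∀ j, p.2 ≠ Δ₂ j) →
      f p = ∑ j, d₁ j * circleFract (p.1 - Δ₁ j) + ∑ j, d₂ j * circleFract (p.2 - Δ₂ j) + G p +
        γ * heisenbergFun α β p)
    {p : TwoTorus} {w : ℝ × ℝ} (hp : AvoidsLines α β Δ₁ Δ₂ p)
    (hpw : AvoidsLines α β Δ₁ Δ₂ (p + torusMk w)) (n : ℕ) :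
    orbitSum (torusMk (α, β)) f n (p + torusMk w) - orbitSum (torusMk (α, β)) f n p =
      n * (w.1 * (∑ j, d₁ j - β * γ) + w.2 * (∑ j, d₂ j + α * γ)) +
      jumpSum α β γ Δ₁ Δ₂ d₁ d₂ p w n +
      (orbitSum (torusMk (α, β)) G n (p + torusMk w) - orbitSum (torusMk (α, β)) G n p) -
      γ * (circleFract (p.1 + n • (α : UnitAddCircle)) *
          carry (p.2 + n • (β : UnitAddCircle)) w.2 - circleFract p.1 * carry p.2 w.2) -
      γ * (w.1 * (circleFract (p.2 + w.2) -
          circleFract (p.2 + n • (β : UnitAddCircle) + w.2))) := by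
  have key : ∀ q : TwoTorus, AvoidsLines α β Δ₁ Δ₂ q → orbitSum (torusMk (α, β)) f n q =
      ∑ j, d₁ j * orbitSum (α : UnitAddCircle) (fun y => circleFract (y - Δ₁ j)) n q.1 +
      ∑ j, d₂ j * orbitSum (β : UnitAddCircle) (fun y => circleFract (y - Δ₂ j)) n q.2 +
      orbitSum (torusMk (α, β)) G n q +
      γ * orbitSum (torusMk (α, β)) (heisenbergFun α β) n q := by
    intro q hq
    have h1 : orbitSum (torusMk (α, β)) f n q = orbitSum (torusMk (α, β)) (fun p =>
        ∑ j, d₁ j * circleFract (p.1 - Δ₁ j) + ∑ j, d₂ j * circleFract (p.2 - Δ₂ j) + G p +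
        γ * heisenbergFun α β p) n q :=
      Finset.sum_congr rfl fun k _ => hf _ (hq k).1 (hq k).2
    rw [h1, orbitSum_add_fun, orbitSum_add_fun, orbitSum_add_fun, orbitSum_sum, orbitSum_sum,
      orbitSum_const_mul]
    simp only [orbitSum_const_mul]
    rfl
  rw [key _ hpw, key _ hp]
  have c1 : ∀ j, orbitSum (α : UnitAddCircle) (fun y => circleFract (y - Δ₁ j)) n
      (p + torusMk w).1 = orbitSum (α : UnitAddCircle) (fun y => circleFract (y - Δ₁ j)) n p.1 +
      (n * w.1 - ((∑ k ∈ Finset.range n, carry (p.1 + k • (α : UnitAddCircle) - Δ₁ j) w.1 : ℤ) : ℝ))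
      := fun j => by
    rw [← orbitSum_circleFract_sub, add_sub_cancel]; rfl
  have c2 : ∀ j, orbitSum (β : UnitAddCircle) (fun y => circleFract (y - Δ₂ j)) n
      (p + torusMk w).2 = orbitSum (β : UnitAddCircle) (fun y => circleFract (y - Δ₂ j)) n p.2 +
      (n * w.2 - ((∑ k ∈ Finset.range n, carry (p.2 + k • (β : UnitAddCircle) - Δ₂ j) w.2 : ℤ) : ℝ))
      := fun j => by
    rw [← orbitSum_circleFract_sub, add_sub_cancel]; rfl
  have c3 := orbitSum_heisenbergFun_sub α β n p w
  simp only [c1, c2, jumpSum, mul_add, mul_sub, Finset.sum_add_distrib, Finset.sum_sub_distrib,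
    ← Finset.sum_mul, Int.cast_neg, neg_mul, Finset.sum_neg_distrib] at c3 ⊢
  simp only [mul_comm (d₁ _), mul_comm (d₂ _)] at c3 ⊢
  linear_combination γ * c3

/-! ### Combinatorial lemmas -/

theorem Finset.exists_block_card_le (A : Finset ℕ) (a ℓ q : ℕ) (hq : 0 < q) :
    ∃ i < q, (q : ℝ) * ((A.filter fun k => a + i * ℓ ≤ k ∧ k < a + (i + 1) * ℓ).card : ℝ) ≤
      A.card := by
  have hq' : (0 : ℝ) < q := by exact_mod_cast hq
  obtain ⟨i, hi, h⟩ := Finset.exists_card_fiber_le_of_card_le_nsmul (s := A)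
    (t := Finset.range q) (f := fun k => (k - a) / ℓ) (b := (A.card : ℝ) / q)
    ⟨0, Finset.mem_range.2 hq⟩ (by
      rw [Finset.card_range, nsmul_eq_mul, mul_div_cancel₀ _ hq'.ne'])
  refine ⟨i, Finset.mem_range.1 hi, ?_⟩
  rw [mul_comm, ← le_div_iff₀ hq']
  refine le_trans ?_ h
  norm_cast
  refine Finset.card_le_card fun k hk => ?_
  rw [Finset.mem_filter] at hk ⊢
  refine ⟨hk.1, Nat.div_eq_of_lt_le ?_ ?_⟩
  · omega
  · have := hk.2.1
    omega

theorem exists_free_block {c α β : ℝ} (hc : 0 < c) (hα : BadlyApproximable c α)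
    (hβ : BadlyApproximable c β) (p : TwoTorus) (B₁ B₂ : Finset UnitAddCircle) {d : ℝ}
    (hd : 0 < d) (N ℓ q : ℕ) (hq : 2 * (B₁.card + B₂.card) < q) (hℓ : 2 * d * (q * ℓ) / c ≤ 1) :
    ∃ i < q, ∀ k, N + i * ℓ ≤ k → k < N + (i + 1) * ℓ →
      (∀ b ∈ B₁, d < ‖p.1 + k • (α : UnitAddCircle) - b‖) ∧
      ∀ b ∈ B₂, d < ‖p.2 + k • (β : UnitAddCircle) - b‖ := by
  classical
  set A₁ := B₁.biUnion fun b => (Finset.range (q * ℓ)).filter fun k : ℕ =>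
    ‖p.1 + N • (α : UnitAddCircle) + ((k * α : ℝ) : UnitAddCircle) - b‖ ≤ d
  set A₂ := B₂.biUnion fun b => (Finset.range (q * ℓ)).filter fun k : ℕ =>
    ‖p.2 + N • (β : UnitAddCircle) + ((k * β : ℝ) : UnitAddCircle) - b‖ ≤ d
  have h1 : A₁.card ≤ B₁.card * 2 := by
    refine Finset.card_biUnion_le_card_mul _ _ _ fun b _ => ?_
    have := hα.card_le hc (p.1 + N • (α : UnitAddCircle)) b hd (q * ℓ)
    push_cast at this
    exact_mod_cast this.trans (by linarith : _ ≤ (2 : ℝ))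
  have h2 : A₂.card ≤ B₂.card * 2 := by
    refine Finset.card_biUnion_le_card_mul _ _ _ fun b _ => ?_
    have := hβ.card_le hc (p.2 + N • (β : UnitAddCircle)) b hd (q * ℓ)
    push_cast at this
    exact_mod_cast this.trans (by linarith : _ ≤ (2 : ℝ))
  obtain ⟨i, hi, h⟩ := Finset.exists_block_card_le (A₁ ∪ A₂) 0 ℓ q (by omega)
  refine ⟨i, hi, ?_⟩
  have hempty : ((A₁ ∪ A₂).filter fun k => 0 + i * ℓ ≤ k ∧ k < 0 + (i + 1) * ℓ).card = 0 := by
    by_contra hne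
    have h3 : (1 : ℝ) ≤
        (((A₁ ∪ A₂).filter fun k => 0 + i * ℓ ≤ k ∧ k < 0 + (i + 1) * ℓ).card : ℝ) := by
      exact_mod_cast Nat.one_le_iff_ne_zero.2 hne
    have h4 : ((A₁ ∪ A₂).card : ℝ) < q := by
      have := Finset.card_union_le A₁ A₂
      exact_mod_cast (by omega : (A₁ ∪ A₂).card < q)
    have h5 : (0 : ℝ) ≤ q := by positivity
    nlinarith
  rw [Finset.card_eq_zero, Finset.filter_eq_empty_iff] at hempty
  intro k hk1 hk2
  obtain ⟨m, rfl⟩ : ∃ m, k = N + m := ⟨k - N, by omega⟩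
  have hm : m ∉ A₁ ∪ A₂ := fun hm => hempty hm ⟨by omega, by omega⟩
  have hmq : m < q * ℓ := by
    have : (i + 1) * ℓ ≤ q * ℓ := Nat.mul_le_mul_right _ hi
    omega
  rw [Finset.mem_union, not_or] at hm
  constructor
  · intro b hb
    by_contra hcon
    refine hm.1 (Finset.mem_biUnion.2 ⟨b, hb, Finset.mem_filter.2 ⟨Finset.mem_range.2 hmq, ?_⟩⟩)
    rw [add_smul, ← add_assoc, nsmul_coe m] at hcon
    exact not_lt.1 hcon
  · intro b hb
    by_contra hcon
    refine hm.2 (Finset.mem_biUnion.2 ⟨b, hb, Finset.mem_filter.2 ⟨Finset.mem_range.2 hmq, ?_⟩⟩)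
    rw [add_smul, ← add_assoc, nsmul_coe m] at hcon
    exact not_lt.1 hcon

/-- On the first or on the last quarter of an interval, an affine function is bounded below by a
quarter of its increment. -/
theorem exists_quarter_le_abs_affine (σ ρ : ℝ) (a L : ℕ) :
    ∃ M : ℕ, a ≤ M ∧ M + L / 4 ≤ a + L ∧ ∀ k : ℕ, M ≤ k → k ≤ M + L / 4 →
      |σ| * L / 4 ≤ |ρ + k * σ| := by
  have hL : ((L / 4 : ℕ) : ℝ) ≤ L / 4 := Nat.cast_div_le
  rcases le_total 0 ((ρ + (a + L / 2 : ℝ) * σ) * σ) with h | h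
  · refine ⟨a + L - L / 4, by omega, by omega, fun k hk _ => ?_⟩
    have hk' : (a : ℝ) + L - L / 4 ≤ k := by
      have : (a + L : ℕ) ≤ k + L / 4 := by omega
      have : ((a + L : ℕ) : ℝ) ≤ ((k + L / 4 : ℕ) : ℝ) := by exact_mod_cast this
      push_cast at this
      linarith
    rcases le_total 0 σ with hσ | hσ
    · rcases hσ.eq_or_lt with rfl | hσ
      · simp
      have := nonneg_of_mul_nonneg_left h hσ
      rw [abs_of_pos hσ]
      refine le_trans ?_ (le_abs_self _)
      nlinarith
    · rcases hσ.eq_or_lt with rfl | hσ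
      · simp
      have := nonpos_of_mul_nonneg_left h hσ
      rw [abs_of_neg hσ]
      refine le_trans ?_ (neg_le_abs _)
      nlinarith
  · refine ⟨a, le_rfl, by omega, fun k hk hk2 => ?_⟩
    have hk' : (k : ℝ) ≤ a + L / 4 := by
      have : (k : ℝ) ≤ ((a + L / 4 : ℕ) : ℝ) := by exact_mod_cast hk2
      push_cast at this
      linarith
    rcases le_total 0 σ with hσ | hσ
    · rcases hσ.eq_or_lt with rfl | hσ
      · simp
      have := nonpos_of_mul_nonpos_left h hσ
      rw [abs_of_pos hσ]
      refine le_trans ?_ (neg_le_abs _)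
      nlinarith
    · rcases hσ.eq_or_lt with rfl | hσ
      · simp
      have : 0 ≤ ρ + (a + L / 2 : ℝ) * σ := by
        by_contra hneg
        exact absurd h (not_le.2 (mul_pos_of_neg_of_neg (not_le.1 hneg) hσ))
      rw [abs_of_neg hσ]
      refine le_trans ?_ (le_abs_self _)
      nlinarith

/-- Integer combinations of `d₁`, `d₂`, `γ` with bounded coefficients, those of `d₁` and `d₂` not
all zero, stay away from zero. -/
def CombinationsAway {s₁ s₂ : ℕ} (γ : ℝ) (d₁ : Fin s₁ → ℝ) (d₂ : Fin s₂ → ℝ) : Prop :=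
  ∀ J : ℤ, ∃ b : ℝ, 0 < b ∧ ∀ (z₁ : Fin s₁ → ℤ) (z₂ : Fin s₂ → ℤ) (z : ℤ), (∀ j, |z₁ j| ≤ J) →
    (∀ j, |z₂ j| ≤ J) → |z| ≤ J → (z₁ ≠ 0 ∨ z₂ ≠ 0) →
    b ≤ |∑ j, (z₁ j : ℝ) * d₁ j + ∑ j, (z₂ j : ℝ) * d₂ j + (z : ℝ) * γ|

theorem combinationsAway_of_ne_zero {s₁ s₂ : ℕ} {γ : ℝ} {d₁ : Fin s₁ → ℝ} {d₂ : Fin s₂ → ℝ}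
    (h : ∀ (z₁ : Fin s₁ → ℤ) (z₂ : Fin s₂ → ℤ) (z : ℤ), (z₁ ≠ 0 ∨ z₂ ≠ 0) →
      ∑ j, (z₁ j : ℝ) * d₁ j + ∑ j, (z₂ j : ℝ) * d₂ j + (z : ℝ) * γ ≠ 0) :
    CombinationsAway γ d₁ d₂ := by
  intro J
  set T : Set ((Fin s₁ → ℤ) × (Fin s₂ → ℤ) × ℤ) :=
    (Set.Icc (fun _ => -J) (fun _ => J) ×ˢ (Set.Icc (fun _ => -J) (fun _ => J) ×ˢ Set.Icc (-J) J)) ∩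
      {z | z.1 ≠ 0 ∨ z.2.1 ≠ 0} with hT
  have hfin : T.Finite := ((Set.finite_Icc _ _).prod
    ((Set.finite_Icc _ _).prod (Set.finite_Icc _ _))).subset Set.inter_subset_left
  have hmem : ∀ (z₁ : Fin s₁ → ℤ) (z₂ : Fin s₂ → ℤ) (z : ℤ), (∀ j, |z₁ j| ≤ J) →
      (∀ j, |z₂ j| ≤ J) → |z| ≤ J → (z₁ ≠ 0 ∨ z₂ ≠ 0) → (z₁, z₂, z) ∈ T := by
    intro z₁ z₂ z h1 h2 h3 h4
    refine ⟨Set.mk_mem_prod ⟨fun j => (abs_le.1 (h1 j)).1, fun j => (abs_le.1 (h1 j)).2⟩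
      (Set.mk_mem_prod ⟨fun j => (abs_le.1 (h2 j)).1, fun j => (abs_le.1 (h2 j)).2⟩
        (abs_le.1 h3)), h4⟩
  rcases T.eq_empty_or_nonempty with he | hne
  · exact ⟨1, one_pos, fun z₁ z₂ z h1 h2 h3 h4 =>
      absurd (hmem z₁ z₂ z h1 h2 h3 h4) (by rw [he]; exact Set.notMem_empty _)⟩
  · let val : (Fin s₁ → ℤ) × (Fin s₂ → ℤ) × ℤ → ℝ := fun z =>
      |∑ j, (z.1 j : ℝ) * d₁ j + ∑ j, (z.2.1 j : ℝ) * d₂ j + (z.2.2 : ℝ) * γ|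
    obtain ⟨m, hm, hmin⟩ := Set.exists_min_image T val hfin hne
    refine ⟨val m, abs_pos.2 (h m.1 m.2.1 m.2.2 hm.2), fun z₁ z₂ z h1 h2 h3 h4 => ?_⟩
    exact hmin (z₁, z₂, z) (hmem z₁ z₂ z h1 h2 h3 h4)

theorem combinationsAway {s₁ s₂ : ℕ} {γ : ℝ} {d₁ : Fin s₁ → ℝ} {d₂ : Fin s₂ → ℝ}
    (hd : LinearIndependent ℚ (Sum.elim d₁ d₂))
    (hγ : LinearIndependent ℚ (Sum.elim (fun _ : Unit => γ) (Sum.elim d₁ d₂)) ∨ γ = 0) :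
    CombinationsAway γ d₁ d₂ := by
  refine combinationsAway_of_ne_zero fun z₁ z₂ z hz h0 => ?_
  have hzero : (∀ j, (z₁ j : ℚ) = 0) ∧ ∀ j, (z₂ j : ℚ) = 0 := by
    rcases hγ with hli | rfl
    · rw [Fintype.linearIndependent_iff] at hli
      have := hli (Sum.elim (fun _ => (z : ℚ)) (Sum.elim (fun j => (z₁ j : ℚ)) fun j => (z₂ j : ℚ)))
        (by simp [Rat.smul_def]; linarith)
      exact ⟨fun j => this (Sum.inr (Sum.inl j)), fun j => this (Sum.inr (Sum.inr j))⟩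
    · rw [Fintype.linearIndependent_iff] at hd
      have := hd (Sum.elim (fun j => (z₁ j : ℚ)) fun j => (z₂ j : ℚ))
        (by simp [Rat.smul_def]; linarith)
      exact ⟨fun j => this (Sum.inl j), fun j => this (Sum.inr j)⟩
  rcases hz with hz | hz
  · exact hz (funext fun j => by exact_mod_cast hzero.1 j)
  · exact hz (funext fun j => by exact_mod_cast hzero.2 j)

/-! ### Long time intervals of slow drift -/

section Drift

variable {s₁ s₂ : ℕ} {α β γ c : ℝ} {Δ₁ : Fin s₁ → UnitAddCircle} {Δ₂ : Fin s₂ → UnitAddCircle}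
  {d₁ : Fin s₁ → ℝ} {d₂ : Fin s₂ → ℝ} {G f : TwoTorus → ℝ}

theorem jumpSum_succ {p : TwoTorus} {w : ℝ × ℝ} {n : ℕ}
    (h₁ : ∀ j, carry (p.1 + n • (α : UnitAddCircle) - Δ₁ j) w.1 = 0)
    (h₂ : ∀ j, carry (p.2 + n • (β : UnitAddCircle) - Δ₂ j) w.2 = 0)
    (h₃ : carry (p.1 + n • (α : UnitAddCircle)) w.1 = 0)
    (h₄ : carry (p.2 + (n + 1) • (β : UnitAddCircle)) w.2 = 0) :
    jumpSum α β γ Δ₁ Δ₂ d₁ d₂ p w (n + 1) = jumpSum α β γ Δ₁ Δ₂ d₁ d₂ p w n := by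
  have h5 : heisenbergCarry α β (p + n • torusMk (α, β)) w = 0 := by
    rw [succ_nsmul, ← add_assoc] at h₄
    have f1 : (p + n • torusMk (α, β)).1 = p.1 + n • (α : UnitAddCircle) := rfl
    have f2 : (p + n • torusMk (α, β)).2 = p.2 + n • (β : UnitAddCircle) := rfl
    rw [heisenbergCarry, f1, f2, h₃, h₄]; ring
  simp only [jumpSum, Finset.sum_range_succ, h₁, h₂, h5, add_zero]

theorem jumpSum_coeff_le (hc : 0 < c) (hα : BadlyApproximable c α) (hβ : BadlyApproximable c β)
    (hα1 : α ∈ Set.Ico (0 : ℝ) 1) (hβ1 : β ∈ Set.Ico (0 : ℝ) 1) {p : TwoTorus} {w : ℝ × ℝ}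
    (hw : ‖w‖ < 1) (hw0 : 0 < ‖w‖) {n : ℕ} {A : ℝ} (hn : n * ‖w‖ ≤ A) {J : ℤ}
    (hJ : 2 * (2 * A / c + 1) ≤ J) :
    (∀ j, |-∑ k ∈ Finset.range n, carry (p.1 + k • (α : UnitAddCircle) - Δ₁ j) w.1| ≤ J) ∧
    (∀ j, |-∑ k ∈ Finset.range n, carry (p.2 + k • (β : UnitAddCircle) - Δ₂ j) w.2| ≤ J) ∧
    |∑ k ∈ Finset.range n, heisenbergCarry α β (p + k • torusMk (α, β)) w| ≤ J := by
  have h0 : 2 * ‖w‖ * n / c + 1 ≤ 2 * A / c + 1 := by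
    have : 2 * ‖w‖ * n ≤ 2 * A := by linarith
    gcongr
  have hpos : 0 ≤ 2 * ‖w‖ * n / c + 1 := by positivity
  refine ⟨fun j => ?_, fun j => ?_, ?_⟩
  · have := abs_sum_carry_le hc hα (p.1 - Δ₁ j) (norm_fst_le w) hw hw0 n
    simp only [sub_add_eq_add_sub] at this
    rw [abs_neg]
    exact_mod_cast this.trans (by linarith : _ ≤ (J : ℝ))
  · have := abs_sum_carry_le hc hβ (p.2 - Δ₂ j) (norm_snd_le w) hw hw0 n
    simp only [sub_add_eq_add_sub] at this
    rw [abs_neg]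
    exact_mod_cast this.trans (by linarith : _ ≤ (J : ℝ))
  · exact_mod_cast (abs_sum_heisenbergCarry_le hc hα hβ hα1 hβ1 p hw hw0 n).trans
      (by linarith : _ ≤ (J : ℝ))

/-- For every tolerance `e` and for sufficiently close points `p` and `p + w` whose orbits
avoid the discontinuities, the difference of the Birkhoff sums is, up to `e`, an affine function
of time bounded away from zero and infinity, on an interval of times comparable with `1 / ‖w‖`. -/
theorem exists_drift_window (hα1 : α ∈ Set.Ico (0 : ℝ) 1) (hβ1 : β ∈ Set.Ico (0 : ℝ) 1)
    (hc : 0 < c) (hα : BadlyApproximable c α) (hβ : BadlyApproximable c β) (hs₁ : 0 < s₁)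
    (hs₂ : 0 < s₂) (hcomb : CombinationsAway γ d₁ d₂)
    (hG : ∀ A e : ℝ, 0 < A → 0 < e → ∃ δ : ℝ, 0 < δ ∧ ∀ (p : TwoTorus) (w : ℝ × ℝ) (n : ℕ),
      ‖w‖ < δ → n * ‖w‖ ≤ A →
      |orbitSum (torusMk (α, β)) G n (p + torusMk w) - orbitSum (torusMk (α, β)) G n p| ≤ e)
    (hf : ∀ p : TwoTorus, (∀ j, p.1 ≠ Δ₁ j) → (∀ j, p.2 ≠ Δ₂ j) →
      f p = ∑ j, d₁ j * circleFract (p.1 - Δ₁ j) + ∑ j, d₂ j * circleFract (p.2 - Δ₂ j) + G p +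
        γ * heisenbergFun α β p) :
    ∃ b B κ S A : ℝ, 0 < b ∧ 0 < κ ∧ 0 ≤ S ∧ ∀ e : ℝ, 0 < e → ∀ η : ℝ, 0 < η →
      ∃ δ : ℝ, 0 < δ ∧ ∀ (p : TwoTorus) (w : ℝ × ℝ), w ≠ 0 → ‖w‖ < δ → η < circleFract p.2 →
        circleFract p.2 < 1 - η → AvoidsLines α β Δ₁ Δ₂ p →
        AvoidsLines α β Δ₁ Δ₂ (p + torusMk w) →
        ∃ (M L : ℕ) (σ ρ : ℝ), |σ| ≤ S * ‖w‖ ∧ 1 ≤ M * ‖w‖ ∧ κ ≤ L * ‖w‖ ∧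
          (M + L) * ‖w‖ ≤ A ∧ ∀ k : ℕ, M ≤ k → k ≤ M + L → b ≤ |ρ + k * σ| ∧ |ρ + k * σ| ≤ B ∧
            |orbitSum (torusMk (α, β)) f k (p + torusMk w) - orbitSum (torusMk (α, β)) f k p -
              (ρ + k * σ)| ≤ e := by
  classical
  set q : ℕ := 2 * (s₁ + s₂ + 2) + 1 with hq
  have hq0 : (0 : ℝ) < q := by positivity
  set c₁ : ℝ := c / (2 * q) with hc₁
  have hc₁0 : 0 < c₁ := by positivity
  set A₀ : ℝ := 6 / c + 4 with hA₀
  have hA₀4 : 4 ≤ A₀ := by have : 0 < 6 / c := by positivity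
                           linarith
  set A : ℝ := A₀ + 1 + c / 2 with hA
  have hA0 : 0 < A := by linarith
  obtain ⟨J, hJ⟩ : ∃ J : ℤ, 2 * (2 * A / c + 1) ≤ J := ⟨⌈2 * (2 * A / c + 1)⌉, Int.le_ceil _⟩
  have hJ0 : (0 : ℝ) ≤ J := le_trans (by positivity) hJ
  obtain ⟨b₀, hb₀, hb⟩ := hcomb J
  set S₁ := ∑ j, d₁ j - β * γ
  set S₂ := ∑ j, d₂ j + α * γ
  set S := |S₁| + |S₂| with hS
  have hS0 : 0 ≤ S := by positivity
  refine ⟨min (b₀ / 2) (b₀ * c₁ / (16 * A)),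
    J * (∑ j, |d₁ j| + ∑ j, |d₂ j| + |γ|) + A * S, c₁ / 8, S, A, by positivity, by positivity,
    hS0, fun e he η hη => ?_⟩
  obtain ⟨δ, hδ, hδG⟩ := hG A (e / 2) hA0 (by positivity)
  refine ⟨min δ (min η (min (c₁ / 32) (min 1 (e / 2 / (|γ| + 1))))), by positivity,
    fun p w hw0 hwδ hpη hpη' hp hpw => ?_⟩
  simp only [lt_min_iff] at hwδ
  obtain ⟨hwδ, hwη, hwc, hw1, hwe⟩ := hwδ
  set d := ‖w‖ with hd
  have hd0 : 0 < d := norm_pos_iff.2 hw0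
  have hu : |w.1| ≤ d := norm_fst_le w
  have hv : |w.2| ≤ d := norm_snd_le w
  set N : ℕ := ⌈A₀ / d⌉₊ with hN
  have hN1 : A₀ ≤ N * d := by rw [← div_le_iff₀ hd0]; exact Nat.le_ceil _
  have hN2 : N * d ≤ A₀ + d := by
    have h1 : (N : ℝ) < A₀ / d + 1 := Nat.ceil_lt_add_one (by positivity)
    have h2 := mul_le_mul_of_nonneg_right h1.le hd0.le
    rwa [add_mul, div_mul_cancel₀ _ hd0.ne', one_mul] at h2
  set ℓ : ℕ := ⌊c₁ / d⌋₊ with hℓ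
  have hℓ1 : ℓ * d ≤ c₁ := by rw [← le_div_iff₀ hd0]; exact Nat.floor_le (by positivity)
  have hℓ2 : c₁ - d ≤ ℓ * d := by
    have h1 : c₁ / d < (ℓ : ℝ) + 1 := Nat.lt_floor_add_one _
    rw [div_lt_iff₀ hd0] at h1
    linarith
  have hqc : q * c₁ = c / 2 := by rw [hc₁]; field_simp
  have hqℓ : (q * ℓ : ℝ) * d ≤ c / 2 := by rw [← hqc, mul_assoc]; gcongr
  set B₁ : Finset UnitAddCircle := insert 0 (Finset.univ.image Δ₁) with hB₁
  set B₂ : Finset UnitAddCircle := insert 0 (Finset.univ.image Δ₂) with hB₂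
  have hcard : 2 * (B₁.card + B₂.card) < q := by
    have h1 : B₁.card ≤ s₁ + 1 := (Finset.card_insert_le _ _).trans
      (Nat.add_le_add_right (Finset.card_image_le.trans (by simp)) 1)
    have h2 : B₂.card ≤ s₂ + 1 := (Finset.card_insert_le _ _).trans
      (Nat.add_le_add_right (Finset.card_image_le.trans (by simp)) 1)
    omega
  obtain ⟨i, hi, hfree⟩ := exists_free_block hc hα hβ p B₁ B₂ hd0 N ℓ q hcard (by
    rw [div_le_one hc]; linarith)
  -- no crossing takes place during the chosen block
  have hℓpos : 1 ≤ ℓ := by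
    have : 0 < (ℓ : ℝ) * d := by linarith
    have : 0 < (ℓ : ℝ) := pos_of_mul_pos_left this hd0.le
    exact_mod_cast this
  obtain ⟨a, L', haN, hL'ℓ, haL', hblock⟩ : ∃ a L' : ℕ, N ≤ a ∧ L' + 1 = ℓ ∧ a + L' ≤ N + q * ℓ ∧
      ∀ k, a ≤ k → k ≤ a + L' → (∀ b ∈ B₁, carry (p.1 + k • (α : UnitAddCircle) - b) w.1 = 0) ∧
        ∀ b ∈ B₂, carry (p.2 + k • (β : UnitAddCircle) - b) w.2 = 0 := by
    have hsucc : (i + 1) * ℓ = i * ℓ + ℓ := by ring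
    refine ⟨N + i * ℓ, ℓ - 1, by omega, by omega, ?_, fun k hk1 hk2 => ?_⟩
    · have : (i + 1) * ℓ ≤ q * ℓ := Nat.mul_le_mul_right _ hi
      omega
    · obtain ⟨h1, h2⟩ := hfree k hk1 (by omega)
      constructor
      · intro b hb
        by_contra hne
        exact absurd ((norm_le_of_carry_ne_zero hne).trans hu) (not_le.2 (h1 b hb))
      · intro b hb
        by_contra hne
        exact absurd ((norm_le_of_carry_ne_zero hne).trans hv) (not_le.2 (h2 b hb))
  have hΔ₁ : ∀ j, Δ₁ j ∈ B₁ := fun j =>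
    Finset.mem_insert_of_mem (Finset.mem_image_of_mem _ (Finset.mem_univ j))
  have hΔ₂ : ∀ j, Δ₂ j ∈ B₂ := fun j =>
    Finset.mem_insert_of_mem (Finset.mem_image_of_mem _ (Finset.mem_univ j))
  have hz₁ : ∀ k, a ≤ k → k ≤ a + L' → carry (p.1 + k • (α : UnitAddCircle)) w.1 = 0 := by
    intro k h1 h2
    have := (hblock k h1 h2).1 0 (Finset.mem_insert_self _ _)
    rwa [sub_zero] at this
  have hz₂ : ∀ k, a ≤ k → k ≤ a + L' → carry (p.2 + k • (β : UnitAddCircle)) w.2 = 0 := by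
    intro k h1 h2
    have := (hblock k h1 h2).2 0 (Finset.mem_insert_self _ _)
    rwa [sub_zero] at this
  set ρ := jumpSum α β γ Δ₁ Δ₂ d₁ d₂ p w a with hρ
  have hconst : ∀ t, t ≤ L' → jumpSum α β γ Δ₁ Δ₂ d₁ d₂ p w (a + t) = ρ := by
    intro t
    induction t with
    | zero => intro _; rfl
    | succ t ih =>
      intro ht
      rw [← ih (by omega), ← add_assoc]
      obtain ⟨h1, h2⟩ := hblock (a + t) (by omega) (by omega)
      exact jumpSum_succ (fun j => h1 _ (hΔ₁ j)) (fun j => h2 _ (hΔ₂ j))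
        (hz₁ _ (by omega) (by omega)) (hz₂ (a + t + 1) (by omega) (by omega))
  have htime : ∀ k : ℕ, k ≤ a + L' → k * d ≤ A := by
    intro k hk
    have h1 : (k : ℝ) ≤ ((N + q * ℓ : ℕ) : ℝ) := by exact_mod_cast hk.trans haL'
    push_cast at h1
    calc k * d ≤ (N + q * ℓ) * d := by gcongr
      _ = N * d + q * ℓ * d := by ring
      _ ≤ A := by linarith
  obtain ⟨hJ₁, hJ₂, hJ₃⟩ := jumpSum_coeff_le (Δ₁ := Δ₁) (Δ₂ := Δ₂) hc hα hβ hα1 hβ1 (p := p) hw1 hd0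
    (htime a (by omega)) hJ
  have hlate : ∀ u : ℝ, |u| = d → u ≠ 0 ∧ 6 / (c * |u|) + 2 < (a : ℝ) := by
    intro u hu
    refine ⟨abs_pos.1 (hu ▸ hd0), ?_⟩
    have h1 : (N : ℝ) ≤ a := by exact_mod_cast haN
    refine lt_of_lt_of_le ?_ h1
    rw [hu]
    have h2 : A₀ / d ≤ N := Nat.le_ceil _
    have h3 : A₀ / d = 6 / (c * d) + 4 / d := by rw [hA₀]; field_simp
    have h4 : 4 ≤ 4 / d := by rw [le_div_iff₀ hd0]; linarith
    linarith
  have hρb : b₀ ≤ |ρ| := by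
    refine hb _ _ _ hJ₁ hJ₂ hJ₃ ?_
    rcases max_choice ‖w.1‖ ‖w.2‖ with h | h
    · left
      obtain ⟨h1, h2⟩ := hlate w.1 (by rw [hd, Prod.norm_def, h, Real.norm_eq_abs])
      intro h0
      exact exists_sum_carry_ne_zero hc hα p.1 (Δ₁ ⟨0, hs₁⟩) h1 h2
        (neg_eq_zero.1 (congrFun h0 ⟨0, hs₁⟩))
    · right
      obtain ⟨h1, h2⟩ := hlate w.2 (by rw [hd, Prod.norm_def, h, Real.norm_eq_abs])
      intro h0
      exact exists_sum_carry_ne_zero hc hβ p.2 (Δ₂ ⟨0, hs₂⟩) h1 h2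
        (neg_eq_zero.1 (congrFun h0 ⟨0, hs₂⟩))
  have hρB : |ρ| ≤ J * (∑ j, |d₁ j| + ∑ j, |d₂ j| + |γ|) := by
    have hterm : ∀ (z : ℤ) (t : ℝ), |z| ≤ J → |(z : ℝ) * t| ≤ J * |t| := by
      intro z t hz
      rw [abs_mul]
      have : |(z : ℝ)| ≤ J := by exact_mod_cast hz
      gcongr
    rw [hρ, jumpSum, mul_add, mul_add, Finset.mul_sum, Finset.mul_sum]
    refine (abs_add_three _ _ _).trans (add_le_add (add_le_add ?_ ?_) (hterm _ _ hJ₃))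
    · exact (Finset.abs_sum_le_sum_abs _ _).trans (Finset.sum_le_sum fun j _ => hterm _ _ (hJ₁ j))
    · exact (Finset.abs_sum_le_sum_abs _ _).trans (Finset.sum_le_sum fun j _ => hterm _ _ (hJ₂ j))
  set σ := w.1 * S₁ + w.2 * S₂ with hσ
  have hσS : |σ| ≤ S * d := by
    refine (abs_add_le _ _).trans ?_
    rw [abs_mul, abs_mul, hS, add_mul, mul_comm |S₁|, mul_comm |S₂|]
    gcongr
  obtain ⟨M, haM, hMa, hquarter⟩ := exists_quarter_le_abs_affine σ ρ a L'
  have hL'd : c₁ - 2 * d ≤ L' * d := by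
    have : (L' : ℝ) + 1 = ℓ := by exact_mod_cast hL'ℓ
    have : (L' : ℝ) * d = ℓ * d - d := by rw [← this]; ring
    linarith
  refine ⟨M, L' / 4, σ, ρ, hσS, ?_, ?_, ?_, fun k hk1 hk2 => ⟨?_, ?_, ?_⟩⟩
  · have h1 : (N : ℝ) ≤ M := by exact_mod_cast haN.trans haM
    have : (N : ℝ) * d ≤ M * d := by gcongr
    linarith
  · have h1 : (L' : ℝ) ≤ 4 * ((L' / 4 : ℕ) : ℝ) + 3 := by
      exact_mod_cast (by omega : L' ≤ 4 * (L' / 4) + 3)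
    have h2 : (L' : ℝ) * d ≤ 4 * (((L' / 4 : ℕ) : ℝ) * d) + 3 * d := by
      calc (L' : ℝ) * d ≤ (4 * ((L' / 4 : ℕ) : ℝ) + 3) * d := by gcongr
        _ = _ := by ring
    linarith
  · have := htime (M + L' / 4) hMa
    push_cast at this
    exact this
  · by_cases hsmall : |σ| * A ≤ b₀ / 2 * d
    · refine (min_le_left _ _).trans ?_
      have h1 : |(k : ℝ) * σ| ≤ b₀ / 2 := by
        have h2 := htime k (hk2.trans hMa)
        rw [abs_mul, Nat.abs_cast]
        have h3 : k * |σ| * d ≤ b₀ / 2 * d := by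
          calc k * |σ| * d = |σ| * (k * d) := by ring
            _ ≤ |σ| * A := by gcongr
            _ ≤ _ := hsmall
        exact le_of_mul_le_mul_right h3 hd0
      have h4 := abs_sub_abs_le_abs_sub ρ (-(k * σ))
      rw [abs_neg, sub_neg_eq_add] at h4
      linarith
    · refine (min_le_right _ _).trans (le_trans ?_ (hquarter k hk1 hk2))
      push Not at hsmall
      rw [div_le_iff₀ (by positivity)]
      have h1 : c₁ / 2 ≤ L' * d := by linarith
      have h2 : b₀ / 2 * (c₁ / 2) * d ≤ |σ| * A * L' * d := by
        calc b₀ / 2 * (c₁ / 2) * d = (b₀ / 2 * d) * (c₁ / 2) := by ring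
          _ ≤ (|σ| * A) * (L' * d) := by gcongr
          _ = _ := by ring
      have h3 := le_of_mul_le_mul_right h2 hd0
      linarith
  · refine (abs_add_le _ _).trans (add_le_add hρB ?_)
    rw [abs_mul, Nat.abs_cast]
    calc k * |σ| ≤ k * (S * d) := by gcongr
      _ = (k * d) * S := by ring
      _ ≤ A * S := by gcongr; exact htime k (hk2.trans hMa)
  · have hk : k ≤ a + L' := hk2.trans hMa
    obtain ⟨t, rfl⟩ : ∃ t, k = a + t := ⟨k - a, by omega⟩
    have hl0 : carry p.2 w.2 = 0 := by
      have := abs_le.1 hv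
      exact Int.floor_eq_zero_iff.2 ⟨by linarith, by linarith⟩
    rw [orbitSum_sub_eq hf hp hpw, hconst t (by omega), hz₂ (a + t) (by omega) hk, hl0]
    have h1 := hδG p w (a + t) hwδ (htime _ hk)
    have h2 : |γ * (w.1 * (circleFract (p.2 + w.2) -
        circleFract (p.2 + (a + t) • (β : UnitAddCircle) + w.2)))| ≤ e / 2 := by
      have h3 : |circleFract (p.2 + w.2) -
          circleFract (p.2 + (a + t) • (β : UnitAddCircle) + w.2)| ≤ 1 := by
        have t1 := circleFract_nonneg (p.2 + w.2)
        have t2 := circleFract_lt_one (p.2 + w.2)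
        have t3 := circleFract_nonneg (p.2 + (a + t) • (β : UnitAddCircle) + w.2)
        have t4 := circleFract_lt_one (p.2 + (a + t) • (β : UnitAddCircle) + w.2)
        rw [abs_le]; constructor <;> linarith
      rw [abs_mul, abs_mul]
      calc _ ≤ |γ| * (d * 1) := by gcongr
        _ ≤ (|γ| + 1) * d := by linarith
        _ ≤ e / 2 := by rw [lt_div_iff₀ (by positivity)] at hwe; linarith
    have e1 : ∀ T D E F X : ℝ, T + ρ + D - γ * (X * ((0 : ℤ) : ℝ) - E * ((0 : ℤ) : ℝ)) - F -
        (ρ + T) = D - F := by intro T D E F X; push_cast; ring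
    rw [e1]
    exact (abs_sub _ _).trans (by linarith)

end Drift

/-! ### A maximal inequality -/

theorem maximal_combinatorial {a : ℕ → ℝ} (ha : ∀ k, 0 ≤ a k) {η : ℝ} (hη : 0 ≤ η) (m : ℕ)
    (b : ℕ → ℝ) (hb : ∀ i, b i = 0 ∨ b i = 1 ∧ ∃ l, 1 ≤ l ∧ l ≤ m ∧
      η * l ≤ ∑ k ∈ Finset.range l, a (i + k)) (N : ℕ) : ∀ s : ℕ,
    η * ∑ i ∈ Finset.range N, b (s + i) ≤ ∑ k ∈ Finset.range (N + m), a (s + k) := by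
  have hb1 : ∀ i, b i ≤ 1 := fun i => by rcases hb i with h | h <;> linarith
  induction N using Nat.strong_induction_on with
  | _ N ih =>
    intro s
    rcases Nat.eq_zero_or_pos N with rfl | hN
    · simpa using Finset.sum_nonneg fun k _ => ha (s + k)
    rcases hb s with h0 | ⟨-, l, hl1, hlm, hl⟩
    · obtain ⟨N, rfl⟩ : ∃ N', N = N' + 1 := ⟨N - 1, by omega⟩
      rw [Finset.sum_range_succ', show N + 1 + m = N + m + 1 by ring, Finset.sum_range_succ',
        add_zero, h0, add_zero]
      have := ih N (by omega) (s + 1)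
      simp only [add_assoc, add_comm 1] at this ⊢
      linarith [ha s]
    · rcases le_or_gt N l with hNl | hNl
      · calc η * ∑ i ∈ Finset.range N, b (s + i) ≤ η * l := by
              refine mul_le_mul_of_nonneg_left ?_ hη
              refine (Finset.sum_le_card_nsmul _ _ 1 fun i _ => hb1 _).trans ?_
              simpa using hNl
          _ ≤ ∑ k ∈ Finset.range l, a (s + k) := hl
          _ ≤ _ := Finset.sum_le_sum_of_subset_of_nonneg
              (Finset.range_mono (by omega)) fun k _ _ => ha _
      · obtain ⟨N', rfl⟩ : ∃ N', N = l + N' := ⟨N - l, by omega⟩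
        have h1 := ih N' (by omega) (s + l)
        rw [Finset.sum_range_add, add_assoc, Finset.sum_range_add, mul_add]
        simp only [← add_assoc] at h1 ⊢
        refine add_le_add (le_trans ?_ hl) h1
        refine mul_le_mul_of_nonneg_left ?_ hη
        exact (Finset.sum_le_card_nsmul _ _ 1 fun i _ => hb1 _).trans (by simp)

section Maximal

variable {Ω : Type*} [MeasurableSpace Ω] {ν : Measure Ω} [IsFiniteMeasure ν] {Ψ : Ω → Ω}
  {B : Set Ω}

/-- The number of visits of the orbit of `z` to `B` before time `m`. -/
def visits (Ψ : Ω → Ω) (B : Set Ω) (m : ℕ) (z : Ω) : ℝ :=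
  ∑ k ∈ Finset.range m, B.indicator 1 (Ψ^[k] z)

theorem measurable_visits (hΨ : Measurable Ψ) (hB : MeasurableSet B) (m : ℕ) :
    Measurable (visits Ψ B m) :=
  Finset.measurable_fun_sum _ fun k _ => (measurable_one.indicator hB).comp (hΨ.iterate k)

theorem integral_visits (hΨ : MeasurePreserving Ψ ν ν) (hB : MeasurableSet B) (m : ℕ) :
    Integrable (visits Ψ B m) ν ∧ ∫ z, visits Ψ B m z ∂ν = m * ν.real B := by
  have h1 : ∀ k, (fun z => B.indicator (1 : Ω → ℝ) (Ψ^[k] z)) = (Ψ^[k] ⁻¹' B).indicator 1 :=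
    fun k => rfl
  have hmeas : ∀ k, MeasurableSet (Ψ^[k] ⁻¹' B) := fun k => (hΨ.iterate k).measurable hB
  have hint : ∀ k, Integrable (fun z => B.indicator (1 : Ω → ℝ) (Ψ^[k] z)) ν := fun k => by
    rw [h1]; exact (integrable_const (1 : ℝ)).indicator (hmeas k)
  refine ⟨integrable_finsetSum _ fun k _ => hint k, ?_⟩
  simp only [visits]
  rw [integral_finsetSum _ fun k _ => hint k]
  have h2 : ∀ k, ∫ z, B.indicator (1 : Ω → ℝ) (Ψ^[k] z) ∂ν = ν.real B := fun k => by
    rw [h1, integral_indicator_one (hmeas k), measureReal_def, measureReal_def,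
      (hΨ.iterate k).measure_preimage hB.nullMeasurableSet]
  simp [h2]

/-- The set of points whose orbit visits `B` with frequency more than `η` on some initial
segment. -/
def frequentVisits (Ψ : Ω → Ω) (B : Set Ω) (η : ℝ) : Set Ω :=
  {z | ∃ m : ℕ, 1 ≤ m ∧ η * m < visits Ψ B m z}

theorem measurableSet_frequentVisits (hΨ : Measurable Ψ) (hB : MeasurableSet B) (η : ℝ) :
    MeasurableSet (frequentVisits Ψ B η) := by
  have : frequentVisits Ψ B η = ⋃ m : ℕ, ⋃ _ : 1 ≤ m, {z | η * m < visits Ψ B m z} := by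
    ext z; simp [frequentVisits]
  rw [this]
  exact MeasurableSet.iUnion fun m => MeasurableSet.iUnion fun _ =>
    measurableSet_lt measurable_const (measurable_visits hΨ hB m)

theorem measure_frequentVisits_le (hΨ : MeasurePreserving Ψ ν ν) (hB : MeasurableSet B) {η : ℝ}
    (hη : 0 < η) : ν.real (frequentVisits Ψ B η) ≤ ν.real B / η := by
  set F : ℕ → Set Ω := fun m => {z | ∃ l : ℕ, 1 ≤ l ∧ l ≤ m ∧ η * l < visits Ψ B l z} with hF
  have hFm : ∀ m, MeasurableSet (F m) := by
    intro m
    have : F m = ⋃ l : ℕ, ⋃ _ : 1 ≤ l, ⋃ _ : l ≤ m, {z | η * l < visits Ψ B l z} := by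
      ext z; simp only [hF, Set.mem_ofPred_eq, Set.mem_iUnion, exists_prop]
    rw [this]
    exact MeasurableSet.iUnion fun l => MeasurableSet.iUnion fun _ => MeasurableSet.iUnion fun _ =>
      measurableSet_lt measurable_const (measurable_visits hΨ.measurable hB l)
  have hFle : ∀ m, ν.real (F m) ≤ ν.real B / η := by
    intro m
    rw [le_div_iff₀' hη]
    have hineq : ∀ N : ℕ, η * (N * ν.real (F m)) ≤ (N + m : ℕ) * ν.real B := by
      intro N
      obtain ⟨hi1, he1⟩ := integral_visits hΨ (hFm m) N
      obtain ⟨hi2, he2⟩ := integral_visits hΨ hB (N + m)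
      rw [← he1, ← he2, ← integral_const_mul]
      refine integral_mono (hi1.const_mul η) hi2 fun z => ?_
      have := maximal_combinatorial (a := fun k => B.indicator (1 : Ω → ℝ) (Ψ^[k] z))
        (fun k => Set.indicator_nonneg (fun _ _ => zero_le_one) _) hη.le m
        (fun i => (F m).indicator (1 : Ω → ℝ) (Ψ^[i] z)) (fun i => ?_) N 0
      · simpa only [visits, zero_add] using this
      · by_cases hz : Ψ^[i] z ∈ F m
        · right
          refine ⟨by rw [Set.indicator_of_mem hz]; rfl, ?_⟩
          obtain ⟨l, hl1, hl2, hl3⟩ := hz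
          refine ⟨l, hl1, hl2, hl3.le.trans (le_of_eq ?_)⟩
          refine Finset.sum_congr rfl fun k _ => ?_
          rw [add_comm i k, Function.iterate_add_apply]
        · left; exact Set.indicator_of_notMem hz _
    by_contra hcon
    push Not at hcon
    obtain ⟨N, hN⟩ := exists_nat_gt (m * ν.real B / (η * ν.real (F m) - ν.real B))
    rw [div_lt_iff₀ (by linarith)] at hN
    have := hineq N
    push_cast at this
    linarith
  have hmono : Monotone F := fun m n hmn z hz => by
    obtain ⟨l, h1, h2, h3⟩ := hz
    exact ⟨l, h1, h2.trans hmn, h3⟩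
  have hU : frequentVisits Ψ B η = ⋃ m, F m := by
    ext z
    simp only [frequentVisits, hF, Set.mem_iUnion]
    exact ⟨fun ⟨m, h1, h2⟩ => ⟨m, m, h1, le_rfl, h2⟩, fun ⟨_, l, h1, _, h2⟩ => ⟨l, h1, h2⟩⟩
  rw [hU]
  have ht := tendsto_measure_iUnion_atTop (μ := ν) hmono
  have ht' : Tendsto (fun m => ν.real (F m)) atTop (𝓝 (ν.real (⋃ m, F m))) :=
    (ENNReal.tendsto_toReal (measure_ne_top _ _)).comp ht
  exact le_of_tendsto' ht' hFle

end Maximal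

/-! ### Return times to the section of a special flow along two nearby orbits -/

theorem exists_mem_Ico_succ {u : ℕ → ℝ} {x : ℝ} {a : ℕ} (ha : u a ≤ x) :
    ∀ L : ℕ, x < u (a + L) → ∃ k, a ≤ k ∧ k < a + L ∧ u k ≤ x ∧ x < u (k + 1)
  | 0, h => absurd ha (not_le.2 (by simpa using h))
  | L + 1, h => by
    rcases lt_or_ge x (u (a + L)) with h1 | h1
    · obtain ⟨k, h2, h3, h4⟩ := exists_mem_Ico_succ ha L h1
      exact ⟨k, h2, by omega, h4⟩
    · exact ⟨a + L, by omega, by omega, h1, h⟩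

theorem exists_good_block {u v : ℕ → ℝ} {c C D s s' t e σ ρ : ℝ} {M L Q ℓ : ℕ} (hc : 0 < c)
    (he : 0 < e) (het : 6 * e < t) (hQ : 0 < Q) (hℓ : 0 < ℓ) (hu : StrictMono u)
    (hlow : ∀ k j, c * j - C ≤ u (k + j) - u k) (hup : ∀ k, u (k + 1) ≤ u k + D)
    (hs : s ≤ u M) (hss : |s - s'| ≤ e)
    (hv : ∀ k, M ≤ k → k ≤ M + L → |v k - u k - (ρ + k * σ)| ≤ e)
    (hℓL : t * (Q * ℓ) + t + C ≤ c * L) (hσ : |σ| * ((ℓ * t + D + C) / c + 1) ≤ e)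
    (W : Finset ℕ) (hW : ∀ k ≤ M + L, ∀ n : ℕ, |s + n * t - u k| ≤ 3 * e → k ∈ W) :
    ∃ (m k₀ : ℕ) (G : Finset ℕ), G ⊆ Finset.Ico m (m + ℓ) ∧
      (Q : ℝ) * (ℓ - G.card) ≤ W.card ∧ u M - s ≤ m * t ∧ m * t ≤ u M - s + c * L - C ∧
      M ≤ k₀ ∧ k₀ ≤ M + L ∧ ∀ n ∈ G, ∃ k, u k ≤ s + n * t ∧ s + n * t < u (k + 1) ∧
        v k ≤ s' + (n * t + (ρ + k₀ * σ)) ∧ s' + (n * t + (ρ + k₀ * σ)) < v (k + 1) ∧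
        |(s + n * t - u k) - (s' + (n * t + (ρ + k₀ * σ)) - v k)| ≤ 3 * e := by
  have ht : 0 < t := by linarith
  set m₀ := ⌈(u M - s) / t⌉₊ with hm₀
  have hm1 : u M - s ≤ m₀ * t := by
    rw [← div_le_iff₀ ht]; exact Nat.le_ceil _
  have hm2 : m₀ * t < u M - s + t := by
    have := Nat.ceil_lt_add_one (div_nonneg (sub_nonneg.2 hs) ht.le)
    rw [← hm₀, ← sub_lt_iff_lt_add, lt_div_iff₀ ht] at this
    linarith
  have hk : ∀ n, m₀ ≤ n → n < m₀ + Q * ℓ →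
      ∃ k, M ≤ k ∧ k < M + L ∧ u k ≤ s + n * t ∧ s + n * t < u (k + 1) := by
    intro n h1 h2
    refine exists_mem_Ico_succ ?_ L ?_
    · have : (m₀ : ℝ) * t ≤ n * t := mul_le_mul_of_nonneg_right (by exact_mod_cast h1) ht.le
      linarith
    · have h3 : (n : ℝ) * t ≤ (m₀ + Q * ℓ : ℝ) * t :=
        mul_le_mul_of_nonneg_right (by exact_mod_cast h2.le) ht.le
      have := hlow M L
      linarith
  choose! k hkM hkL hk1 hk2 using hk
  have hD : 0 ≤ D := by linarith [hup 0, hu (Nat.lt_succ_self 0)]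
  classical
  set bad : Finset ℕ := (Finset.Ico m₀ (m₀ + Q * ℓ)).filter
    (fun n => s + n * t - u (k n) < 3 * e ∨ u (k n + 1) - (s + n * t) ≤ 3 * e) with hbad
  have hcard : bad.card ≤ W.card := by
    set φ : ℕ → ℕ := fun n => if s + n * t - u (k n) < 3 * e then k n else k n + 1 with hφ
    have hφE : ∀ n ∈ bad, |s + n * t - u (φ n)| ≤ 3 * e ∧ φ n ≤ M + L := by
      intro n hn
      simp only [hbad, Finset.mem_filter, Finset.mem_Ico] at hn
      obtain ⟨⟨h1, h2⟩, h3⟩ := hn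
      have h4 := hk1 n h1 h2
      have h5 := hk2 n h1 h2
      have h6 := hkL n h1 h2
      by_cases h : s + n * t - u (k n) < 3 * e
      · simp only [hφ, if_pos h]
        exact ⟨abs_le.2 ⟨by linarith, h.le⟩, h6.le⟩
      · simp only [hφ, if_neg h]
        have h7 := h3.resolve_left h
        exact ⟨abs_le.2 ⟨by linarith, by linarith⟩, h6⟩
    refine Finset.card_le_card_of_injOn φ (fun n hn => ?_) (fun n hn n' hn' hnn => ?_)
    · obtain ⟨h1, h2⟩ := hφE n hn
      exact hW _ h2 n h1
    · have h1 := (hφE n hn).1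
      have h2 := (hφE n' hn').1
      rw [← hnn] at h2
      rw [abs_le] at h1 h2
      by_contra hne
      rcases Nat.lt_or_gt_of_ne hne with h | h
      · have : ((n : ℝ) + 1) * t ≤ n' * t :=
          mul_le_mul_of_nonneg_right (by exact_mod_cast h) ht.le
        linarith
      · have : ((n' : ℝ) + 1) * t ≤ n * t :=
          mul_le_mul_of_nonneg_right (by exact_mod_cast h) ht.le
        linarith
  obtain ⟨i, hi, hblock⟩ := Finset.exists_block_card_le bad m₀ ℓ Q hQ
  set m := m₀ + i * ℓ with hm
  have hmle : m + ℓ ≤ m₀ + Q * ℓ := by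
    have := Nat.mul_le_mul_right ℓ (Nat.succ_le_of_lt hi)
    rw [Nat.succ_mul] at this
    omega
  have hmm : m₀ ≤ m := by omega
  set badm := bad.filter (fun j => m₀ + i * ℓ ≤ j ∧ j < m₀ + (i + 1) * ℓ) with hbadm
  refine ⟨m, k m, Finset.Ico m (m + ℓ) \ badm, Finset.sdiff_subset, ?_, ?_, ?_, hkM m hmm (by omega),
    (hkL m hmm (by omega)).le, ?_⟩
  · have h1 : ℓ ≤ (Finset.Ico m (m + ℓ) \ badm).card + badm.card := by
      calc ℓ = (Finset.Ico m (m + ℓ)).card := by simp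
        _ ≤ _ := Finset.card_le_card_sdiff_add_card
    have h1' : (ℓ : ℝ) - (Finset.Ico m (m + ℓ) \ badm).card ≤ badm.card := by
      rw [sub_le_iff_le_add']; exact_mod_cast h1
    calc _ ≤ (Q : ℝ) * badm.card := mul_le_mul_of_nonneg_left h1' (Nat.cast_nonneg _)
      _ ≤ bad.card := hblock
      _ ≤ W.card := by exact_mod_cast hcard
  · exact hm1.trans (mul_le_mul_of_nonneg_right (by exact_mod_cast hmm) ht.le)
  · have : (m : ℝ) * t ≤ (m₀ + Q * ℓ : ℝ) * t :=
      mul_le_mul_of_nonneg_right (by exact_mod_cast (by omega : m ≤ m₀ + Q * ℓ)) ht.le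
    linarith
  · intro n hn
    rw [Finset.mem_sdiff, Finset.mem_Ico] at hn
    obtain ⟨⟨hn1, hn2⟩, hn3⟩ := hn
    have hn4 : m₀ ≤ n := by omega
    have hn5 : n < m₀ + Q * ℓ := by omega
    have hnb : ¬ (s + n * t - u (k n) < 3 * e ∨ u (k n + 1) - (s + n * t) ≤ 3 * e) := by
      intro h
      refine hn3 (Finset.mem_filter.2 ⟨Finset.mem_filter.2 ⟨Finset.mem_Ico.2 ⟨hn4, hn5⟩, h⟩, ?_⟩)
      rw [Nat.add_mul]
      omega
    push Not at hnb
    obtain ⟨hb1, hb2⟩ := hnb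
    have hnt : (m : ℝ) * t ≤ n * t := mul_le_mul_of_nonneg_right (by exact_mod_cast hn1) ht.le
    have hnt2 : (n : ℝ) * t ≤ (m + ℓ : ℝ) * t :=
      mul_le_mul_of_nonneg_right (by exact_mod_cast hn2.le) ht.le
    have hkk : k m ≤ k n := by
      have h1 := hk1 m hmm (by omega)
      have h2 := hk2 n hn4 hn5
      have := hu.lt_iff_lt.1 (show u (k m) < u (k n + 1) by linarith)
      omega
    have hdk : ((k n : ℝ) + 1 - k m) ≤ (ℓ * t + D + C) / c + 1 := by
      have h1 := hlow (k m) (k n - k m)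
      rw [Nat.add_sub_cancel' hkk, Nat.cast_sub hkk] at h1
      have h2 := hk1 n hn4 hn5
      have h3 := hk2 m hmm (by omega)
      have h4 := hup (k m)
      have : (k n : ℝ) - k m ≤ (ℓ * t + D + C) / c := by
        rw [le_div_iff₀' hc]; linarith
      linarith
    have hnear : ∀ j, k m ≤ j → (j : ℝ) ≤ k n + 1 → j ≤ M + L →
        |v j - u j - (ρ + k m * σ)| ≤ 2 * e := by
      intro j h1 h2 h3
      have h4 := hv j ((hkM m hmm (by omega)).trans h1) h3
      have h5 : |((j : ℝ) - k m) * σ| ≤ e := by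
        rw [abs_mul, abs_of_nonneg (sub_nonneg.2 (by exact_mod_cast h1)), mul_comm]
        exact (mul_le_mul_of_nonneg_left (by linarith) (abs_nonneg _)).trans hσ
      calc _ = |(v j - u j - (ρ + j * σ)) + ((j : ℝ) - k m) * σ| := by ring_nf
        _ ≤ _ := (abs_add_le _ _).trans (by linarith)
    have hL := hkL n hn4 hn5
    have e1 := hnear (k n) hkk (by linarith) hL.le
    have e2 := hnear (k n + 1) (by omega) (by push_cast; rfl) hL
    have hss2 := hss
    rw [abs_le] at e1 e2 hss2
    refine ⟨k n, hk1 n hn4 hn5, hk2 n hn4 hn5, by linarith, by linarith, abs_le.2 ⟨?_, ?_⟩⟩ <;>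
    linarith

/-! ### Ratner's property from drift windows -/

theorem birkhoffCocycle_eq_orbitSum (α β : ℝ) (f : TwoTorus → ℝ) (n : ℕ) (p : TwoTorus) :
    birkhoffCocycle (torusRotation α β) f n p = orbitSum (torusMk (α, β)) f n p :=
  birkhoffCocycle_torusRotation α β f n p

theorem birkhoffCocycle_eq_orbitSum_succ (α β : ℝ) (f : TwoTorus → ℝ) (n : ℕ) (p : TwoTorus) :
    birkhoffCocycle (torusRotation α β) f ((n : ℤ) + 1) p =
      orbitSum (torusMk (α, β)) f (n + 1) p := by
  rw [← birkhoffCocycle_eq_orbitSum, Nat.cast_add_one]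

section Flow

variable {α β : ℝ} {f : TwoTorus → ℝ}

theorem specialFlow_torusRotation_eq (hf : ∀ p, 0 < f p) (τ : ℝ) (x : SpecialFlowSpace f) (k : ℕ)
    (h1 : orbitSum (torusMk (α, β)) f k x.1.fst ≤ x.1.snd + τ)
    (h2 : x.1.snd + τ < orbitSum (torusMk (α, β)) f (k + 1) x.1.fst) :
    (specialFlow (torusRotation α β) f τ x).1.fst = x.1.fst + (k : ℤ) • torusMk (α, β) ∧
    (specialFlow (torusRotation α β) f τ x).1.snd =
      x.1.snd + τ - orbitSum (torusMk (α, β)) f k x.1.fst := by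
  have h := specialFlow_eq (torusRotation α β) hf τ x k
    ⟨by rwa [birkhoffCocycle_eq_orbitSum], by rwa [birkhoffCocycle_eq_orbitSum_succ]⟩
  rw [h]
  refine ⟨?_, ?_⟩
  · simp only [specialFlowPoint]
    exact torusRotation_zpow α β k x.1.fst
  · simp only [specialFlowPoint, birkhoffCocycle_eq_orbitSum]
    rfl

theorem dist_specialFlow_eq (hf : ∀ p, 0 < f p) (τ τ' : ℝ) (x x' : SpecialFlowSpace f) (k : ℕ)
    (h1 : orbitSum (torusMk (α, β)) f k x.1.fst ≤ x.1.snd + τ)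
    (h2 : x.1.snd + τ < orbitSum (torusMk (α, β)) f (k + 1) x.1.fst)
    (h1' : orbitSum (torusMk (α, β)) f k x'.1.fst ≤ x'.1.snd + τ')
    (h2' : x'.1.snd + τ' < orbitSum (torusMk (α, β)) f (k + 1) x'.1.fst) :
    dist (specialFlow (torusRotation α β) f τ x) (specialFlow (torusRotation α β) f τ' x') =
      dist x.1.fst x'.1.fst + |(x.1.snd + τ - orbitSum (torusMk (α, β)) f k x.1.fst) -
        (x'.1.snd + τ' - orbitSum (torusMk (α, β)) f k x'.1.fst)| := by
  obtain ⟨h3, h4⟩ := specialFlow_torusRotation_eq hf τ x k h1 h2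
  obtain ⟨h3', h4'⟩ := specialFlow_torusRotation_eq hf τ' x' k h1' h2'
  rw [SpecialFlowSpace.dist_eq, h3, h4, h3', h4', dist_add_right]

theorem specialFlow_eq_of_fst_eq (hf : ∀ p, 0 < f p) (x x' : SpecialFlowSpace f)
    (h : x.1.fst = x'.1.fst) :
    specialFlow (torusRotation α β) f (x'.1.snd - x.1.snd) x = x' := by
  have h0 : orbitSum (torusMk (α, β)) f 0 x.1.fst = 0 := by simp [orbitSum]
  have h1 : orbitSum (torusMk (α, β)) f (0 + 1) x.1.fst = f x.1.fst := by simp [orbitSum]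
  obtain ⟨h3, h4⟩ := specialFlow_torusRotation_eq (α := α) (β := β) hf (x'.1.snd - x.1.snd) x 0
    (by rw [h0]; linarith [x'.2.1]) (by rw [h1, h]; linarith [x'.2.2])
  apply Subtype.ext
  apply WithLp.ofLp_injective
  refine Prod.ext ?_ ?_
  · exact (h3.trans (by simp)).trans h
  · have h5 : (specialFlow (torusRotation α β) f (x'.1.snd - x.1.snd) x).1.snd = x'.1.snd :=
      h4.trans (by rw [h0]; ring)
    exact h5

theorem norm_coe_addCircle_le {t : ℝ} (x y : ℝ) (n : ℕ) :
    ‖((x - y : ℝ) : AddCircle t)‖ ≤ |x + n * t - y| := by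
  have : ((x - y : ℝ) : AddCircle t) = ((x + n * t - y : ℝ) : AddCircle t) := by
    rw [show x + n * t - y = x - y + n • t by rw [nsmul_eq_mul]; ring, AddCircle.coe_add,
      AddCircle.coe_nsmul, AddCircle.coe_period, smul_zero, add_zero]
  rw [this]
  exact QuotientAddGroup.norm_mk_le_norm

set_option maxHeartbeats 1000000 in
theorem hasRatnerProperty_of_window {s₁ s₂ : ℕ} {Δ₁ : Fin s₁ → UnitAddCircle}
    {Δ₂ : Fin s₂ → UnitAddCircle} (hf : ∀ p, 0 < f p) {D c C : ℝ} (hD : ∀ p, f p ≤ D) (hc : 0 < c)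
    (hC : 0 ≤ C) (hlow : ∀ (n : ℕ) (p : TwoTorus), c * n - C ≤ orbitSum (torusMk (α, β)) f n p)
    {b B κ S A : ℝ} (hκ : 0 < κ) (hS : 0 ≤ S) (hA : 0 < A)
    (hwin : ∀ e : ℝ, 0 < e → ∀ η : ℝ, 0 < η →
      ∃ δ : ℝ, 0 < δ ∧ ∀ (p : TwoTorus) (w : ℝ × ℝ), w ≠ 0 → ‖w‖ < δ → η < circleFract p.2 →
        circleFract p.2 < 1 - η → AvoidsLines α β Δ₁ Δ₂ p →
        AvoidsLines α β Δ₁ Δ₂ (p + torusMk w) →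
        ∃ (M L : ℕ) (σ ρ : ℝ), |σ| ≤ S * ‖w‖ ∧ 1 ≤ M * ‖w‖ ∧ κ ≤ L * ‖w‖ ∧
          (M + L) * ‖w‖ ≤ A ∧ ∀ k : ℕ, M ≤ k → k ≤ M + L → b ≤ |ρ + k * σ| ∧ |ρ + k * σ| ≤ B ∧
            |orbitSum (torusMk (α, β)) f k (p + torusMk w) - orbitSum (torusMk (α, β)) f k p -
              (ρ + k * σ)| ≤ e)
    {t : ℝ} (ht : D < t) (μ : Measure (SpecialFlowSpace f))
    (hZ : ∀ ε : ℝ, 0 < ε → ∀ η : ℝ, 0 < η → ∃ E₀ : ℝ, 0 < E₀ ∧ ∃ y : ℝ, 0 < y ∧ ∀ E : ℝ, 0 < E →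
      E ≤ E₀ → ∃ Z : Set (SpecialFlowSpace f), MeasurableSet Z ∧ 1 - ε < μ.real Z ∧
        ∀ x ∈ Z, AvoidsLines α β Δ₁ Δ₂ x.1.fst ∧ y < circleFract x.1.fst.2 ∧
          circleFract x.1.fst.2 < 1 - y ∧ ∀ m : ℕ, 1 ≤ m →
            (((Finset.range m).filter fun k =>
              ‖((x.1.snd - orbitSum (torusMk (α, β)) f k x.1.fst : ℝ) : AddCircle t)‖ ≤ E).card : ℝ)
                ≤ η * m) :
    HasRatnerProperty μ (specialFlow (torusRotation α β) f) t {ρ | b ≤ |ρ| ∧ |ρ| ≤ B} := by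
  intro ε hε
  have hD0 : 0 < D := (hf 0).trans_le (hD 0)
  have ht0 : 0 < t := hD0.trans ht
  set η := ε * c * κ / (4 * t * (A + 1)) with hη
  have hη0 : 0 < η := by positivity
  obtain ⟨E₀, hE₀, y, hy, hZ⟩ := hZ ε hε η hη0
  obtain ⟨e, he, he1, he2, he3⟩ : ∃ e : ℝ, 0 < e ∧ 8 * e ≤ ε ∧ 12 * e ≤ t ∧ 3 * e ≤ E₀ := by
    refine ⟨min (ε / 8) (min (t / 12) (E₀ / 3)), by positivity, ?_, ?_, ?_⟩
    · linarith [min_le_left (ε / 8) (min (t / 12) (E₀ / 3))]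
    · linarith [min_le_right (ε / 8) (min (t / 12) (E₀ / 3)), min_le_left (t / 12) (E₀ / 3)]
    · linarith [min_le_right (ε / 8) (min (t / 12) (E₀ / 3)), min_le_right (t / 12) (E₀ / 3)]
  obtain ⟨Q, hQ⟩ := exists_nat_gt (2 * S * A / e)
  have hQ0 : (0 : ℝ) < Q := lt_of_le_of_lt (by positivity) hQ
  rw [div_lt_iff₀ he] at hQ
  set r := c * κ / (2 * t * Q) with hr
  have hr0 : 0 < r := by positivity
  set R := (D + c) * A / t + 1 with hR
  have hR0 : 0 < R := by positivity
  refine ⟨r / R, by positivity, fun N => ?_⟩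
  obtain ⟨Z, hZm, hZμ, hZ⟩ := hZ (3 * e) (by positivity) he3
  obtain ⟨δ₀, hδ₀, hwin⟩ := hwin e he y hy
  obtain ⟨δ, hδ, hδ1, hδ2, hδ3, hδ4, hδ5, hδ6, hδ7⟩ : ∃ δ : ℝ, 0 < δ ∧ δ ≤ δ₀ ∧ δ ≤ 1 ∧ δ ≤ e ∧
      δ * (t * (N + 1) + C + D) ≤ c ∧ δ * ((C + t) / (t * Q) + 1) ≤ r ∧ δ * (N + 1) ≤ r ∧
      δ * (S * ((D + C) / c + 1)) ≤ e / 2 := by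
    have key : ∀ X Y : ℝ, 0 ≤ X → 0 < Y → ∀ᶠ δ in 𝓝[>] (0 : ℝ), δ * X ≤ Y := by
      intro X Y _ hY
      have : Tendsto (fun δ : ℝ => δ * X) (𝓝[>] 0) (𝓝 (0 * X)) :=
        (tendsto_nhdsWithin_of_tendsto_nhds tendsto_id).mul_const X
      rw [zero_mul] at this
      exact this.eventually (eventually_le_nhds hY)
    have h := (((((((eventually_mem_nhdsWithin (a := (0 : ℝ)) (s := Set.Ioi 0)).and
      (key 1 δ₀ zero_le_one hδ₀)).and (key 1 1 zero_le_one one_pos)).and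
      (key 1 e zero_le_one he)).and (key (t * (N + 1) + C + D) c (by positivity) hc)).and
      (key ((C + t) / (t * Q) + 1) r (by positivity) hr0)).and
      (key (N + 1) r (by positivity) hr0)).and
      (key (S * ((D + C) / c + 1)) (e / 2) (by positivity) (by positivity))
    obtain ⟨δ, ⟨⟨⟨⟨⟨⟨h1, h2⟩, h3⟩, h4⟩, h5⟩, h6⟩, h7⟩, h8⟩ := h.exists
    rw [mul_one] at h2 h3 h4
    exact ⟨δ, h1, h2, h3, h4, h5, h6, h7, h8⟩
  refine ⟨δ, hδ, Z, hZm, hZμ, fun x hx x' hx' horb hdist => ?_⟩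
  obtain ⟨w, hw, hwd⟩ := exists_torusMk_eq x.1.fst x'.1.fst
  have hdd := SpecialFlowSpace.dist_eq x x'
  have hwδ : ‖w‖ < δ := by rw [hwd]; linarith [abs_nonneg (x.1.snd - x'.1.snd)]
  have hsδ : |x.1.snd - x'.1.snd| < δ := by linarith [dist_nonneg (x := x.1.fst) (y := x'.1.fst)]
  have hw0 : w ≠ 0 := by
    rintro rfl
    refine horb _ (specialFlow_eq_of_fst_eq hf x x' ?_)
    rw [hw, torusMk_zero, add_zero]
  have hwpos : 0 < ‖w‖ := norm_pos_iff.2 hw0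
  obtain ⟨hZ1, hZ2, hZ3, hZ4⟩ := hZ x hx
  obtain ⟨M, L, σ, ρ, hσ, hM, hL, hMA, hwn⟩ := hwin x.1.fst w hw0 (hwδ.trans_le hδ1) hZ2 hZ3 hZ1
    (by rw [← hw]; exact (hZ x' hx').1)
  rw [← hw] at hwn
  set d := ‖w‖ with hd
  have hsmall : ∀ {X Y : ℝ}, 0 ≤ X → δ * X ≤ Y → X ≤ Y / d := by
    intro X Y hX h
    rw [le_div_iff₀ hwpos]
    nlinarith
  set u : ℕ → ℝ := fun k => orbitSum (torusMk (α, β)) f k x.1.fst with hu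
  set v : ℕ → ℝ := fun k => orbitSum (torusMk (α, β)) f k x'.1.fst with hv
  have hlow' : ∀ k j, c * j - C ≤ u (k + j) - u k := by
    intro k j
    simp only [hu]
    rw [orbitSum_add, add_sub_cancel_left]
    exact hlow _ _
  have hup : ∀ k, u (k + 1) ≤ u k + D := by
    intro k
    simp only [hu, orbitSum_succ]
    linarith [hD (x.1.fst + k • torusMk (α, β))]
  have humono : StrictMono u := strictMono_nat_of_lt_succ fun k => by
    simp only [hu, orbitSum_succ]
    linarith [hf (x.1.fst + k • torusMk (α, β))]
  have hu0 : u 0 = 0 := by simp [hu, orbitSum]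
  have hu1 : u 1 = f x.1.fst := by simp [hu, orbitSum]
  have huD : ∀ k : ℕ, u k ≤ k * D := by
    intro k
    induction k with
    | zero => simp [hu0]
    | succ k ih => push_cast; linarith [hup k]
  have hM1 : 1 ≤ M := by
    rcases Nat.eq_zero_or_pos M with h | h
    · rw [h] at hM; simp at hM; linarith
    · exact h
  have hM' : 1 / d ≤ M := by rwa [div_le_iff₀ hwpos]
  have hL' : κ / d ≤ L := by rwa [div_le_iff₀ hwpos]
  have hMA' : (M : ℝ) + L ≤ A / d := by rwa [le_div_iff₀ hwpos]
  set ℓ := ⌊(c * L - C - t) / (t * Q)⌋₊ with hℓ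
  have hℓr : r / d ≤ ℓ := by
    have h1 : c * κ / d ≤ c * L := by
      rw [mul_div_assoc]; exact mul_le_mul_of_nonneg_left hL' hc.le
    have h2 := hsmall (by positivity) hδ5
    have h3 := Nat.lt_floor_add_one ((c * L - C - t) / (t * Q))
    rw [← hℓ] at h3
    have h4 : c * κ / d / (t * Q) ≤ c * L / (t * Q) := by gcongr
    have h5 : c * κ / d / (t * Q) = r / d + r / d := by
      rw [hr]; field_simp; ring
    have h6 : (c * L - C - t) / (t * Q) = c * L / (t * Q) - (C + t) / (t * Q) := by ring
    linarith
  have hℓN : (N : ℝ) + 1 ≤ ℓ := (hsmall (by positivity) hδ6).trans hℓr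
  have hℓ0 : 0 < ℓ := by
    have : (0 : ℝ) < ℓ := by linarith [Nat.cast_nonneg (α := ℝ) N]
    exact_mod_cast this
  have hℓnn : 0 ≤ (c * L - C - t) / (t * Q) := by
    by_contra hcon
    push Not at hcon
    exact hℓ0.ne' (Nat.floor_of_nonpos hcon.le)
  have hℓL : t * (Q * ℓ) + t + C ≤ c * L := by
    have := Nat.floor_le hℓnn
    rw [← hℓ, le_div_iff₀ (by positivity)] at this
    linarith
  have hℓt : ℓ * t ≤ c * (A / d) / Q := by
    rw [le_div_iff₀ hQ0]
    have : c * L ≤ c * (A / d) :=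
      mul_le_mul_of_nonneg_left (by linarith [Nat.cast_nonneg (α := ℝ) M]) hc.le
    linarith
  have hσ' : |σ| * ((ℓ * t + D + C) / c + 1) ≤ e := by
    have h1 : (ℓ * t + D + C) / c + 1 ≤ A / d / Q + ((D + C) / c + 1) := by
      have : ℓ * t / c ≤ A / d / Q := by
        rw [div_le_iff₀ hc]
        calc _ ≤ _ := hℓt
          _ = _ := by ring
      have h2 : (ℓ * t + D + C) / c = ℓ * t / c + (D + C) / c := by ring
      linarith
    calc |σ| * ((ℓ * t + D + C) / c + 1) ≤ (S * d) * (A / d / Q + ((D + C) / c + 1)) :=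
          mul_le_mul hσ h1 (by positivity) (by positivity)
      _ = S * A / Q + d * (S * ((D + C) / c + 1)) := by field_simp
      _ ≤ e / 2 + e / 2 := by
        refine add_le_add ?_ ?_
        · rw [div_le_iff₀ hQ0]; linarith
        · exact (mul_le_mul_of_nonneg_right hwδ.le (by positivity)).trans hδ7
      _ = e := by ring
  set W : Finset ℕ := (Finset.range (M + L + 1)).filter fun k =>
    ‖((x.1.snd - u k : ℝ) : AddCircle t)‖ ≤ 3 * e with hW
  have hWcard : (W.card : ℝ) ≤ η * ((A + 1) / d) := by
    refine (hZ4 (M + L + 1) (by omega)).trans (mul_le_mul_of_nonneg_left ?_ hη0.le)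
    push_cast
    rw [add_div]
    have := hsmall zero_le_one (show δ * 1 ≤ 1 by linarith)
    linarith
  obtain ⟨m, k₀, G, hGsub, hGcard, hm1, hm2, hk1, hk2, hG⟩ :=
    exists_good_block (u := u) (v := v) (s := x.1.snd) (s' := x'.1.snd) (t := t) (e := e)
      (ρ := ρ) (σ := σ) (M := M) (L := L) (Q := Q) (ℓ := ℓ) (D := D) hc he (by linarith)
      (by exact_mod_cast hQ0) hℓ0 humono hlow' hup
      ((x.2.2.le.trans_eq hu1.symm).trans (humono.monotone hM1)) (hsδ.le.trans hδ3)
      (fun k h1 h2 => (hwn k h1 h2).2.2) hℓL hσ' W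
      (fun k hk n hn => Finset.mem_filter.2
        ⟨Finset.mem_range.2 (by omega), (norm_coe_addCircle_le _ _ n).trans hn⟩)
  have hmN : (N : ℝ) + 1 ≤ m := by
    have h1 := hlow' 0 M
    rw [zero_add, hu0, sub_zero] at h1
    have h2 := x.2.2.le.trans (hD x.1.fst)
    have h3 := hsmall (by positivity) hδ4
    have h4 : c / d ≤ c * M := by
      rw [div_eq_mul_one_div]; exact mul_le_mul_of_nonneg_left hM' hc.le
    refine le_of_mul_le_mul_right ?_ ht0
    linarith
  have hmR : (m : ℝ) ≤ R / d := by
    have h1 := huD M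
    have h2 := x.2.1
    have h3 : m * t ≤ (D + c) * (A / d) := by
      have : (D + c) * ((M : ℝ) + L) ≤ (D + c) * (A / d) :=
        mul_le_mul_of_nonneg_left hMA' (by positivity)
      have h4 : 0 ≤ c * (M : ℝ) := by positivity
      have h5 : 0 ≤ D * (L : ℝ) := by positivity
      linarith
    have h4 : (m : ℝ) ≤ (D + c) * A / t / d := by
      rw [← le_div_iff₀ ht0] at h3
      calc _ ≤ _ := h3
        _ = _ := by ring
    rw [hR, add_div]
    have : 0 ≤ 1 / d := by positivity
    linarith
  have hmpos : (0 : ℝ) < m := by linarith [Nat.cast_nonneg (α := ℝ) N]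
  refine ⟨m, ℓ, ?_, ?_, ?_, ρ + k₀ * σ, ⟨(hwn k₀ hk1 hk2).1, (hwn k₀ hk1 hk2).2.1⟩, ?_⟩
  · have : (N : ℝ) ≤ m := by linarith
    exact_mod_cast this
  · have : (N : ℝ) ≤ ℓ := by linarith
    exact_mod_cast this
  · rw [div_le_div_iff₀ hR0 hmpos]
    calc r * m ≤ r * (R / d) := mul_le_mul_of_nonneg_left hmR hr0.le
      _ = (r / d) * R := by ring
      _ ≤ ℓ * R := mul_le_mul_of_nonneg_right hℓr hR0.le
  · have hℓpos : (0 : ℝ) < ℓ := by exact_mod_cast hℓ0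
    rw [lt_div_iff₀ hℓpos]
    have hGc : (1 - ε) * ℓ < G.card := by
      have h1 : (Q : ℝ) * (ℓ - G.card) < Q * (ε * ℓ) := by
        calc _ ≤ η * ((A + 1) / d) := hGcard.trans hWcard
          _ = Q * (ε * (r / d)) / 2 := by rw [hη, hr]; field_simp; norm_num
          _ < Q * (ε * (r / d)) := half_lt_self (by positivity)
          _ ≤ Q * (ε * ℓ) := by gcongr
      have := lt_of_mul_lt_mul_left h1 hQ0.le
      linarith
    refine hGc.trans_le ?_
    rw [← Set.ncard_coe_finset, ← Set.ncard_image_of_injective _ (Nat.cast_injective (R := ℤ))]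
    have hfin : Set.Finite {n : ℤ | (m : ℤ) ≤ n ∧ n ≤ (m : ℤ) + (ℓ : ℤ) ∧
        dist (specialFlow (torusRotation α β) f ((n : ℝ) * t) x)
          (specialFlow (torusRotation α β) f ((n : ℝ) * t + (ρ + k₀ * σ)) x') < ε} :=
      (Set.finite_Icc (m : ℤ) (m + ℓ)).subset fun n hn => ⟨hn.1, hn.2.1⟩
    refine Nat.cast_le.2 (Set.ncard_le_ncard ?_ hfin)
    rintro _ ⟨n, hn, rfl⟩
    have hn1 := Finset.mem_Ico.1 (hGsub hn)
    obtain ⟨k, g1, g2, g3, g4, g5⟩ := hG n hn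
    refine ⟨by exact_mod_cast hn1.1, by exact_mod_cast hn1.2.le, ?_⟩
    rw [Int.cast_natCast, dist_specialFlow_eq hf _ _ x x' k g1 g2 g3 g4, ← hwd]
    calc d + |_| ≤ d + 3 * e := by gcongr
      _ < ε := by linarith

end Flow

/-! ### Measurability, boundedness and growth of the roof function -/

theorem volume_addCircle_singleton {t : ℝ} [Fact (0 < t)] (x : AddCircle t) :
    (volume : Measure (AddCircle t)) {x} = 0 := by
  have := AddCircle.volume_closedBall t (x := x) 0
  simpa [(Fact.out : 0 < t).le] using this

instance isProbabilityMeasure_volume_unitAddCircle :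
    IsProbabilityMeasure (volume : Measure UnitAddCircle) :=
  ⟨UnitAddCircle.measure_univ⟩

theorem exists_notMem_of_finite {s : Set UnitAddCircle} (hs : s.Finite) : ∃ x, x ∉ s := by
  by_contra hcon
  push Not at hcon
  have h1 : (volume : Measure UnitAddCircle) s = 0 := by
    rw [← Set.biUnion_of_singleton s]
    exact (measure_biUnion_null_iff hs.countable).2 fun x _ => volume_addCircle_singleton x
  rw [Set.eq_univ_of_forall hcon, measure_univ] at h1
  exact one_ne_zero h1

theorem measurable_circleFract : Measurable circleFract :=
  measurable_subtype_coe.comp (AddCircle.measurableEquivIco (1 : ℝ) 0).measurable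

theorem continuousAt_circleFract {x : UnitAddCircle} (hx : x ≠ 0) : ContinuousAt circleFract x :=
  continuousAt_subtype_val.comp (AddCircle.continuousAt_equivIco (1 : ℝ) 0 (by simpa using hx))

theorem measurable_heisenbergFun (α β : ℝ) : Measurable (heisenbergFun α β) := by
  have := measurable_circleFract
  unfold heisenbergFun
  fun_prop

theorem continuousAt_heisenbergFun {α β : ℝ} {p : TwoTorus} (h1 : p.1 ≠ 0) (h2 : p.2 ≠ 0)
    (h3 : p.2 + (β : UnitAddCircle) ≠ 0) : ContinuousAt (heisenbergFun α β) p := by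
  have h : heisenbergFun α β = fun p => α * circleFract p.2 - (circleFract p.1 + α) *
      (circleFract p.2 + β - circleFract (p.2 + (β : UnitAddCircle))) := by
    funext q
    have := circleFract_add q.2 β
    simp only [heisenbergFun]
    rw [this, carry]
    ring
  rw [h]
  have c1 : ContinuousAt (fun q : TwoTorus => circleFract q.1) p :=
    (continuousAt_circleFract h1).comp continuousAt_fst
  have c2 : ContinuousAt (fun q : TwoTorus => circleFract q.2) p :=
    (continuousAt_circleFract h2).comp continuousAt_snd
  have c3 : ContinuousAt (fun q : TwoTorus => circleFract (q.2 + (β : UnitAddCircle))) p :=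
    ContinuousAt.comp (f := fun q : TwoTorus => q.2 + (β : UnitAddCircle))
      (continuousAt_circleFract h3) (by fun_prop)
  fun_prop

theorem heisenbergFun_abs_le {α β : ℝ} (hα : α ∈ Set.Ico (0 : ℝ) 1) (hβ : β ∈ Set.Ico (0 : ℝ) 1)
    (p : TwoTorus) : |heisenbergFun α β p| ≤ 3 := by
  have h1 : |(⌊circleFract p.2 + β⌋ : ℝ)| ≤ 1 := by
    exact_mod_cast abs_carry_le_one_of_mem (a := p.2) hβ
  have h2 := circleFract_nonneg p.1
  have h3 := circleFract_lt_one p.1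
  have h4 := circleFract_nonneg p.2
  have h5 := circleFract_lt_one p.2
  have h6 : |α * circleFract p.2| ≤ 1 := by
    rw [abs_of_nonneg (mul_nonneg hα.1 h4)]
    nlinarith [hα.1, hα.2]
  have h7 : |(circleFract p.1 + α) * (⌊circleFract p.2 + β⌋ : ℝ)| ≤ 2 := by
    rw [abs_mul, abs_of_nonneg (add_nonneg h2 hα.1)]
    nlinarith [hα.1, hα.2, abs_nonneg (⌊circleFract p.2 + β⌋ : ℝ)]
  exact (abs_sub _ _).trans (by linarith)

section Jumps

variable {s : ℕ} {f F : UnitAddCircle → ℝ} {Δ : Fin s → UnitAddCircle} {d : Fin s → ℝ}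

theorem measurable_of_jumps (hF : Continuous F)
    (h : ∀ x, x ∉ Set.range Δ → f x = ∑ j, d j * circleFract (x - Δ j) + F x) : Measurable f := by
  have hm : Measurable fun x => ∑ j, d j * circleFract (x - Δ j) + F x :=
    (Finset.measurable_fun_sum _ fun j _ =>
      (measurable_circleFract.comp (measurable_sub_const (Δ j))).const_mul (d j)).add hF.measurable
  refine hm.measurable_of_countable_ne ((Set.finite_range Δ).countable.mono fun x hx => ?_)
  by_contra hcon
  exact hx (h x hcon).symm

theorem bddAbove_of_jumps (hF : Continuous F)
    (h : ∀ x, x ∉ Set.range Δ → f x = ∑ j, d j * circleFract (x - Δ j) + F x) :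
    ∃ D, ∀ x, f x ≤ D := by
  obtain ⟨D₁, hD₁⟩ := isCompact_univ.bddAbove_image hF.continuousOn
  obtain ⟨D₂, hD₂⟩ := ((Set.finite_range Δ).image f).bddAbove
  refine ⟨max (∑ j, |d j| + D₁) D₂, fun x => ?_⟩
  by_cases hx : x ∈ Set.range Δ
  · exact (hD₂ (Set.mem_image_of_mem f hx)).trans (le_max_right _ _)
  · rw [h x hx]
    refine le_trans (add_le_add (Finset.sum_le_sum fun j _ => ?_)
      (hD₁ (Set.mem_image_of_mem F (Set.mem_univ x)))) (le_max_left _ _)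
    calc d j * circleFract (x - Δ j) ≤ |d j * circleFract (x - Δ j)| := le_abs_self _
      _ = |d j| * circleFract (x - Δ j) := by rw [abs_mul, abs_of_nonneg (circleFract_nonneg _)]
      _ ≤ |d j| := mul_le_of_le_one_right (abs_nonneg _) (circleFract_lt_one _).le

end Jumps

theorem exists_ball_le_of_continuousAt {X : Type*} [PseudoMetricSpace X] {f : X → ℝ} {q : X}
    (hf : ContinuousAt f q) (hq : 0 < f q) :
    ∃ b r : ℝ, 0 < b ∧ 0 < r ∧ ∀ p, dist p q < r → b ≤ f p := by
  obtain ⟨r, hr, h⟩ := Metric.eventually_nhds_iff.1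
    (hf.eventually (lt_mem_nhds (half_lt_self hq)))
  exact ⟨f q / 2, r, half_pos hq, hr, fun p hp => (h hp).le⟩

/-! ### Large sets of good points of a special flow -/

section Embedding

variable {f : TwoTorus → ℝ}

theorem measurableEmbedding_specialFlowSpace (hf : Measurable f) :
    MeasurableEmbedding (fun x : SpecialFlowSpace f => (x.1.fst, x.1.snd)) := by
  have h1 : MeasurableSet {x : WithLp 1 (TwoTorus × ℝ) | 0 ≤ x.snd ∧ x.snd < f x.fst} := by
    have : Measurable fun x : WithLp 1 (TwoTorus × ℝ) => (x.fst, x.snd) :=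
      (MeasurableEquiv.toLp 1 (TwoTorus × ℝ)).symm.measurable
    have hfst := this.fst
    have hsnd := this.snd
    exact (measurableSet_le measurable_const hsnd).inter
      (measurableSet_lt hsnd (hf.comp hfst))
  exact (MeasurableEquiv.toLp 1 (TwoTorus × ℝ)).symm.measurableEmbedding.comp
    (MeasurableEmbedding.subtype_coe h1)

theorem measurable_specialFlowSpace_coe (hf : Measurable f) (t : ℝ) :
    Measurable fun x : SpecialFlowSpace f => (x.1.fst, (x.1.snd : AddCircle t)) := by
  have h := (measurableEmbedding_specialFlowSpace hf).measurable
  exact h.fst.prodMk (AddCircle.measurable_mk'.comp h.snd)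

theorem comap_le_of_forall_mem (hf : Measurable f) {t : ℝ} [Fact (0 < t)] (hft : ∀ p, f p ≤ t)
    {S : Set (SpecialFlowSpace f)} {V : Set (TwoTorus × AddCircle t)} (hV : MeasurableSet V)
    (h : ∀ x ∈ S, (x.1.fst, (x.1.snd : AddCircle t)) ∈ V) :
    Measure.comap (fun x : SpecialFlowSpace f => (x.1.fst, x.1.snd))
      ((volume : Measure TwoTorus).prod volume) S ≤
      ((volume : Measure TwoTorus).prod volume) V := by
  rw [(measurableEmbedding_specialFlowSpace hf).comap_apply]
  have hmk : MeasurePreserving (QuotientAddGroup.mk : ℝ → AddCircle t)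
      (volume.restrict (Set.Ico 0 t)) volume := by
    have := AddCircle.measurePreserving_mk t 0
    rwa [zero_add, ← restrict_Ico_eq_restrict_Ioc] at this
  have hp := (MeasurePreserving.id (volume : Measure TwoTorus)).prod hmk
  rw [← hp.measure_preimage hV.nullMeasurableSet]
  have hr : (volume : Measure TwoTorus).prod ((volume : Measure ℝ).restrict (Set.Ico 0 t)) =
      ((volume : Measure TwoTorus).prod volume).restrict (Set.univ ×ˢ Set.Ico 0 t) := by
    rw [← Measure.prod_restrict, Measure.restrict_univ]
  rw [hr, Measure.restrict_apply (hp.measurable hV)]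
  refine measure_mono ?_
  rintro _ ⟨x, hx, rfl⟩
  exact ⟨h x hx, Set.mem_univ _, x.2.1, x.2.2.trans_le (hft _)⟩

theorem comap_univ_ne_zero (hf : Measurable f) (hpos : ∀ p, 0 < f p) :
    Measure.comap (fun x : SpecialFlowSpace f => (x.1.fst, x.1.snd))
      ((volume : Measure TwoTorus).prod volume) Set.univ ≠ 0 := by
  have hE := measurableEmbedding_specialFlowSpace hf
  rw [hE.comap_apply]
  intro h
  rw [Measure.measure_prod_null (hE.measurableSet_image.2 MeasurableSet.univ)] at h
  have h2 : ∀ᵐ p ∂(volume : Measure TwoTorus), False := by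
    filter_upwards [h] with p hp
    have hsub : Set.Ico 0 (f p) ⊆ Prod.mk p ⁻¹'
        ((fun x : SpecialFlowSpace f => (x.1.fst, x.1.snd)) '' Set.univ) := fun s hs =>
      ⟨⟨WithLp.toLp 1 (p, s), hs.1, hs.2⟩, Set.mem_univ _, rfl⟩
    have := (measure_mono hsub).trans_eq hp
    simp only [Real.volume_Ico, sub_zero, Pi.zero_apply, nonpos_iff_eq_zero,
      ENNReal.ofReal_eq_zero] at this
    exact this.not_gt (hpos p)
  exact (NeZero.ne (volume : Measure TwoTorus)) (by simpa using h2)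

end Embedding

/-- The skew product `(p, θ) ↦ (p + ω, θ - f p)`. -/
def skewRotation {t : ℝ} (ω : TwoTorus) (f : TwoTorus → ℝ) (z : TwoTorus × AddCircle t) :
    TwoTorus × AddCircle t :=
  (z.1 + ω, z.2 - (f z.1 : AddCircle t))

theorem measurePreserving_skewRotation {t : ℝ} [Fact (0 < t)] (ω : TwoTorus) {f : TwoTorus → ℝ}
    (hf : Measurable f) : MeasurePreserving (skewRotation (t := t) ω f)
      ((volume : Measure TwoTorus).prod volume) ((volume : Measure TwoTorus).prod volume) := by
  refine MeasurePreserving.skew_product (g := fun p θ => θ - (f p : AddCircle t))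
    ((measurePreserving_add_right volume ω.1).prod (measurePreserving_add_right volume ω.2)) ?_ (Eventually.of_forall fun p => ?_)
  · exact measurable_snd.sub (AddCircle.measurable_mk'.comp (hf.comp measurable_fst))
  · exact (measurePreserving_sub_right volume (f p : AddCircle t)).map_eq

theorem skewRotation_iterate {t : ℝ} (ω : TwoTorus) (f : TwoTorus → ℝ) (k : ℕ) (p : TwoTorus)
    (s : ℝ) : (skewRotation (t := t) ω f)^[k] (p, (s : AddCircle t)) =
      (p + k • ω, ((s - orbitSum ω f k p : ℝ) : AddCircle t)) := by
  induction k with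
  | zero => simp [orbitSum]
  | succ k ih =>
    rw [Function.iterate_succ_apply', ih, skewRotation, orbitSum_succ]
    refine Prod.ext ?_ ?_
    · simp only [succ_nsmul, add_assoc]
    · simp only [← AddCircle.coe_sub, sub_sub]

section Avoid

variable {α β : ℝ} {s₁ s₂ : ℕ} {Δ₁ : Fin s₁ → UnitAddCircle} {Δ₂ : Fin s₂ → UnitAddCircle}

theorem measurableSet_avoidsLines : MeasurableSet {p | AvoidsLines α β Δ₁ Δ₂ p} := by
  unfold AvoidsLines
  refine measurableSet_setOfPred.2 ?_
  refine Measurable.forall fun k => (Measurable.forall fun j => ?_).and (Measurable.forall fun j => ?_)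
  · exact measurableSet_setOfPred.1 (measurableSet_eq_fun (by fun_prop) measurable_const).compl
  · exact measurableSet_setOfPred.1 (measurableSet_eq_fun (by fun_prop) measurable_const).compl

theorem ae_avoidsLines : ∀ᵐ p ∂(volume : Measure TwoTorus), AvoidsLines α β Δ₁ Δ₂ p := by
  have h : ∀ a b : UnitAddCircle, ∀ᵐ x ∂(volume : Measure UnitAddCircle), x + a ≠ b := fun a b => by
    refine measure_mono_null (fun x hx => ?_) (volume_addCircle_singleton (b - a))
    exact eq_sub_of_add_eq (not_not.1 hx)
  refine ae_all_iff.2 fun k => Filter.Eventually.and (ae_all_iff.2 fun j => ?_)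
    (ae_all_iff.2 fun j => ?_)
  · exact Measure.quasiMeasurePreserving_fst.ae (h _ (Δ₁ j))
  · exact Measure.quasiMeasurePreserving_snd.ae (h _ (Δ₂ j))

theorem exists_large_good_set {f : TwoTorus → ℝ} (hf : Measurable f) (hpos : ∀ p, 0 < f p) {t : ℝ}
    (hft : ∀ p, f p ≤ t) {ε η : ℝ} (hε : 0 < ε) (hη : 0 < η) : ∃ E₀ : ℝ, 0 < E₀ ∧ ∃ y : ℝ, 0 < y ∧
      ∀ E : ℝ, 0 < E → E ≤ E₀ → ∃ Z : Set (SpecialFlowSpace f), MeasurableSet Z ∧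
        1 - ε < (specialFlowMeasure (volume : Measure TwoTorus) f).real Z ∧
        ∀ x ∈ Z, AvoidsLines α β Δ₁ Δ₂ x.1.fst ∧ y < circleFract x.1.fst.2 ∧
          circleFract x.1.fst.2 < 1 - y ∧ ∀ m : ℕ, 1 ≤ m →
            (((Finset.range m).filter fun k =>
              ‖((x.1.snd - orbitSum (torusMk (α, β)) f k x.1.fst : ℝ) : AddCircle t)‖ ≤ E).card : ℝ)
                ≤ η * m := by
  have ht : 0 < t := (hpos 0).trans_le (hft 0)
  have : Fact (0 < t) := ⟨ht⟩
  set ν : Measure (SpecialFlowSpace f) :=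
    Measure.comap (fun x : SpecialFlowSpace f => (x.1.fst, x.1.snd))
      ((volume : Measure TwoTorus).prod volume) with hν
  set ν' : Measure (TwoTorus × AddCircle t) := (volume : Measure TwoTorus).prod volume with hν'
  have hle : ∀ {S : Set (SpecialFlowSpace f)} {V : Set (TwoTorus × AddCircle t)}, MeasurableSet V →
      (∀ x ∈ S, (x.1.fst, (x.1.snd : AddCircle t)) ∈ V) → ν S ≤ ν' V := fun hV h =>
    comap_le_of_forall_mem hf hft hV h
  have : IsFiniteMeasure ν := ⟨(hle MeasurableSet.univ fun _ _ => Set.mem_univ _).trans_lt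
    (measure_lt_top _ _)⟩
  have : NeZero ν := ⟨fun h => comap_univ_ne_zero hf hpos (by
    rw [← hν, h]; rfl)⟩
  have hμ : specialFlowMeasure (volume : Measure TwoTorus) f = (ν Set.univ)⁻¹ • ν := rfl
  have : IsProbabilityMeasure (specialFlowMeasure (volume : Measure TwoTorus) f) := by
    rw [hμ]; infer_instance
  set V := ν.real Set.univ with hV
  have hV0 : 0 < V := by
    rw [hV, measureReal_def]
    exact ENNReal.toReal_pos (comap_univ_ne_zero hf hpos) (measure_ne_top _ _)
  refine ⟨ε * η * V / 8, by positivity, ε * V / (8 * t), by positivity, fun E hE hE₀ => ?_⟩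
  set y := ε * V / (8 * t) with hy
  have hy0 : 0 < y := by positivity
  set Ψ := skewRotation (t := t) (torusMk (α, β)) f with hΨ
  have hΨm : MeasurePreserving Ψ ν' ν' := measurePreserving_skewRotation _ hf
  set B : Set (TwoTorus × AddCircle t) := Set.univ ×ˢ Metric.closedBall 0 E with hB
  have hBm : MeasurableSet B := MeasurableSet.univ.prod measurableSet_closedBall
  have hBν : ν'.real B ≤ 2 * E := by
    rw [hν', hB, measureReal_prod_prod, probReal_univ, one_mul, measureReal_def,
      AddCircle.volume_closedBall, ENNReal.toReal_ofReal (by positivity)]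
    exact min_le_right _ _
  set U : Set (TwoTorus × AddCircle t) := Metric.closedBall (0 : UnitAddCircle) y |>.preimage
    (fun z : TwoTorus × AddCircle t => z.1.2) with hU
  have hUm : MeasurableSet U := measurableSet_closedBall.preimage (by fun_prop)
  have hUν : ν'.real U ≤ 2 * y * t := by
    have : U = (Set.univ ×ˢ Metric.closedBall (0 : UnitAddCircle) y) ×ˢ Set.univ := by
      ext z; simp [hU]
    rw [this, hν', measureReal_prod_prod, Measure.volume_eq_prod, measureReal_prod_prod,
      probReal_univ, one_mul, measureReal_def, measureReal_def, AddCircle.volume_closedBall,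
      ENNReal.toReal_ofReal (by positivity), AddCircle.measure_univ, ENNReal.toReal_ofReal ht.le]
    exact mul_le_mul_of_nonneg_right (min_le_right _ _) ht.le
  set N : Set (TwoTorus × AddCircle t) := {z | AvoidsLines α β Δ₁ Δ₂ z.1}ᶜ with hN
  have hNm : MeasurableSet N := (measurableSet_avoidsLines.preimage measurable_fst).compl
  have hNν : ν'.real N = 0 := by
    rw [measureReal_def, show ν' N = 0 from
      Measure.quasiMeasurePreserving_fst.ae ae_avoidsLines, ENNReal.toReal_zero]
  set F := frequentVisits Ψ B η with hF
  have hFm : MeasurableSet F := measurableSet_frequentVisits hΨm.measurable hBm η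
  have hFν : ν'.real F ≤ 2 * E / η :=
    (measure_frequentVisits_le hΨm hBm hη).trans (by gcongr)
  set W := N ∪ (U ∪ F) with hW
  have hWm : MeasurableSet W := hNm.union (hUm.union hFm)
  have hWν : ν'.real W ≤ ε * V / 2 := by
    have h1 := measureReal_union_le (μ := ν') N (U ∪ F)
    have h2 := measureReal_union_le (μ := ν') U F
    have h3 : 2 * y * t = ε * V / 4 := by rw [hy]; field_simp; norm_num
    have h4 : 2 * E / η ≤ ε * V / 4 := by
      rw [div_le_iff₀ hη]; linarith
    linarith
  set Z : Set (SpecialFlowSpace f) := {x | (x.1.fst, (x.1.snd : AddCircle t)) ∈ W}ᶜ with hZ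
  have hZm : MeasurableSet Z := ((measurable_specialFlowSpace_coe hf t) hWm).compl
  refine ⟨Z, hZm, ?_, fun x hx => ?_⟩
  · have h1 : (specialFlowMeasure (volume : Measure TwoTorus) f).real Zᶜ < ε := by
      have h2 : ν.real Zᶜ ≤ ν'.real W :=
        ENNReal.toReal_mono (measure_ne_top _ _) (hle hWm fun x hx => not_not.1 hx)
      rw [hμ, measureReal_ennreal_smul_apply, ENNReal.toReal_inv, ← measureReal_def,
        inv_mul_lt_iff₀ hV0]
      have : 0 < ε * V := by positivity
      linarith
    rw [probReal_compl_eq_one_sub hZm] at h1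
    linarith
  · have h1 : (x.1.fst, (x.1.snd : AddCircle t)) ∉ W := hx
    simp only [hW, Set.mem_union, not_or] at h1
    obtain ⟨h2, h3, h4⟩ := h1
    have h3' : y < ‖x.1.fst.2‖ := by
      by_contra hcon
      exact h3 (by simpa [hU] using hcon)
    refine ⟨not_not.1 h2, ?_, ?_, fun m hm => ?_⟩
    · have := norm_coe_le_abs (circleFract x.1.fst.2)
      rw [coe_circleFract, abs_of_nonneg (circleFract_nonneg _)] at this
      linarith
    · have := norm_coe_le_abs_sub (circleFract x.1.fst.2) 1
      rw [coe_circleFract, Int.cast_one, abs_sub_comm,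
        abs_of_nonneg (by linarith [circleFract_lt_one x.1.fst.2])] at this
      linarith
    · have h5 : visits Ψ B m (x.1.fst, (x.1.snd : AddCircle t)) ≤ η * m := by
        by_contra hcon
        exact h4 ⟨m, hm, not_le.1 hcon⟩
      refine le_trans (le_of_eq ?_) h5
      classical
      rw [visits, Finset.card_filter, Nat.cast_sum]
      refine Finset.sum_congr rfl fun k _ => ?_
      rw [hΨ, skewRotation_iterate, Set.indicator_apply]
      simp only [hB, Set.mem_prod, Set.mem_univ, mem_closedBall_zero_iff, true_and, Pi.one_apply]
      split_ifs <;> simp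

end Avoid

/-! ### Special flows over badly approximable rotations -/

theorem orbitSum_regular_sub_small {c α β : ℝ} (hc : 0 < c) (hα : BadlyApproximable c α)
    (hβ : BadlyApproximable c β) (hmin : UniformlyMinimal (torusMk (α, β)))
    {F₁ F₂ : UnitAddCircle → ℝ} {C₁ C₂ : ℝ} {B₁ B₂ : Finset UnitAddCircle} (hC₁ : 0 ≤ C₁)
    (hC₂ : 0 ≤ C₂) (hlip₁ : ∀ (x : UnitAddCircle) (u : ℝ), |F₁ (x + u) - F₁ x| ≤ C₁ * |u|)
    (hlip₂ : ∀ (x : UnitAddCircle) (u : ℝ), |F₂ (x + u) - F₂ x| ≤ C₂ * |u|)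
    (hsec₁ : ∀ (x : UnitAddCircle) (u z : ℝ), (∀ b ∈ B₁, |u| + |z| < ‖x - b‖) →
        |F₁ (x + u + z) - F₁ (x + u) - F₁ (x + z) + F₁ x| ≤ C₁ * (|u| * |z|))
    (hsec₂ : ∀ (x : UnitAddCircle) (u z : ℝ), (∀ b ∈ B₂, |u| + |z| < ‖x - b‖) →
        |F₂ (x + u + z) - F₂ (x + u) - F₂ (x + z) + F₂ x| ≤ C₂ * (|u| * |z|))
    {g : TwoTorus → ℝ} (hg : IsTorusContDiff 2 g) {A e : ℝ} (hA : 0 < A) (he : 0 < e) :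
    ∃ δ : ℝ, 0 < δ ∧ ∀ (p : TwoTorus) (w : ℝ × ℝ) (n : ℕ), ‖w‖ < δ → n * ‖w‖ ≤ A →
      |orbitSum (torusMk (α, β)) (fun p => F₁ p.1 + F₂ p.2 + g p) n (p + torusMk w) -
        orbitSum (torusMk (α, β)) (fun p => F₁ p.1 + F₂ p.2 + g p) n p| ≤ e := by
  obtain ⟨Cg, hCg, hglip, hgsec⟩ := hg.bounds
  obtain ⟨K₁, hK₁, h₁⟩ := abs_secondDiff_orbitSum_le hc hα hC₁ hlip₁ hsec₁
  obtain ⟨K₂, hK₂, h₂⟩ := abs_secondDiff_orbitSum_le hc hβ hC₂ hlip₂ hsec₂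
  have hcont : Continuous fun p : TwoTorus => F₁ p.1 + F₂ p.2 + g p := by
    refine continuous_of_torus_lipschitz (C := C₁ + C₂ + Cg) fun p w hw => ?_
    have e1 := (hlip₁ p.1 w.1).trans (mul_le_mul_of_nonneg_left (norm_fst_le w) hC₁)
    have e2 := (hlip₂ p.2 w.2).trans (mul_le_mul_of_nonneg_left (norm_snd_le w) hC₂)
    have e3 := hglip p w hw
    simp only [torusMk, Prod.fst_add, Prod.snd_add] at e3 ⊢
    calc _ = |(F₁ (p.1 + w.1) - F₁ p.1) + (F₂ (p.2 + w.2) - F₂ p.2) +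
          (g (p + ((w.1 : UnitAddCircle), (w.2 : UnitAddCircle))) - g p)| := by ring_nf
      _ ≤ _ := (abs_add_three _ _ _).trans (by linarith)
  refine orbitSum_sub_small (fun η hη => hmin.osc_le hcont hη) (C := K₁ + K₂ + Cg) (by positivity)
    (fun n p w z hw hz => ?_) hA he
  have hw1 : |w.1| ≤ ‖w‖ := norm_fst_le w
  have hw2 : |w.2| ≤ ‖w‖ := norm_snd_le w
  have hz1 : |z.1| ≤ ‖z‖ := norm_fst_le z
  have hz2 : |z.2| ≤ ‖z‖ := norm_snd_le z
  have e1 : |secondDiff (orbitSum (α : UnitAddCircle) F₁ n) p.1 w.1 z.1| ≤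
      K₁ * ‖w‖ * (n * (‖w‖ + ‖z‖) + 1) := (h₁ n p.1 w.1 z.1).trans (by gcongr)
  have e2 : |secondDiff (orbitSum (β : UnitAddCircle) F₂ n) p.2 w.2 z.2| ≤
      K₂ * ‖w‖ * (n * (‖w‖ + ‖z‖) + 1) := (h₂ n p.2 w.2 z.2).trans (by gcongr)
  have e3 : |secondDiff (orbitSum (torusMk (α, β)) g n) p (torusMk w) (torusMk z)| ≤
      Cg * ‖w‖ * (n * (‖w‖ + ‖z‖) + 1) := by
    rw [secondDiff_orbitSum]
    refine (Finset.abs_sum_le_sum_abs _ _).trans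
      ((Finset.sum_le_card_nsmul _ _ _ fun k _ => hgsec _ w z hw hz).trans ?_)
    rw [Finset.card_range, nsmul_eq_mul]
    have h4 : 0 ≤ Cg * ‖w‖ * (n * ‖w‖ + 1) := by positivity
    linarith
  have hsplit : secondDiff (orbitSum (torusMk (α, β)) (fun p => F₁ p.1 + F₂ p.2 + g p) n) p
      (torusMk w) (torusMk z) =
      secondDiff (orbitSum (α : UnitAddCircle) F₁ n) p.1 w.1 z.1 +
      secondDiff (orbitSum (β : UnitAddCircle) F₂ n) p.2 w.2 z.2 +
      secondDiff (orbitSum (torusMk (α, β)) g n) p (torusMk w) (torusMk z) := by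
    simp only [secondDiff_orbitSum, ← Finset.sum_add_distrib]
    refine Finset.sum_congr rfl fun k _ => ?_
    simp only [secondDiff, torusMk, Prod.fst_add, Prod.snd_add, Prod.smul_fst, Prod.smul_snd]
    ring
  rw [hsplit]
  exact (abs_add_three _ _ _).trans (by linarith)

theorem continuous_of_circle_lipschitz {F : UnitAddCircle → ℝ} {C : ℝ}
    (h : ∀ (x : UnitAddCircle) (u : ℝ), |F (x + u) - F x| ≤ C * |u|) (hC : 0 ≤ C) :
    Continuous F := by
  have h1 : Continuous fun p : TwoTorus => F p.1 :=
    continuous_of_torus_lipschitz (C := C) fun p w _ =>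
      (h p.1 w.1).trans (mul_le_mul_of_nonneg_left (norm_fst_le w) hC)
  exact h1.comp (f := fun x : UnitAddCircle => ((x, 0) : TwoTorus)) (by fun_prop)

theorem HasDiscontinuities.pos {F : UnitAddCircle → ℝ} {s : ℕ} {Δ : Fin s → UnitAddCircle}
    {d : Fin s → ℝ} (h : HasDiscontinuities F Δ d) (hF : ¬ Continuous F) : 0 < s := by
  by_contra hs
  obtain rfl : s = 0 := by omega
  refine hF (continuous_iff_continuousAt.2 fun x => ?_)
  by_contra hx
  obtain ⟨j, -⟩ := (h.2.1 x).1 hx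
  exact j.elim0

theorem BadlyApproximable.mono {c c' α : ℝ} (h : BadlyApproximable c α) (hc : c' ≤ c) :
    BadlyApproximable c' α := fun k hk => hc.trans (h k hk)

theorem exists_continuousAt_roof {α β γ : ℝ} {f₁ f₂ : UnitAddCircle → ℝ} {f g : TwoTorus → ℝ}
    (hf : ∀ p : TwoTorus, f p = f₁ p.1 + f₂ p.2 + g p + γ * heisenbergFun α β p)
    (hg : Continuous g) {s₁ s₂ : ℕ} {Δ₁ : Fin s₁ → UnitAddCircle} {Δ₂ : Fin s₂ → UnitAddCircle}
    {d₁ : Fin s₁ → ℝ} {d₂ : Fin s₂ → ℝ} (hd₁ : HasDiscontinuities f₁ Δ₁ d₁)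
    (hd₂ : HasDiscontinuities f₂ Δ₂ d₂) : ∃ p, ContinuousAt f p := by
  obtain ⟨x, hx⟩ := exists_notMem_of_finite ((Set.finite_range Δ₁).insert 0)
  obtain ⟨y, hy⟩ := exists_notMem_of_finite
    (((Set.finite_range Δ₂).insert 0).insert (-(β : UnitAddCircle)))
  simp only [Set.mem_insert_iff, not_or] at hx hy
  refine ⟨(x, y), ?_⟩
  rw [show f = fun p => f₁ p.1 + f₂ p.2 + g p + γ * heisenbergFun α β p from funext hf]
  have c1 : ContinuousAt (fun p : TwoTorus => f₁ p.1) (x, y) :=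
    ContinuousAt.comp (f := Prod.fst) (not_not.1 fun h => hx.2 ((hd₁.2.1 x).1 h)) continuousAt_fst
  have c2 : ContinuousAt (fun p : TwoTorus => f₂ p.2) (x, y) :=
    ContinuousAt.comp (f := Prod.snd) (not_not.1 fun h => hy.2.2 ((hd₂.2.1 y).1 h)) continuousAt_snd
  have c3 : ContinuousAt (heisenbergFun α β) (x, y) :=
    continuousAt_heisenbergFun hx.1 hy.2.1 fun h => hy.1 (eq_neg_of_add_eq_zero_left h)
  exact ((c1.add c2).add hg.continuousAt).add (c3.const_mul γ)

theorem isCompact_annulus (b B : ℝ) : IsCompact {ρ : ℝ | b ≤ |ρ| ∧ |ρ| ≤ B} := by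
  refine (isCompact_Icc (a := -B) (b := B)).of_isClosed_subset ?_ fun ρ hρ => abs_le.1 hρ.2
  exact (isClosed_le continuous_const continuous_abs).inter
    (isClosed_le continuous_abs continuous_const)

theorem not_countable_Ioi (a : ℝ) : ¬ (Set.Ioi a).Countable := fun h => by
  simpa using h.measure_zero (volume : Measure ℝ)

end

theorem theorem7p4 (α β : ℝ) (hα : α ∈ Set.Ico (0 : ℝ) 1) (hβ : β ∈ Set.Ico (0 : ℝ) 1)
    (hαbpq : HasBoundedPartialQuotients α) (hβbpq : HasBoundedPartialQuotients β)
    (hT : Ergodic (torusRotation α β) (volume : Measure TwoTorus))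
    (f₁ f₂ : UnitAddCircle → ℝ) (g : TwoTorus → ℝ) (γ : ℝ) (f : TwoTorus → ℝ)
    (hf : ∀ p : TwoTorus, f p = f₁ p.1 + f₂ p.2 + g p + γ * heisenbergFun α β p)
    (hfpos : ∀ p : TwoTorus, 0 < f p)
    (hf₁ : IsPiecewiseContDiff 2 f₁) (hf₂ : IsPiecewiseContDiff 2 f₂)
    (hf₁disc : ¬ Continuous f₁) (hf₂disc : ¬ Continuous f₂)
    (hg : IsTorusContDiff 2 g)
    (s₁ s₂ : ℕ) (Δ₁ : Fin s₁ → UnitAddCircle) (Δ₂ : Fin s₂ → UnitAddCircle)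
    (d₁ : Fin s₁ → ℝ) (d₂ : Fin s₂ → ℝ)
    (hd₁ : HasDiscontinuities f₁ Δ₁ d₁) (hd₂ : HasDiscontinuities f₂ Δ₂ d₂)
    (hd : LinearIndependent ℚ (Sum.elim d₁ d₂))
    (hcase : (LinearIndependent ℚ (Sum.elim (fun _ : Unit => γ) (Sum.elim d₁ d₂)) ∧
        (∑ j, d₁ j - β * γ ≠ 0 ∨ ∑ j, d₂ j + α * γ ≠ 0)) ∨ γ = 0) :
    HasWeakRatnerProperty (specialFlowMeasure (volume : Measure TwoTorus) f)
      (specialFlow (torusRotation α β) f) := by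
  obtain ⟨c₁, hc₁, hα₁⟩ := hαbpq.badlyApproximable
  obtain ⟨c₂, hc₂, hβ₁⟩ := hβbpq.badlyApproximable
  have hc : 0 < min c₁ c₂ := lt_min hc₁ hc₂
  have hα' := hα₁.mono (min_le_left c₁ c₂)
  have hβ' := hβ₁.mono (min_le_right c₁ c₂)
  have hmin : UniformlyMinimal (torusMk (α, β)) := uniformlyMinimal_of_ergodic hT
  obtain ⟨F₁, C₁, B₁, hC₁, hF₁, hlip₁, hsec₁⟩ := exists_regular_part hf₁ hd₁
  obtain ⟨F₂, C₂, B₂, hC₂, hF₂, hlip₂, hsec₂⟩ := exists_regular_part hf₂ hd₂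
  have hF₁c := continuous_of_circle_lipschitz hlip₁ hC₁
  have hF₂c := continuous_of_circle_lipschitz hlip₂ hC₂
  obtain ⟨Cg, -, hglip, -⟩ := hg.bounds
  have hgc : Continuous g := continuous_of_torus_lipschitz hglip
  have hmeas : Measurable f := by
    rw [show f = fun p => f₁ p.1 + f₂ p.2 + g p + γ * heisenbergFun α β p from funext hf]
    exact ((((measurable_of_jumps hF₁c hF₁).comp measurable_fst).add
      ((measurable_of_jumps hF₂c hF₂).comp measurable_snd)).add hgc.measurable).add
      ((measurable_heisenbergFun α β).const_mul γ)
  obtain ⟨D, hD⟩ : ∃ D, ∀ p, f p ≤ D := by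
    obtain ⟨D₁, hD₁⟩ := bddAbove_of_jumps hF₁c hF₁
    obtain ⟨D₂, hD₂⟩ := bddAbove_of_jumps hF₂c hF₂
    obtain ⟨D₃, hD₃⟩ := isCompact_univ.bddAbove_image hgc.continuousOn
    refine ⟨D₁ + D₂ + D₃ + |γ| * 3, fun p => ?_⟩
    have h3 : γ * heisenbergFun α β p ≤ |γ| * 3 := (le_abs_self _).trans (by
      rw [abs_mul]
      exact mul_le_mul_of_nonneg_left (heisenbergFun_abs_le hα hβ p) (abs_nonneg _))
    rw [hf]
    linarith [hD₁ p.1, hD₂ p.2, hD₃ (Set.mem_image_of_mem g (Set.mem_univ p))]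
  obtain ⟨q, hq⟩ := exists_continuousAt_roof hf hgc hd₁ hd₂
  obtain ⟨a, r, ha, hr, hball⟩ := exists_ball_le_of_continuousAt hq (hfpos q)
  obtain ⟨c, hc', C, hlow⟩ := hmin.linear_growth (fun p => (hfpos p).le) ha hr hball
  obtain ⟨b, B, κ, S, A, hb, hκ, hS, hwin⟩ := exists_drift_window (f := f) hα hβ hc hα' hβ'
    (hd₁.pos hf₁disc) (hd₂.pos hf₂disc) (combinationsAway hd (hcase.imp And.left id))
    (fun A e hA he => orbitSum_regular_sub_small hc hα' hβ' hmin hC₁ hC₂ hlip₁ hlip₂ hsec₁ hsec₂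
      hg hA he)
    (Δ₁ := Δ₁) (Δ₂ := Δ₂) (fun p h1 h2 => by
      rw [hf, hF₁ p.1 fun ⟨j, hj⟩ => h1 j hj.symm, hF₂ p.2 fun ⟨j, hj⟩ => h2 j hj.symm]
      ring)
  refine ⟨{ρ | b ≤ |ρ| ∧ |ρ| ≤ B}, isCompact_annulus b B, fun h => ?_, fun hcount => ?_⟩
  · have := h.1
    rw [abs_zero] at this
    exact this.not_gt hb
  · refine not_countable_Ioi D (hcount.mono fun t ht => ?_)
    have hDt : D < t := ht
    refine ⟨((hfpos 0).trans_le (hD 0)).trans hDt |>.ne', ?_⟩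
    refine hasRatnerProperty_of_window (Δ₁ := Δ₁) (Δ₂ := Δ₂) hfpos hD hc' (le_max_right C 0) (fun n p => ?_) hκ hS
      (lt_max_of_lt_right one_pos) (A := max A 1) (fun e he η hη => ?_) hDt _
      (fun ε hε η hη => exists_large_good_set hmeas hfpos (fun p => (hD p).trans hDt.le) hε hη)
    · exact (sub_le_sub_left (le_max_left C 0) _).trans (hlow n p)
    · obtain ⟨δ, hδ, h⟩ := hwin e he η hη
      refine ⟨δ, hδ, fun p w h1 h2 h3 h4 h5 h6 => ?_⟩
      obtain ⟨M, L, σ, ρ, g1, g2, g3, g4, g5⟩ := h p w h1 h2 h3 h4 h5 h6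
      exact ⟨M, L, σ, ρ, g1, g2, g3, g4.trans (le_max_left A 1), g5⟩
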